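/- **Unique continuation at infinity.** Let $(M,g)$ be a smooth Riemannian manifold (without boundary, Hausdorff, second countable; neither completeness nor any curvature bound is assumed), let $\phi:M\to\mathbf R$ be smooth, and let $\mathcal L_\phi u=\Delta u-\langle\nabla u,\nabla\phi\rangle$ be the drift Laplacian on $\mathbf R^N$-valued functions. Let $W^{1,2}_\phi$ be the closure of the smooth compactly supported $\mathbf R^N$-valued functions for the norm $\left(\int_M(|f|^2+|\nabla f|^2)\,e^{-\phi}\right)^{1/2}$. (When $M$ is complete, a smooth function lies in $W^{1,2}_\phi$ as soon as this norm is finite.) Let $a\in\mathbf R$, let $C:[a,\infty)\to\mathbf R$ satisfy $\sup C+\int_a^\infty C^2(s)\,ds<\infty$, and let $u:M\times[a,\infty)\to\mathbf R^N$ be smooth, with $u(\cdot,t),\,u_t(\cdot,t)\in W^{1,2}_\phi$ for every $t\ge a$ and $$\int_a^b\left(\|u(\cdot,t)\|_{W^{1,2}_\phi}^2+\|u_t(\cdot,t)\|_{W^{1,2}_\phi}^2\right)dt<\infty\quad\text{for every } b\ge a .$$ Suppose that on $M\times[a,\infty)$ $$|(\partial_t-\mathcal L_\phi)u|\le C(t)\,(|u|+|\nabla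 u|),$$ and that $u$ vanishes to infinite order at $\infty$: with $I(t)=\int_M|u(\cdot,t)|^2e^{-\phi}$, one has $\lim_{t\to\infty}e^{ct}I(t)=0$ for every constant $c\in\mathbf R$. Then $u\equiv0$. **Unique continuation for the heat operator on $\mathbf R^n$.** Let $T>0$, let $C$ be a constant, and let $u:\mathbf R^n\times[-T,0)\to\mathbf R$ be smooth with $$|u_t-\Delta u|\le C\,(|u|+|\nabla u|).$$ Put $w(x,s)=u(e^{-s/2}x,-e^{-s})$ for $s\ge a:=-\log T$ and $\|f\|^2=\int_{\mathbf R^n}(|f|^2+|\nabla f|^2)\,e^{-|x|^2/4}\,dx$. Suppose that $\|w(\cdot,s)\|$ and $\|w_s(\cdot,s)\|$ are finite for every $s\ge a$, and that $\int_a^b(\|w(\cdot,s)\|^2+\|w_s(\cdot,s)\|^2)\,ds<\infty$ for every $b\ge a$. Suppose that $u$ vanishes to infinite order at the space-time origin, in the sense that for every $k\in\mathbf R$ $$\lim_{t\to0^-}(-t)^{-k}\,(-4\pi t)^{-n/2}\int_{\mathbf R^n}u^2(y,t)\,e^{|y|^2/(4t)}\,dy=0 .$$ Then $u\equiv0$ on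 $\mathbf R^n\times[-T,0)$. -/

import Mathlib

open MeasureTheory Set Filter Topology
open scoped Manifold ContDiff RealInnerProductSpace ENNReal

noncomputable section

namespace DriftHeat

section Coordinates

variable {n : ℕ} {M : Type*} [TopologicalSpace M]
  [ChartedSpace (EuclideanSpace ℝ (Fin n)) M]
  {F : Type*} [NormedAddCommGroup F] [InnerProductSpace ℝ F]

/-- The Gram matrix `(g_ij)` of a Riemannian metric in the chart `c`, at the point of coordinates
`y`: the scalar products of the coordinate vector fields `∂_i`, `∂_j`. -/
def gram (g : Bundle.RiemannianMetric (fun x : M ↦ TangentSpace (𝓡 n) x))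
    (c : OpenPartialHomeomorph M (EuclideanSpace ℝ (Fin n))) (y : EuclideanSpace ℝ (Fin n)) :
    Matrix (Fin n) (Fin n) ℝ :=
  Matrix.of fun i j ↦
    g.inner (c.symm y)
      (mfderiv (𝓡 n) (𝓡 n) c.symm y (EuclideanSpace.single i (1 : ℝ)))
      (mfderiv (𝓡 n) (𝓡 n) c.symm y (EuclideanSpace.single j (1 : ℝ)))

/-- The volume density `√(det g_ij)` in the chart `c`. -/
def volDensity (g : Bundle.RiemannianMetric (fun x : M ↦ TangentSpace (𝓡 n) x))
    (c : OpenPartialHomeomorph M (EuclideanSpace ℝ (Fin n))) (y : EuclideanSpace ℝ (Fin n)) : ℝ :=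
  √(gram g c y).det

/-- The partial derivative `∂_i f` in the chart `c`, at the point of coordinates `y`. -/
def partialIn (c : OpenPartialHomeomorph M (EuclideanSpace ℝ (Fin n))) (f : M → F) (i : Fin n)
    (y : EuclideanSpace ℝ (Fin n)) : F :=
  fderiv ℝ (f ∘ c.symm) y (EuclideanSpace.single i (1 : ℝ))

/-- The squared length `|∇f|² = ∑_ij g^ij ⟨∂_i f, ∂_j f⟩` of the gradient of a vector-valued
function. -/
def gradSq (g : Bundle.RiemannianMetric (fun x : M ↦ TangentSpace (𝓡 n) x)) (f : M → F) (x : M) :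
    ℝ :=
  let c := chartAt (EuclideanSpace ℝ (Fin n)) x
  ∑ i, ∑ j, (gram g c (c x))⁻¹ i j * ⟪partialIn c f i (c x), partialIn c f j (c x)⟫

/-- `⟨∇f, ∇φ⟩ = ∑_ij g^ij (∂_j φ) ∂_i f`, for a vector-valued function `f` and a scalar `φ`. -/
def gradPairing (g : Bundle.RiemannianMetric (fun x : M ↦ TangentSpace (𝓡 n) x)) (f : M → F)
    (φ : M → ℝ) (x : M) : F :=
  let c := chartAt (EuclideanSpace ℝ (Fin n)) x
  ∑ i, ∑ j, ((gram g c (c x))⁻¹ i j * partialIn c φ j (c x)) • partialIn c f i (c x)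

/-- The Laplace-Beltrami operator
`Δ f = (det g)^(-1/2) ∑_ij ∂_i ((det g)^(1/2) g^ij ∂_j f)`. -/
def laplaceBeltrami (g : Bundle.RiemannianMetric (fun x : M ↦ TangentSpace (𝓡 n) x)) (f : M → F)
    (x : M) : F :=
  let c := chartAt (EuclideanSpace ℝ (Fin n)) x
  (volDensity g c (c x))⁻¹ •
    ∑ i, fderiv ℝ (fun z ↦ ∑ j, (volDensity g c z * (gram g c z)⁻¹ i j) • partialIn c f j z)
      (c x) (EuclideanSpace.single i (1 : ℝ))

/-- The drift Laplacian `L_φ f = Δ f - ⟨∇f, ∇φ⟩`. -/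
def driftLaplacian (g : Bundle.RiemannianMetric (fun x : M ↦ TangentSpace (𝓡 n) x)) (φ : M → ℝ)
    (f : M → F) (x : M) : F :=
  laplaceBeltrami g f x - gradPairing g f φ x

/-- The Riemannian measure carried by the domain of one chart: the measure `√(det g_ij) dy` on the
image of the chart, transported to the manifold. -/
def chartVolume [MeasurableSpace M]
    (g : Bundle.RiemannianMetric (fun x : M ↦ TangentSpace (𝓡 n) x))
    (c : OpenPartialHomeomorph M (EuclideanSpace ℝ (Fin n))) : Measure M :=
  ((volume.restrict c.target).withDensity fun y ↦ ENNReal.ofReal (volDensity g c y)).map c.symm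

/-- The Riemannian measure. The measures carried by two chart domains agree on the intersection of
these, so (on a second countable manifold) their supremum is the unique measure on `M` that is
`√(det g_ij) dy` in each of the charts. -/
def riemannianVolume [MeasurableSpace M]
    (g : Bundle.RiemannianMetric (fun x : M ↦ TangentSpace (𝓡 n) x)) : Measure M :=
  ⨆ x : M, chartVolume g (chartAt (EuclideanSpace ℝ (Fin n)) x)

/-- The weighted measure `e^(-φ) dvol`. -/
def weightedVolume [MeasurableSpace M]
    (g : Bundle.RiemannianMetric (fun x : M ↦ TangentSpace (𝓡 n) x)) (φ : M → ℝ) : Measure M :=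
  (riemannianVolume g).withDensity fun x ↦ ENNReal.ofReal (Real.exp (-φ x))

/-- The squared Sobolev norm `∫ (|f|² + |∇f|²) e^(-φ)`, of a smooth function; it may be infinite. -/
def sobolevSq [MeasurableSpace M]
    (g : Bundle.RiemannianMetric (fun x : M ↦ TangentSpace (𝓡 n) x)) (φ : M → ℝ) (f : M → F) :
    ℝ≥0∞ :=
  ∫⁻ x, ENNReal.ofReal (‖f x‖ ^ 2 + gradSq g f x) ∂(weightedVolume g φ)

/-- Membership of a smooth function in the weighted Sobolev space `W^{1,2}_φ`, the closure of the
smooth functions of compact support for the norm `∫ (|f|² + |∇f|²) e^(-φ)`. This is the space on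
which `L_φ` is self-adjoint; when the manifold is complete, it contains all the smooth functions of
finite norm. -/
def MemW12 [MeasurableSpace M]
    (g : Bundle.RiemannianMetric (fun x : M ↦ TangentSpace (𝓡 n) x)) (φ : M → ℝ) (f : M → F) :
    Prop :=
  sobolevSq g φ f < ⊤ ∧
    ∃ w : ℕ → M → F,
      (∀ k, ContMDiff (𝓡 n) 𝓘(ℝ, F) ∞ (w k) ∧ HasCompactSupport (w k)) ∧
      Tendsto (fun k ↦ sobolevSq g φ (fun x ↦ f x - w k x)) atTop (𝓝 0)

/-- The time derivative `u_t` on `M × [a, ∞)`, one-sided at `t = a`. -/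
def timeDeriv (a : ℝ) (u : M → ℝ → F) (x : M) (t : ℝ) : F :=
  derivWithin (fun τ ↦ u x τ) (Ici a) t

/-- The growth condition on `u : M × [a, ∞) → F`: both `u` and `u_t` lie in `W^{1,2}_φ` for each
time, with norms that are square integrable over bounded intervals of time. -/
def SobolevGrowth [MeasurableSpace M]
    (g : Bundle.RiemannianMetric (fun x : M ↦ TangentSpace (𝓡 n) x)) (φ : M → ℝ) (a : ℝ)
    (u : M → ℝ → F) : Prop :=
  (∀ t, a ≤ t → MemW12 g φ (fun x ↦ u x t) ∧ MemW12 g φ (fun x ↦ timeDeriv a u x t)) ∧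
  ∀ b, ∫⁻ t in Icc a b,
    (sobolevSq g φ (fun x ↦ u x t) + sobolevSq g φ (fun x ↦ timeDeriv a u x t)) < ⊤

/-- `I(t) = ∫ |u(·,t)|² e^(-φ)`. -/
def energy [MeasurableSpace M]
    (g : Bundle.RiemannianMetric (fun x : M ↦ TangentSpace (𝓡 n) x)) (φ : M → ℝ)
    (u : M → ℝ → F) (t : ℝ) : ℝ :=
  ∫ x, ‖u x t‖ ^ 2 ∂(weightedVolume g φ)

/-- `u` vanishes to infinite order at `∞`. -/
def VanishesToInfiniteOrder [MeasurableSpace M]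
    (g : Bundle.RiemannianMetric (fun x : M ↦ TangentSpace (𝓡 n) x)) (φ : M → ℝ)
    (u : M → ℝ → F) : Prop :=
  ∀ c : ℝ, Tendsto (fun t ↦ Real.exp (c * t) * energy g φ u t) atTop (𝓝 0)

end Coordinates

section Euclidean

variable {n : ℕ}

/-- The function `w(x, s) = u(e^(-s/2) x, -e^(-s))`, that is, `u` in self-similar variables. -/
def selfSimilar (u : EuclideanSpace ℝ (Fin n) → ℝ → ℝ) (x : EuclideanSpace ℝ (Fin n)) (s : ℝ) : ℝ :=
  u (Real.exp (-s / 2) • x) (-Real.exp (-s))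

/-- The squared Gaussian Sobolev norm `∫ (|f|² + |∇f|²) e^(-|x|²/4) dx` on Euclidean space. -/
def gaussSobolevSq (f : EuclideanSpace ℝ (Fin n) → ℝ) : ℝ≥0∞ :=
  ∫⁻ x, ENNReal.ofReal ((f x ^ 2 + ‖gradient f x‖ ^ 2) * Real.exp (-(‖x‖ ^ 2 / 4)))

/-- The growth condition for `w : ℝⁿ × [a, ∞) → ℝ` and the Gaussian weight: both `w` and `w_s` have
finite Gaussian Sobolev norm for each `s`, square integrable over bounded intervals of `s`. -/
def GaussGrowth (a : ℝ) (w : EuclideanSpace ℝ (Fin n) → ℝ → ℝ) : Prop :=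
  (∀ s, a ≤ s → gaussSobolevSq (fun x ↦ w x s) < ⊤ ∧
    gaussSobolevSq (fun x ↦ derivWithin (fun σ ↦ w x σ) (Ici a) s) < ⊤) ∧
  ∀ b, ∫⁻ s in Icc a b, (gaussSobolevSq (fun x ↦ w x s) +
    gaussSobolevSq (fun x ↦ derivWithin (fun σ ↦ w x σ) (Ici a) s)) < ⊤

/-- Poon's weighted energy `(-4πt)^(-n/2) ∫ u(y,t)² e^(|y|²/(4t)) dy`, at a time `t < 0`. -/
def poonEnergy (u : EuclideanSpace ℝ (Fin n) → ℝ → ℝ) (t : ℝ) : ℝ :=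
  (4 * Real.pi * (-t)) ^ (-(n : ℝ) / 2) *
    ∫ y, u y t ^ 2 * Real.exp (-(‖y‖ ^ 2 / (4 * (-t))))

end Euclidean

end DriftHeat

end

set_option linter.unusedSectionVars false

noncomputable section

namespace DriftHeat

/-! ### The frequency argument for two energies on a half-line -/

section Abstract

/-! Put I(t) = ∫ |u|² e^(-φ) and E(t) = ∫ |∇u|² e^(-φ), and write L for the drift Laplacian of u.
Integration by parts for the weight gives ∫ ⟨L, u⟩ = -E, and formally I' = 2 ∫ ⟨u, u_t⟩ and E' = -2
∫ ⟨L, u_t⟩. If u_t = L, Cauchy-Schwarz makes the frequency E / I nonincreasing. In general the error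
satisfies ‖u_t - L‖² ≤ 2 C² (I + E); polarization, 4⟨L, u_t⟩ = |u_t + L|² - |u_t - L|², and
Cauchy-Schwarz for u and u_t + L yield E' I - E I' ≤ C² (I + E) I, which says (log (1 + E / I))' ≤
C². Since ∫ C² is finite the frequency stays bounded. As sup C is finite, I' ≥ -k (I + E) for some
constant k, hence I' ≥ -c I. So I decays at most exponentially once it is positive somewhere, which
contradicts vanishing to infinite order. The Hilbert space inequalities are `frequency_inner_ineq`
and `frequency_inner_lower`; the ODE argument is `eq_zero_of_frequency`.

Two points need care. The integrations by parts must hold without completeness of M: they are proved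
for compactly supported functions and extended by density to the closure W^{1,2} in
`integral_inner_driftLaplacian_of_memW12`, for which L must be square integrable; this follows from
the inequality, since u_t and u_t - L both are. And the Sobolev norms are only square integrable in
time, so I and E are merely absolutely continuous; their derivative formulas are used in integrated
form, by Fubini (`integral_sub_eq_intervalIntegral`).

All objects are defined through the preferred chart at each point, so chart independence is
required. First order objects follow from the transformation rule of the Gram matrix; the drift
Laplacian is handled by its weak form (`driftIn_eq_of_mem_source`).

For the heat operator on Euclidean space, the self-similar change of variables turns ∂_t - Δ into
∂_s - L_φ with φ = |x|²/4, turns C into a multiple of e^(-s) + e^(-s/2), which is square integrable,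
and turns Poon's energy into a multiple of I. The first theorem then applies. -/

theorem frequency_inner_ineq {H : Type*} [NormedAddCommGroup H] [InnerProductSpace ℝ H]
    {P Q L : H} {E γ ε : ℝ} (hε : 0 ≤ ε) (hf : ‖Q - L‖ ^ 2 ≤ 2 * γ * (‖P‖ ^ 2 + E))
    (hL : ⟪L, P⟫ = -E) :
    (-2 * ⟪L, Q⟫) * (‖P‖ ^ 2 + ε) - E * (2 * ⟪P, Q⟫) ≤
      γ * (‖P‖ ^ 2 + E) * (‖P‖ ^ 2 + ε) := by
  -- With x = ⟪P, Q⟫, Cauchy-Schwarz gives (x - E)² ≤ ‖P‖² ‖Q + L‖², and 4xE = (x + E)² - (x - E)².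
  -- The two squares of x - E cancel and (x + E)² has the favourable sign.
  have hCS := real_inner_mul_inner_self_le P (Q + L)
  have h1 : ⟪Q + L, Q + L⟫ = ⟪Q, Q⟫ + 2 * ⟪L, Q⟫ + ⟪L, L⟫ := by
    rw [real_inner_add_add_self, real_inner_comm L Q]
  have h2 : ‖Q - L‖ ^ 2 = ⟪Q, Q⟫ - 2 * ⟪L, Q⟫ + ⟪L, L⟫ := by
    rw [← real_inner_self_eq_norm_sq, real_inner_sub_sub_self, real_inner_comm L Q]
  have h3 : ⟪P, Q + L⟫ = ⟪P, Q⟫ - E := by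
    rw [inner_add_right, real_inner_comm L P, hL]; ring
  have h4 : 0 ≤ ⟪Q + L, Q + L⟫ := real_inner_self_nonneg
  have h5 : ⟪P, P⟫ = ‖P‖ ^ 2 := real_inner_self_eq_norm_sq P
  rw [h3, h5] at hCS
  set p := ‖P‖ ^ 2
  have hp : 0 ≤ p := sq_nonneg _
  set A := ⟪Q + L, Q + L⟫
  set B := ‖Q - L‖ ^ 2
  have h6 : 4 * ⟪L, Q⟫ = A - B := by rw [h1, h2]; ring
  have h7 : B * (p + ε) ≤ 2 * γ * (p + E) * (p + ε) :=
    mul_le_mul_of_nonneg_right hf (by linarith)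
  have h8 : 0 ≤ A * ε := mul_nonneg h4 hε
  nlinarith [sq_nonneg (⟪P, Q⟫ + E)]

/-- Since ⟪P, Q⟫ = ⟪P, Q - L⟫ - E, only the error Q - L has to be estimated. This bounds the decay
rate of I from above. -/
theorem frequency_inner_lower {H : Type*} [NormedAddCommGroup H] [InnerProductSpace ℝ H]
    {P Q L : H} {E K : ℝ} (hf : ‖Q - L‖ ^ 2 ≤ 2 * K * (‖P‖ ^ 2 + E))
    (hL : ⟪L, P⟫ = -E) :
    -(2 + 2 * K) * (‖P‖ ^ 2 + E) ≤ 2 * ⟪P, Q⟫ := by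
  have h1 : ⟪P, Q⟫ = ⟪P, Q - L⟫ - E := by
    rw [inner_sub_right, real_inner_comm L P, hL]; ring
  have h2 := abs_le.1 (abs_real_inner_le_norm P (Q - L))
  nlinarith [sq_nonneg (‖P‖ - ‖Q - L‖), sq_nonneg ‖P‖]

/-- The logarithm is Lipschitz with constant ε⁻¹ on [ε, ∞). -/
theorem AbsolutelyContinuousOnInterval.log_comp {f : ℝ → ℝ} {a b ε : ℝ} (hε : 0 < ε)
    (hf : AbsolutelyContinuousOnInterval f a b) (hpos : ∀ x ∈ uIcc a b, ε ≤ f x) :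
    AbsolutelyContinuousOnInterval (fun x ↦ Real.log (f x)) a b := by
  have hlip : ∀ x y : ℝ, ε ≤ x → ε ≤ y → Real.log x - Real.log y ≤ ε⁻¹ * |x - y| := by
    intro x y hx hy
    have hx0 := hε.trans_le hx
    have hy0 := hε.trans_le hy
    rw [← Real.log_div hx0.ne' hy0.ne']
    calc Real.log (x / y) ≤ x / y - 1 := Real.log_le_sub_one_of_pos (by positivity)
      _ = y⁻¹ * (x - y) := by field_simp
      _ ≤ y⁻¹ * |x - y| := by gcongr; exact le_abs_self _
      _ ≤ ε⁻¹ * |x - y| := by gcongr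
  have h2 : Tendsto _ _ _ := hf
  have h3 := h2.const_mul ε⁻¹
  rw [mul_zero] at h3
  refine squeeze_zero' ?_ ?_ h3
  · exact Eventually.of_forall fun _ ↦ Finset.sum_nonneg fun _ _ ↦ dist_nonneg
  · rw [eventually_inf_principal]
    refine Eventually.of_forall fun D hD ↦ ?_
    rw [Finset.mul_sum]
    refine Finset.sum_le_sum fun i hi ↦ ?_
    have hx := hpos _ (hD.1 i hi).1
    have hy := hpos _ (hD.1 i hi).2
    rw [Real.dist_eq, Real.dist_eq, abs_le]
    constructor
    · have := hlip _ _ hy hx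
      rw [abs_sub_comm] at this; linarith
    · exact hlip _ _ hx hy

theorem AbsolutelyContinuousOnInterval.le_of_ae_deriv_nonpos {f : ℝ → ℝ} {a b : ℝ} (hab : a ≤ b)
    (hf : AbsolutelyContinuousOnInterval f a b) {f' : ℝ → ℝ}
    (hd : ∀ᵐ x, x ∈ Ioc a b → HasDerivAt f (f' x) x) (hle : ∀ x ∈ Ioc a b, f' x ≤ 0) :
    f b ≤ f a := by
  rw [← sub_nonpos, ← hf.integral_deriv_eq_sub, intervalIntegral.integral_of_le hab]
  refine setIntegral_nonpos_of_ae_restrict ?_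
  rw [EventuallyLE, ae_restrict_iff' measurableSet_Ioc]
  filter_upwards [hd] with x hx hxm
  rw [(hx hxm).deriv]; exact hle x hxm

/-- An indefinite integral is absolutely continuous, and Lebesgue's theorem differentiates it almost
everywhere. -/
theorem ac_of_sub_eq_integral {I h : ℝ → ℝ} {s t : ℝ} (hst : s ≤ t)
    (hh : IntervalIntegrable h volume s t)
    (hI : ∀ x ∈ Icc s t, I x - I s = ∫ τ in s..x, h τ) :
    AbsolutelyContinuousOnInterval I s t ∧ ∀ᵐ x, x ∈ Ioc s t → HasDerivAt I (h x) x := by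
  have hac := hh.absolutelyContinuousOnInterval_intervalIntegral (c := s) (by simp)
  have heq : ∀ x ∈ Icc s t, I x = (∫ τ in s..x, h τ) + I s := fun x hx ↦ by
    rw [← hI x hx]; ring
  constructor
  · have h2 : AbsolutelyContinuousOnInterval (fun _ : ℝ ↦ I s) s t :=
      contDiffOn_const.absolutelyContinuousOnInterval
    have h3 : Tendsto _ _ _ := hac.add h2
    refine Tendsto.congr' ?_ h3
    rw [EventuallyEq, eventually_inf_principal]
    refine Eventually.of_forall fun D hD ↦ Finset.sum_congr rfl fun i hi ↦ ?_
    have := hD.1 i hi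
    rw [uIcc_of_le hst] at this
    rw [heq _ this.1, heq _ this.2]; rfl
  -- The endpoint t is discarded: I is compared with the primitive only on [s, t], which does not
  -- determine a two-sided derivative at t.
  · have hne : ∀ᵐ x : ℝ, x ≠ t := by simp [ae_iff, measure_singleton]
    filter_upwards [hh.ae_hasDerivAt_integral, hne] with x hx hxt hxm
    rw [uIcc_of_le hst] at hx
    have h3 := (hx (Ioc_subset_Icc_self hxm) s (left_mem_Icc.2 hst)).add_const (I s)
    refine h3.congr_of_eventuallyEq ?_
    filter_upwards [Icc_mem_nhds hxm.1 (lt_of_le_of_ne hxm.2 hxt)] with y hy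
    exact heq y hy

/-- Here h and e play the roles of I' and E'. Adding ε to I allows logarithms before I is known to
stay positive after t₀; the bounds obtained do not depend on ε, which then tends to 0. -/
theorem eq_zero_of_frequency {a : ℝ} {I E h e γ : ℝ → ℝ} {K : ℝ} (hK : 0 ≤ K)
    (hh : ∀ s t, a < s → s ≤ t → IntervalIntegrable h volume s t ∧ I t - I s = ∫ τ in s..t, h τ)
    (he : ∀ s t, a < s → s ≤ t → IntervalIntegrable e volume s t ∧ E t - E s = ∫ τ in s..t, e τ)
    (hI0 : ∀ t, a < t → 0 ≤ I t) (hE0 : ∀ t, a < t → 0 ≤ E t)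
    (hγ : IntegrableOn γ (Ioi a)) (hγ0 : ∀ t, a < t → 0 ≤ γ t)
    (hfreq : ∀ t, a < t → ∀ ε, 0 < ε →
      e t * (I t + ε) - E t * h t ≤ γ t * (I t + E t) * (I t + ε))
    (hlow : ∀ t, a < t → -K * (I t + E t) ≤ h t)
    (hvan : ∀ c : ℝ, Tendsto (fun t ↦ Real.exp (c * t) * I t) atTop (𝓝 0)) :
    ∀ t, a < t → I t = 0 := by
  intro t₀ ht₀
  by_contra hne
  have hpos : 0 < I t₀ := lt_of_le_of_ne (hI0 t₀ ht₀) (Ne.symm hne)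
  set G := ∫ τ in Ioi a, γ τ
  set R := (1 + E t₀ / I t₀) * Real.exp G
  have hR : 0 ≤ R := by have := hE0 t₀ ht₀; positivity
  -- the frequency stays bounded
  have hfb : ∀ t, t₀ ≤ t → ∀ ε, 0 < ε → I t + ε + E t ≤ R * (I t + ε) := by
    intro t ht ε hε
    have hgt : ∀ x ∈ Icc t₀ t, a < x := fun x hx ↦ ht₀.trans_le hx.1
    have hx1 := ac_of_sub_eq_integral ht (hh t₀ t ht₀ ht).1
      (fun x hx ↦ (hh t₀ x ht₀ hx.1).2)
    have hx2 := ac_of_sub_eq_integral ht (he t₀ t ht₀ ht).1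
      (fun x hx ↦ (he t₀ x ht₀ hx.1).2)
    have hγi : IntervalIntegrable γ volume t₀ t := by
      rw [intervalIntegrable_iff_integrableOn_Ioc_of_le ht]
      exact hγ.mono_set fun x hx ↦ ht₀.trans hx.1
    have hx3 := ac_of_sub_eq_integral (I := fun x ↦ ∫ τ in t₀..x, γ τ) ht hγi (fun x hx ↦ by simp)
    have hc : AbsolutelyContinuousOnInterval (fun _ : ℝ ↦ ε) t₀ t :=
      contDiffOn_const.absolutelyContinuousOnInterval
    have hY := hx1.1.add hc
    have hX := hY.add hx2.1
    have hYpos : ∀ x ∈ uIcc t₀ t, ε ≤ (I + fun _ : ℝ ↦ ε : ℝ → ℝ) x := fun x hx ↦ by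
      rw [uIcc_of_le ht] at hx
      have := hI0 x (hgt x hx)
      simp only [Pi.add_apply]; linarith
    have hXpos : ∀ x ∈ uIcc t₀ t, ε ≤ ((I + fun _ : ℝ ↦ ε) + E : ℝ → ℝ) x := fun x hx ↦ by
      have h1 := hYpos x hx
      rw [uIcc_of_le ht] at hx
      have := hE0 x (hgt x hx)
      simp only [Pi.add_apply] at h1 ⊢; linarith
    have hZ := ((AbsolutelyContinuousOnInterval.log_comp hε hX hXpos).sub
      (AbsolutelyContinuousOnInterval.log_comp hε hY hYpos)).sub hx3.1
    -- The function log (1 + E / (I + ε)) - ∫ γ is nonincreasing: over the common denominator, the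
    -- derivative of the logarithm has the left side of `hfreq` as numerator.
    have hfin := AbsolutelyContinuousOnInterval.le_of_ae_deriv_nonpos ht hZ
      (f' := fun x ↦ (h x + e x) / (I x + ε + E x) - h x / (I x + ε) - γ x)
      (by
        filter_upwards [hx1.2, hx2.2, hx3.2] with x h1 h2 h3 hxm
        have hxm' : x ∈ uIcc t₀ t := by rw [uIcc_of_le ht]; exact Ioc_subset_Icc_self hxm
        have h4 := ((h1 hxm).add_const ε)
        have h5 := h4.add (h2 hxm)
        exact ((h5.log (hε.trans_le (hXpos x hxm')).ne').sub
          (h4.log (hε.trans_le (hYpos x hxm')).ne')).sub (h3 hxm))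
      (by
        intro x hxm
        have hax := ht₀.trans hxm.1
        have h1 := hI0 x hax
        have h2 := hE0 x hax
        have h3 := hfreq x hax ε hε
        have h4 := hγ0 x hax
        have h5 : 0 < I x + ε := by linarith
        have h6 : 0 < I x + ε + E x := by linarith
        rw [sub_nonpos, div_sub_div _ _ h6.ne' h5.ne', div_le_iff₀ (by positivity)]
        nlinarith [mul_nonneg h4 (mul_nonneg hε.le h5.le)])
    simp only [Pi.sub_apply, Pi.add_apply, intervalIntegral.integral_same, sub_zero] at hfin
    have hG : ∫ τ in t₀..t, γ τ ≤ G := by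
      rw [intervalIntegral.integral_of_le ht]
      refine setIntegral_mono_set hγ ?_ (ae_of_all _ fun x hx ↦ ht₀.trans hx.1)
      rw [EventuallyLE, ae_restrict_iff' measurableSet_Ioi]
      exact ae_of_all _ hγ0
    have h1 := hI0 t (ht₀.trans_le ht)
    have h2 := hE0 t (ht₀.trans_le ht)
    have h1' := hE0 t₀ ht₀
    have h3 : Real.log (I t + ε + E t) ≤
        Real.log ((I t₀ + ε + E t₀) / (I t₀ + ε) * Real.exp G * (I t + ε)) := by
      rw [Real.log_mul (by positivity) (by positivity), Real.log_mul (by positivity)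
        (by positivity), Real.log_exp, Real.log_div (by positivity) (by positivity)]
      linarith
    have h4 := (Real.log_le_log_iff (by positivity) (by positivity)).1 h3
    refine h4.trans ?_
    refine mul_le_mul_of_nonneg_right (mul_le_mul_of_nonneg_right ?_ (Real.exp_pos _).le)
      (by positivity)
    -- E t₀ / (I t₀ + ε) ≤ E t₀ / I t₀, which makes R independent of ε.
    rw [add_div, div_self (by positivity)]
    gcongr
    linarith
  clear_value R
  -- Bounded frequency turns the lower bound on h into h ≥ -K R (I + ε), so log (I + ε) falls at
  -- rate at most K R.
  have hgrow : ∀ t, t₀ ≤ t → I t₀ * Real.exp (-(K * R) * (t - t₀)) ≤ I t := by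
    intro t ht
    have key : ∀ ε, 0 < ε → I t₀ * Real.exp (-(K * R) * (t - t₀)) ≤ I t + ε := by
      intro ε hε
      have hgt : ∀ x ∈ Icc t₀ t, a < x := fun x hx ↦ ht₀.trans_le hx.1
      have hx1 := ac_of_sub_eq_integral ht (hh t₀ t ht₀ ht).1
        (fun x hx ↦ (hh t₀ x ht₀ hx.1).2)
      have hc : AbsolutelyContinuousOnInterval (fun _ : ℝ ↦ ε) t₀ t :=
        contDiffOn_const.absolutelyContinuousOnInterval
      have hY := hx1.1.add hc
      have hYpos : ∀ x ∈ uIcc t₀ t, ε ≤ (I + fun _ : ℝ ↦ ε : ℝ → ℝ) x := fun x hx ↦ by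
        rw [uIcc_of_le ht] at hx
        have := hI0 x (hgt x hx)
        simp only [Pi.add_apply]; linarith
      have hlin : AbsolutelyContinuousOnInterval (fun x : ℝ ↦ -(K * R) * (x - t₀)) t₀ t := by
        apply ContDiffOn.absolutelyContinuousOnInterval
        fun_prop
      have hfin := AbsolutelyContinuousOnInterval.le_of_ae_deriv_nonpos ht
        (hlin.sub (AbsolutelyContinuousOnInterval.log_comp hε hY hYpos))
        (f' := fun x ↦ -(K * R) - h x / (I x + ε))
        (by
          filter_upwards [hx1.2] with x h1 hxm
          have hxm' : x ∈ uIcc t₀ t := by rw [uIcc_of_le ht]; exact Ioc_subset_Icc_self hxm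
          have h4 := ((h1 hxm).add_const ε)
          have h5 := ((hasDerivAt_id x).sub_const t₀).const_mul (-(K * R))
          rw [mul_one] at h5
          exact h5.sub (h4.log (hε.trans_le (hYpos x hxm')).ne'))
        (by
          intro x hxm
          have hax := ht₀.trans hxm.1
          have h1 := hI0 x hax
          have h3 := hlow x hax
          have h4 := hfb x hxm.1.le ε hε
          have h5 : 0 < I x + ε := by linarith
          rw [sub_nonpos, le_div_iff₀ h5]
          nlinarith [mul_le_mul_of_nonneg_left h4 hK, mul_nonneg hK hε.le])
      simp only [Pi.sub_apply, Pi.add_apply, sub_self, mul_zero] at hfin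
      have h1 := hI0 t (ht₀.trans_le ht)
      have h3 : Real.log ((I t₀ + ε) * Real.exp (-(K * R) * (t - t₀))) ≤ Real.log (I t + ε) := by
        rw [Real.log_mul (by positivity) (by positivity), Real.log_exp]
        linarith
      have h4 := (Real.log_le_log_iff (by positivity) (by positivity)).1 h3
      refine le_trans ?_ h4
      gcongr
      linarith
    exact le_of_forall_pos_le_add key
  -- The exponent c = K R exactly compensates the slowest decay just proved, so e^(ct) I(t) stays
  -- above a positive constant.
  have h1 := hvan (K * R)
  have h2 : ∀ᶠ t in atTop, I t₀ * Real.exp (K * R * t₀) ≤ Real.exp (K * R * t) * I t := by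
    filter_upwards [eventually_ge_atTop t₀] with t ht
    calc I t₀ * Real.exp (K * R * t₀)
        = Real.exp (K * R * t) * (I t₀ * Real.exp (-(K * R) * (t - t₀))) := by
          rw [mul_left_comm, ← Real.exp_add]; congr 2; ring
      _ ≤ _ := by gcongr; exact hgrow t ht
  have h3 := ge_of_tendsto h1 h2
  have : 0 < I t₀ * Real.exp (K * R * t₀) := by positivity
  linarith

/-- The fundamental theorem of calculus at each x, followed by Fubini. No bound uniform in time is
needed to differentiate under the integral. -/
theorem integral_sub_eq_intervalIntegral {X : Type*} [MeasurableSpace X] {ν : Measure X}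
    [SFinite ν] {q r : X → ℝ → ℝ} {s t : ℝ} (hst : s ≤ t)
    (hd : ∀ x, ∀ τ ∈ Icc s t, HasDerivAt (q x) (r x τ) τ)
    (hc : ∀ x, ContinuousOn (r x) (Icc s t))
    (hr : Integrable (Function.uncurry r) (ν.prod (volume.restrict (Ioc s t))))
    (hqs : Integrable (fun x ↦ q x s) ν) (hqt : Integrable (fun x ↦ q x t) ν) :
    IntervalIntegrable (fun τ ↦ ∫ x, r x τ ∂ν) volume s t ∧
      ∫ x, q x t ∂ν - ∫ x, q x s ∂ν = ∫ τ in s..t, ∫ x, r x τ ∂ν := by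
  constructor
  · rw [intervalIntegrable_iff_integrableOn_Ioc_of_le hst]
    exact hr.integral_prod_right
  · rw [intervalIntegral.integral_of_le hst, ← integral_integral_swap hr, ← integral_sub hqt hqs]
    congr 1 with x
    rw [← intervalIntegral.integral_of_le hst]
    rw [intervalIntegral.integral_eq_sub_of_hasDerivAt]
    · rw [uIcc_of_le hst]; exact hd x
    · apply ContinuousOn.intervalIntegrable; rw [uIcc_of_le hst]; exact hc x

end Abstract

/-! ### Quadratic forms with vector-valued arguments, and congruence -/

section CoordinateChange

open Matrix

-- Factoring A = BᴴB writes the sum as ∑_k ‖∑_i B_ki d_i‖².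
open scoped MatrixOrder in
theorem sum_mul_inner_nonneg {ι F : Type*} [Fintype ι] [DecidableEq ι] [NormedAddCommGroup F]
    [InnerProductSpace ℝ F] {A : Matrix ι ι ℝ} (hA : A.PosSemidef) (d : ι → F) :
    0 ≤ ∑ i, ∑ j, A i j * ⟪d i, d j⟫ := by
  obtain ⟨B, rfl⟩ := CStarAlgebra.nonneg_iff_eq_star_mul_self.mp hA.nonneg
  rw [Matrix.star_eq_conjTranspose]
  have h : ∑ i, ∑ j, (Bᴴ * B) i j * ⟪d i, d j⟫ =
      ∑ k, ⟪∑ i, B k i • d i, ∑ j, B k j • d j⟫ := by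
    simp only [Matrix.mul_apply, Matrix.conjTranspose_apply, star_trivial, sum_inner, inner_sum,
      real_inner_smul_left, real_inner_smul_right, Finset.sum_mul]
    rw [Finset.sum_comm_cycle]
    refine Finset.sum_congr rfl fun k _ ↦ ?_
    rw [Finset.sum_comm]
    refine Finset.sum_congr rfl fun i _ ↦ Finset.sum_congr rfl fun j _ ↦ by ring
  rw [h]
  exact Finset.sum_nonneg fun k _ ↦ real_inner_self_nonneg

/-- The invariance of the scalar product of gradients under a change of coordinates with Jacobian J:
it rests on G⁻¹ = J (JᵀGJ)⁻¹ Jᵀ. -/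
theorem sum_inv_congruence {ι F : Type*} [Fintype ι] [DecidableEq ι] [NormedAddCommGroup F]
    [InnerProductSpace ℝ F] {G J : Matrix ι ι ℝ} (hJ : IsUnit J.det)
    (d e : ι → F) :
    ∑ i, ∑ j, (Jᵀ * G * J)⁻¹ i j * ⟪∑ k, J k i • d k, ∑ l, J l j • e l⟫ =
      ∑ k, ∑ l, G⁻¹ k l * ⟪d k, e l⟫ := by
  have hinv : G⁻¹ = J * (Jᵀ * G * J)⁻¹ * Jᵀ := by
    have hJ' : IsUnit (Jᵀ).det := by rwa [Matrix.det_transpose]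
    rw [Matrix.mul_inv_rev, Matrix.mul_inv_rev, ← mul_assoc J, Matrix.mul_nonsing_inv _ hJ, one_mul,
      mul_assoc, Matrix.nonsing_inv_mul _ hJ', mul_one]
  rw [hinv]
  set S := (Jᵀ * G * J)⁻¹
  have h1 : ∀ i j, S i j * ⟪∑ k, J k i • d k, ∑ l, J l j • e l⟫ =
      ∑ k, ∑ l, S i j * (J k i * J l j * ⟪d k, e l⟫) := fun i j ↦ by
    simp only [sum_inner, inner_sum, real_inner_smul_left, real_inner_smul_right, Finset.mul_sum]
    rw [Finset.sum_comm]
    refine Finset.sum_congr rfl fun k _ ↦ Finset.sum_congr rfl fun l _ ↦ by ring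
  have h2 : ∀ k l, (J * S * Jᵀ) k l * ⟪d k, e l⟫ =
      ∑ i, ∑ j, S i j * (J k i * J l j * ⟪d k, e l⟫) := fun k l ↦ by
    simp only [Matrix.mul_apply, Matrix.transpose_apply, Finset.sum_mul]
    rw [Finset.sum_comm]
    refine Finset.sum_congr rfl fun i _ ↦ Finset.sum_congr rfl fun j _ ↦ by ring
  simp only [h1, h2]
  rw [Finset.sum_comm_cycle]
  exact Finset.sum_congr rfl fun k _ ↦ Finset.sum_comm_cycle

end CoordinateChange

/-! ### The metric and first derivatives under a change of chart -/

section Charts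

open scoped Matrix

variable {n : ℕ} {M : Type*} [TopologicalSpace M]
  [ChartedSpace (EuclideanSpace ℝ (Fin n)) M] [IsManifold (𝓡 n) ∞ M]
  {F : Type*} [NormedAddCommGroup F] [InnerProductSpace ℝ F]
  (g : Bundle.ContMDiffRiemannianMetric (𝓡 n) ∞ (EuclideanSpace ℝ (Fin n))
        (fun x : M ↦ TangentSpace (𝓡 n) x))
  {c c' : OpenPartialHomeomorph M (EuclideanSpace ℝ (Fin n))}

theorem mdifferentiable_of_mem_maximalAtlas (hc : c ∈ IsManifold.maximalAtlas (𝓡 n) ∞ M) :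
    c.MDifferentiable (𝓡 n) (𝓡 n) :=
  ⟨(contMDiffOn_of_mem_maximalAtlas hc).mdifferentiableOn (by simp),
    (contMDiffOn_symm_of_mem_maximalAtlas hc).mdifferentiableOn (by simp)⟩

/-- The derivative of the inverse of a chart, as a linear map of the model space. -/
def chartFrame (c : OpenPartialHomeomorph M (EuclideanSpace ℝ (Fin n)))
    (y : EuclideanSpace ℝ (Fin n)) : EuclideanSpace ℝ (Fin n) →L[ℝ] EuclideanSpace ℝ (Fin n) :=
  mfderiv (𝓡 n) (𝓡 n) c.symm y

/-- The metric at a point, as a bilinear form on the model space. -/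
def metricForm (p : M) :
    EuclideanSpace ℝ (Fin n) →L[ℝ] EuclideanSpace ℝ (Fin n) →L[ℝ] ℝ :=
  g.inner p

theorem gram_apply (y : EuclideanSpace ℝ (Fin n)) (i j : Fin n) :
    gram g.toRiemannianMetric c y i j =
      metricForm g (c.symm y) (chartFrame c y (EuclideanSpace.single i 1))
        (chartFrame c y (EuclideanSpace.single j 1)) := rfl

/-- The coordinate fields are the images of constant vector fields under the tangent map of the
inverse chart, hence smooth into the tangent bundle; the smooth metric is then evaluated on them. -/
theorem contDiffOn_gram (hc : c ∈ IsManifold.maximalAtlas (𝓡 n) ∞ M) (i j : Fin n) :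
    ContDiffOn ℝ ∞ (fun y ↦ gram g.toRiemannianMetric c y i j) c.target := by
  have key : ∀ i : Fin n, ContMDiffOn (𝓡 n) ((𝓡 n).prod 𝓘(ℝ, EuclideanSpace ℝ (Fin n))) ∞
      (fun y ↦ (⟨c.symm y, mfderiv (𝓡 n) (𝓡 n) c.symm y (EuclideanSpace.single i (1 : ℝ))⟩ :
        TangentBundle (𝓡 n) M)) c.target := by
    intro i
    have h1 := (contMDiffOn_symm_of_mem_maximalAtlas hc).contMDiffOn_tangentMapWithin
      (m := ∞) (by simp) c.open_target.uniqueMDiffOn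
    have h2 : ContMDiff (𝓡 n) ((𝓡 n).prod 𝓘(ℝ, EuclideanSpace ℝ (Fin n))) ∞
      (fun y : EuclideanSpace ℝ (Fin n) ↦ (⟨y, EuclideanSpace.single i (1 : ℝ)⟩ :
        TangentBundle (𝓡 n) (EuclideanSpace ℝ (Fin n)))) := by
      exact contMDiff_vectorSpace_iff_contDiff.2 contDiff_const
    have h3 := h1.comp h2.contMDiffOn (s := c.target) (fun y hy ↦ hy)
    refine h3.congr fun y hy ↦ ?_
    simp only [Function.comp_apply, tangentMapWithin]
    rw [mfderivWithin_of_isOpen c.open_target hy]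
  intro y hy
  have h : ContMDiffWithinAt (𝓡 n) ((𝓡 n).prod 𝓘(ℝ, ℝ)) ∞
      (fun y ↦ Bundle.TotalSpace.mk' ℝ (E := Bundle.Trivial M ℝ) (c.symm y)
        (gram g.toRiemannianMetric c y i j)) c.target y := by
    apply ContMDiffWithinAt.clm_bundle_apply₂ (F₁ := EuclideanSpace ℝ (Fin n))
      (F₂ := EuclideanSpace ℝ (Fin n))
    · exact ContMDiffAt.comp_contMDiffWithinAt y g.contMDiff.contMDiffAt
        (contMDiffOn_symm_of_mem_maximalAtlas hc y hy)
    · exact key i y hy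
    · exact key j y hy
  simp only [Bundle.contMDiffWithinAt_totalSpace] at h
  exact h.2.contDiffWithinAt

theorem gram_isHermitian (y : EuclideanSpace ℝ (Fin n)) :
    (gram g.toRiemannianMetric c y).IsHermitian := by
  ext i j
  simp only [Matrix.conjTranspose_apply, star_trivial]
  exact g.symm _ _ _

theorem sum_smul_single (v : EuclideanSpace ℝ (Fin n)) :
    ∑ i, v i • EuclideanSpace.single i (1 : ℝ) = v := by
  ext k
  simp [Finset.sum_apply, Pi.single_apply]

theorem sum_gram (y : EuclideanSpace ℝ (Fin n)) (v w : EuclideanSpace ℝ (Fin n)) :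
    ∑ i, ∑ j, v i * w j * gram g.toRiemannianMetric c y i j =
      metricForm g (c.symm y) (chartFrame c y v) (chartFrame c y w) := by
  conv_rhs => rw [← sum_smul_single v, ← sum_smul_single w]
  simp only [map_sum, map_smul, sum_apply, smul_apply,
    smul_eq_mul, gram_apply, Finset.mul_sum]
  rw [Finset.sum_comm]
  refine Finset.sum_congr rfl fun i _ ↦ Finset.sum_congr rfl fun j _ ↦ by ring

theorem gram_posDef (hc : c ∈ IsManifold.maximalAtlas (𝓡 n) ∞ M) {y : EuclideanSpace ℝ (Fin n)}
    (hy : y ∈ c.target) : (gram g.toRiemannianMetric c y).PosDef := by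
  refine Matrix.PosDef.of_dotProduct_mulVec_pos (gram_isHermitian g y) fun x hx ↦ ?_
  have h := sum_gram g (c := c) y (WithLp.toLp 2 x) (WithLp.toLp 2 x)
  have h2 : star x ⬝ᵥ ((gram g.toRiemannianMetric c y).mulVec x) =
    ∑ i, ∑ j, x i * x j * gram g.toRiemannianMetric c y i j := by
    simp only [dotProduct, Matrix.mulVec, Finset.mul_sum, star_trivial]
    refine Finset.sum_congr rfl fun i _ ↦ Finset.sum_congr rfl fun j _ ↦ by ring
  rw [h2]
  refine lt_of_lt_of_eq ?_ h.symm
  refine g.pos _ _ ?_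
  have hinj := (mdifferentiable_of_mem_maximalAtlas hc).symm.mfderiv_injective hy
  intro h0
  apply hx
  have : (WithLp.toLp 2 x : EuclideanSpace ℝ (Fin n)) = 0 := by
    apply hinj
    exact h0.trans (map_zero (chartFrame c y)).symm
  simpa using congrArg WithLp.ofLp this

theorem det_gram_pos (hc : c ∈ IsManifold.maximalAtlas (𝓡 n) ∞ M) {y : EuclideanSpace ℝ (Fin n)}
    (hy : y ∈ c.target) : 0 < (gram g.toRiemannianMetric c y).det :=
  (gram_posDef g hc hy).det_pos

theorem volDensity_pos (hc : c ∈ IsManifold.maximalAtlas (𝓡 n) ∞ M)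
    {y : EuclideanSpace ℝ (Fin n)} (hy : y ∈ c.target) :
    0 < volDensity g.toRiemannianMetric c y :=
  Real.sqrt_pos.2 (det_gram_pos g hc hy)

theorem contDiffOn_det_gram (hc : c ∈ IsManifold.maximalAtlas (𝓡 n) ∞ M) :
    ContDiffOn ℝ ∞ (fun y ↦ (gram g.toRiemannianMetric c y).det) c.target := by
  simp only [Matrix.det_apply]
  refine ContDiffOn.sum fun σ _ ↦ ContDiffOn.const_smul _ ?_
  exact contDiffOn_prod fun i _ ↦ contDiffOn_gram g hc _ _

theorem contDiffOn_volDensity (hc : c ∈ IsManifold.maximalAtlas (𝓡 n) ∞ M) :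
    ContDiffOn ℝ ∞ (volDensity g.toRiemannianMetric c) c.target :=
  (contDiffOn_det_gram g hc).sqrt fun _ hy ↦ (det_gram_pos g hc hy).ne'

theorem contDiffOn_gram_inv (hc : c ∈ IsManifold.maximalAtlas (𝓡 n) ∞ M) (i j : Fin n) :
    ContDiffOn ℝ ∞ (fun y ↦ (gram g.toRiemannianMetric c y)⁻¹ i j) c.target := by
  simp only [Matrix.inv_def, Ring.inverse_eq_inv', Matrix.smul_apply, smul_eq_mul,
    Matrix.adjugate_apply]
  refine ((contDiffOn_det_gram g hc).inv fun y hy ↦ (det_gram_pos g hc hy).ne').mul ?_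
  simp only [Matrix.det_apply]
  refine ContDiffOn.sum fun σ _ ↦ ContDiffOn.const_smul _ ?_
  refine contDiffOn_prod fun k _ ↦ ?_
  simp only [Matrix.updateRow_apply]
  split_ifs
  · exact contDiffOn_const
  · exact contDiffOn_gram g hc _ _

/-- The Jacobian of the change of coordinates `c ∘ c'⁻¹`. -/
def transitionDeriv (c c' : OpenPartialHomeomorph M (EuclideanSpace ℝ (Fin n)))
    (y : EuclideanSpace ℝ (Fin n)) : EuclideanSpace ℝ (Fin n) →L[ℝ] EuclideanSpace ℝ (Fin n) :=
  fderiv ℝ (c ∘ c'.symm) y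

/-- The Jacobian matrix of the change of coordinates `c ∘ c'⁻¹`. -/
def transitionMatrix (c c' : OpenPartialHomeomorph M (EuclideanSpace ℝ (Fin n)))
    (y : EuclideanSpace ℝ (Fin n)) : Matrix (Fin n) (Fin n) ℝ :=
  Matrix.of fun k i ↦ transitionDeriv c c' y (EuclideanSpace.single i 1) k

theorem det_transitionMatrix (y : EuclideanSpace ℝ (Fin n)) :
    (transitionMatrix c c' y).det = (transitionDeriv c c' y).det := by
  rw [ContinuousLinearMap.det,
    ← LinearMap.det_toMatrix (EuclideanSpace.basisFun (Fin n) ℝ).toBasis]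
  rfl

theorem contDiffAt_transition (hc : c ∈ IsManifold.maximalAtlas (𝓡 n) ∞ M)
    (hc' : c' ∈ IsManifold.maximalAtlas (𝓡 n) ∞ M) {y : EuclideanSpace ℝ (Fin n)}
    (hy : y ∈ c'.target) (hy' : c'.symm y ∈ c.source) :
    ContDiffAt ℝ ∞ (c ∘ c'.symm) y :=
  ((contMDiffAt_of_mem_maximalAtlas hc hy').comp y
    (contMDiffAt_symm_of_mem_maximalAtlas hc' hy)).contDiffAt

theorem eventually_symm_transition {y : EuclideanSpace ℝ (Fin n)}
    (hy : y ∈ c'.target) (hy' : c'.symm y ∈ c.source) :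
    ∀ᶠ z in 𝓝 y, c.symm (c (c'.symm z)) = c'.symm z := by
  have : c'.symm ⁻¹' c.source ∈ 𝓝 y :=
    (c'.symm.continuousAt hy).preimage_mem_nhds (c.open_source.mem_nhds hy')
  filter_upwards [this] with z hz
  exact c.left_inv hz

theorem chartFrame_transition (hc : c ∈ IsManifold.maximalAtlas (𝓡 n) ∞ M)
    (hc' : c' ∈ IsManifold.maximalAtlas (𝓡 n) ∞ M) {y : EuclideanSpace ℝ (Fin n)}
    (hy : y ∈ c'.target) (hy' : c'.symm y ∈ c.source) :
    chartFrame c' y = (chartFrame c (c (c'.symm y))).comp (transitionDeriv c c' y) := by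
  have h1 : c'.symm =ᶠ[𝓝 y] c.symm ∘ (c ∘ c'.symm) :=
    (eventually_symm_transition hy hy').mono fun z hz ↦ hz.symm
  have h2 : MDifferentiableAt (𝓡 n) (𝓡 n) (c ∘ c'.symm) y :=
    ((contDiffAt_transition hc hc' hy hy').differentiableAt (by simp)).mdifferentiableAt
  have h3 : MDifferentiableAt (𝓡 n) (𝓡 n) c.symm ((c ∘ c'.symm) y) :=
    (mdifferentiable_of_mem_maximalAtlas hc).mdifferentiableAt_symm (c.map_source hy')
  unfold chartFrame transitionDeriv
  rw [h1.mfderiv_eq, mfderiv_comp y h3 h2, mfderiv_eq_fderiv]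
  rfl

theorem gram_transition (hc : c ∈ IsManifold.maximalAtlas (𝓡 n) ∞ M)
    (hc' : c' ∈ IsManifold.maximalAtlas (𝓡 n) ∞ M) {y : EuclideanSpace ℝ (Fin n)}
    (hy : y ∈ c'.target) (hy' : c'.symm y ∈ c.source) :
    gram g.toRiemannianMetric c' y =
      (transitionMatrix c c' y)ᵀ * gram g.toRiemannianMetric c (c (c'.symm y)) *
        transitionMatrix c c' y := by
  ext i j
  rw [gram_apply, chartFrame_transition hc hc' hy hy']
  have h := sum_gram g (c := c) (c (c'.symm y)) (transitionDeriv c c' y (EuclideanSpace.single i 1))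
    (transitionDeriv c c' y (EuclideanSpace.single j 1))
  rw [c.left_inv hy'] at h
  refine h.symm.trans ?_
  simp only [Matrix.mul_apply, Matrix.transpose_apply, Finset.sum_mul]
  rw [Finset.sum_comm]
  refine Finset.sum_congr rfl fun k _ ↦ Finset.sum_congr rfl fun l _ ↦ ?_
  simp only [transitionMatrix, Matrix.of_apply]
  ring

/-- The relation G' = JᵀGJ with det G' > 0 already forces det J ≠ 0. -/
theorem isUnit_det_transitionMatrix
    (g : Bundle.ContMDiffRiemannianMetric (𝓡 n) ∞ (EuclideanSpace ℝ (Fin n))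
      (fun x : M ↦ TangentSpace (𝓡 n) x)) (hc : c ∈ IsManifold.maximalAtlas (𝓡 n) ∞ M)
    (hc' : c' ∈ IsManifold.maximalAtlas (𝓡 n) ∞ M) {y : EuclideanSpace ℝ (Fin n)}
    (hy : y ∈ c'.target) (hy' : c'.symm y ∈ c.source) :
    IsUnit (transitionMatrix c c' y).det := by
  have h := det_gram_pos g hc' hy
  rw [gram_transition g hc hc' hy hy', Matrix.det_mul] at h
  exact isUnit_iff_ne_zero.2 (right_ne_zero_of_mul h.ne')

theorem volDensity_transition (hc : c ∈ IsManifold.maximalAtlas (𝓡 n) ∞ M)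
    (hc' : c' ∈ IsManifold.maximalAtlas (𝓡 n) ∞ M) {y : EuclideanSpace ℝ (Fin n)}
    (hy : y ∈ c'.target) (hy' : c'.symm y ∈ c.source) :
    volDensity g.toRiemannianMetric c' y =
      |(transitionDeriv c c' y).det| * volDensity g.toRiemannianMetric c (c (c'.symm y)) := by
  unfold volDensity
  rw [gram_transition g hc hc' hy hy', Matrix.det_mul, Matrix.det_mul, Matrix.det_transpose,
    det_transitionMatrix, mul_right_comm, Real.sqrt_mul (mul_self_nonneg _),
    Real.sqrt_mul_self_eq_abs]

theorem partialIn_transition (hc : c ∈ IsManifold.maximalAtlas (𝓡 n) ∞ M)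
    (hc' : c' ∈ IsManifold.maximalAtlas (𝓡 n) ∞ M) {y : EuclideanSpace ℝ (Fin n)}
    (hy : y ∈ c'.target) (hy' : c'.symm y ∈ c.source) {f : M → F}
    (hf : DifferentiableAt ℝ (f ∘ c.symm) (c (c'.symm y))) (i : Fin n) :
    partialIn c' f i y = ∑ k, transitionMatrix c c' y k i • partialIn c f k (c (c'.symm y)) := by
  have h1 : f ∘ c'.symm =ᶠ[𝓝 y] (f ∘ c.symm) ∘ (c ∘ c'.symm) :=
    (eventually_symm_transition hy hy').mono fun z hz ↦ by
      simp only [Function.comp_apply, hz]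
  have h2 : DifferentiableAt ℝ (c ∘ c'.symm) y :=
    (contDiffAt_transition hc hc' hy hy').differentiableAt (by simp)
  unfold partialIn
  rw [h1.fderiv_eq, fderiv_comp y hf h2, ContinuousLinearMap.comp_apply]
  conv_lhs => rw [← sum_smul_single (fderiv ℝ (c ∘ c'.symm) y (EuclideanSpace.single i 1))]
  simp only [map_sum, map_smul]
  rfl

/-- The scalar product of the gradients of two functions, computed in the chart `c`. -/
def gradInnerIn (g : Bundle.RiemannianMetric (fun x : M ↦ TangentSpace (𝓡 n) x))
    (c : OpenPartialHomeomorph M (EuclideanSpace ℝ (Fin n))) (f h : M → F)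
    (y : EuclideanSpace ℝ (Fin n)) : ℝ :=
  ∑ i, ∑ j, (gram g c y)⁻¹ i j * ⟪partialIn c f i y, partialIn c h j y⟫

/-- The scalar product of the gradients of two functions. -/
def gradInner (g : Bundle.RiemannianMetric (fun x : M ↦ TangentSpace (𝓡 n) x)) (f h : M → F)
    (x : M) : ℝ :=
  gradInnerIn g (chartAt (EuclideanSpace ℝ (Fin n)) x) f h
    (chartAt (EuclideanSpace ℝ (Fin n)) x x)

theorem gradInner_self (g : Bundle.RiemannianMetric (fun x : M ↦ TangentSpace (𝓡 n) x))
    (f : M → F) (x : M) : gradInner g f f x = gradSq g f x := rfl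

theorem gradInnerIn_transition (hc : c ∈ IsManifold.maximalAtlas (𝓡 n) ∞ M)
    (hc' : c' ∈ IsManifold.maximalAtlas (𝓡 n) ∞ M) {x : M}
    (hx : x ∈ c.source) (hx' : x ∈ c'.source) {f h : M → F}
    (hf : DifferentiableAt ℝ (f ∘ c.symm) (c x)) (hh : DifferentiableAt ℝ (h ∘ c.symm) (c x)) :
    gradInnerIn g.toRiemannianMetric c' f h (c' x) =
      gradInnerIn g.toRiemannianMetric c f h (c x) := by
  have hy := c'.map_source hx'
  have hxx := c'.left_inv hx'
  have hy' : c'.symm (c' x) ∈ c.source := by rwa [hxx]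
  unfold gradInnerIn
  have h1 := gram_transition g hc hc' hy hy'
  have h2 := fun i ↦ partialIn_transition hc hc' hy hy' (f := f) (by rwa [hxx]) i
  have h3 := fun i ↦ partialIn_transition hc hc' hy hy' (f := h) (by rwa [hxx]) i
  simp only [h1, h2, h3]
  rw [sum_inv_congruence (isUnit_det_transitionMatrix g hc hc' hy hy'), hxx]

end Charts

/-! ### The Riemannian measure in charts -/

section Volume

variable {n : ℕ} {M : Type*} [TopologicalSpace M]
  [ChartedSpace (EuclideanSpace ℝ (Fin n)) M] [IsManifold (𝓡 n) ∞ M]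
  [MeasurableSpace M] [BorelSpace M]
  (g : Bundle.ContMDiffRiemannianMetric (𝓡 n) ∞ (EuclideanSpace ℝ (Fin n))
        (fun x : M ↦ TangentSpace (𝓡 n) x))
  {c c' : OpenPartialHomeomorph M (EuclideanSpace ℝ (Fin n))}

theorem aemeasurable_symm_restrict (c : OpenPartialHomeomorph M (EuclideanSpace ℝ (Fin n))) :
    AEMeasurable c.symm (volume.restrict c.target) :=
  c.continuousOn_symm.aemeasurable c.open_target.measurableSet

theorem aemeasurable_volDensity (hc : c ∈ IsManifold.maximalAtlas (𝓡 n) ∞ M) :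
    AEMeasurable (fun y ↦ ENNReal.ofReal (volDensity g.toRiemannianMetric c y))
      (volume.restrict c.target) :=
  ((contDiffOn_volDensity g hc).continuousOn.aemeasurable
    c.open_target.measurableSet).ennreal_ofReal

theorem aemeasurable_symm_withDensity (c : OpenPartialHomeomorph M (EuclideanSpace ℝ (Fin n)))
    (ρ : EuclideanSpace ℝ (Fin n) → ℝ≥0∞) :
    AEMeasurable c.symm ((volume.restrict c.target).withDensity ρ) :=
  (aemeasurable_symm_restrict c).mono_ac (withDensity_absolutelyContinuous _ _)

theorem measurableSet_target_inter_preimage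
    (c : OpenPartialHomeomorph M (EuclideanSpace ℝ (Fin n))) {A : Set M} (hA : MeasurableSet A) :
    MeasurableSet (c.target ∩ c.symm ⁻¹' A) := by
  have h2 : c.target ∩ c.symm ⁻¹' A =
      Subtype.val '' ((fun y : c.target ↦ c.symm y) ⁻¹' A) := by
    ext y
    simp [and_comm]
  rw [h2]
  exact c.open_target.measurableSet.subtype_image
    ((continuousOn_iff_continuous_domRestrict.1 c.continuousOn_symm).measurable hA)

theorem chartVolume_apply {A : Set M} (hA : MeasurableSet A) :
    chartVolume g.toRiemannianMetric c A =
      ∫⁻ y in c.target ∩ c.symm ⁻¹' A, ENNReal.ofReal (volDensity g.toRiemannianMetric c y) := by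
  unfold chartVolume
  rw [Measure.map_apply_of_aemeasurable (aemeasurable_symm_withDensity c _) hA,
    withDensity_apply' _ _, Measure.restrict_restrict' c.open_target.measurableSet, inter_comm]

theorem chartVolume_source_compl :
    chartVolume g.toRiemannianMetric c c.sourceᶜ = 0 := by
  rw [chartVolume_apply g c.open_source.measurableSet.compl]
  have : c.target ∩ c.symm ⁻¹' c.sourceᶜ = ∅ := by
    ext y
    simp only [mem_inter_iff, mem_preimage, mem_compl_iff, mem_empty_iff_false, iff_false, not_and,
      not_not]
    exact fun hy ↦ c.map_target hy
  rw [this]; simp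

/-- The change of variables formula for the transition map: its Jacobian determinant is the ratio of
the two volume densities. -/
theorem chartVolume_eq_of_subset (hc : c ∈ IsManifold.maximalAtlas (𝓡 n) ∞ M)
    (hc' : c' ∈ IsManifold.maximalAtlas (𝓡 n) ∞ M) {A : Set M} (hA : MeasurableSet A)
    (h : A ⊆ c.source) (h' : A ⊆ c'.source) :
    chartVolume g.toRiemannianMetric c A = chartVolume g.toRiemannianMetric c' A := by
  rw [chartVolume_apply g hA, chartVolume_apply g hA]
  set T := c'.target ∩ c'.symm ⁻¹' A
  have hT : ∀ y ∈ T, y ∈ c'.target ∧ c'.symm y ∈ c.source := fun y hy ↦ ⟨hy.1, h hy.2⟩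
  have himg : c.target ∩ c.symm ⁻¹' A = (c ∘ c'.symm) '' T := by
    ext y
    constructor
    · rintro ⟨hy, hyA⟩
      refine ⟨c' (c.symm y), ⟨c'.map_source (h' hyA), ?_⟩, ?_⟩
      · simpa only [mem_preimage, c'.left_inv (h' hyA)] using hyA
      · simp only [Function.comp_apply, c'.left_inv (h' hyA), c.right_inv hy]
    · rintro ⟨z, hz, rfl⟩
      refine ⟨c.map_source (hT z hz).2, ?_⟩
      simp only [mem_preimage, Function.comp_apply, c.left_inv (hT z hz).2]
      exact hz.2
  have hinj : InjOn (c ∘ c'.symm) T := by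
    intro y hy z hz hyz
    have h1 := c.injOn (hT y hy).2 (hT z hz).2 hyz
    exact c'.symm.injOn (hT y hy).1 (hT z hz).1 h1
  rw [himg, lintegral_image_eq_lintegral_abs_det_fderiv_mul volume
    (measurableSet_target_inter_preimage c' hA) (f' := transitionDeriv c c') (fun y hy ↦
      ((contDiffAt_transition hc hc' (hT y hy).1 (hT y hy).2).differentiableAt
        (by simp)).hasFDerivAt.hasFDerivWithinAt) hinj]
  refine setLIntegral_congr_fun (measurableSet_target_inter_preimage c' hA) fun y hy ↦ ?_
  rw [volDensity_transition g hc hc' (hT y hy).1 (hT y hy).2,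
    ENNReal.ofReal_mul (abs_nonneg _), Function.comp_apply]

/-- This makes the supremum computable: over one chart domain the other charts contribute nothing
more. -/
theorem restrict_riemannianVolume (x : M) :
    (riemannianVolume g.toRiemannianMetric).restrict
        (chartAt (EuclideanSpace ℝ (Fin n)) x).source =
      chartVolume g.toRiemannianMetric (chartAt (EuclideanSpace ℝ (Fin n)) x) := by
  set c := chartAt (EuclideanSpace ℝ (Fin n)) x
  have hc : c ∈ IsManifold.maximalAtlas (𝓡 n) ∞ M := IsManifold.chart_mem_maximalAtlas x
  have hS := c.open_source.measurableSet
  set μ := riemannianVolume g.toRiemannianMetric (M := M)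
  set m := chartVolume g.toRiemannianMetric c
  have hle : m ≤ μ :=
    le_iSup (fun x : M ↦ chartVolume g.toRiemannianMetric (chartAt (EuclideanSpace ℝ (Fin n)) x)) x
  have hm : m.restrict c.source = m := by
    rw [Measure.restrict_eq_self_of_ae_mem]
    exact chartVolume_source_compl g
  -- A supremum of measures is not taken set by set, so it is bounded by a single measure. Each
  -- chart measure is split along the source of c: the inner part is at most m because chart
  -- measures agree on overlaps, the outer part is at most that of μ.
  have hge : μ ≤ m + μ.restrict c.sourceᶜ := by
    refine iSup_le fun z ↦ ?_
    set c' := chartAt (EuclideanSpace ℝ (Fin n)) z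
    have hc' : c' ∈ IsManifold.maximalAtlas (𝓡 n) ∞ M := IsManifold.chart_mem_maximalAtlas z
    have hle' : chartVolume g.toRiemannianMetric c' ≤ μ :=
      le_iSup (fun x : M ↦
        chartVolume g.toRiemannianMetric (chartAt (EuclideanSpace ℝ (Fin n)) x)) z
    rw [← Measure.restrict_add_restrict_compl (μ := chartVolume g.toRiemannianMetric c') hS]
    refine add_le_add ?_ (Measure.restrict_mono_measure hle' _)
    refine Measure.le_iff.2 fun A hA ↦ ?_
    rw [Measure.restrict_apply hA]
    have h1 : chartVolume g.toRiemannianMetric c' (A ∩ c.source) =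
        chartVolume g.toRiemannianMetric c' (A ∩ c.source ∩ c'.source) := by
      refine (measure_inter_conull ?_).symm
      exact chartVolume_source_compl g
    rw [h1, chartVolume_eq_of_subset g hc' hc ((hA.inter hS).inter c'.open_source.measurableSet)
      inter_subset_right (fun y hy ↦ hy.1.2)]
    exact measure_mono fun y hy ↦ hy.1.1
  apply le_antisymm
  · refine (Measure.restrict_mono_measure hge _).trans ?_
    rw [Measure.restrict_add, hm, Measure.restrict_restrict hS, inter_compl_self,
      Measure.restrict_empty, add_zero]
  · conv_lhs => rw [← hm]
    exact Measure.restrict_mono_measure hle _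

theorem chartVolume_pos (hc : c ∈ IsManifold.maximalAtlas (𝓡 n) ∞ M) {U : Set M} (hU : IsOpen U)
    (hne : (U ∩ c.source).Nonempty) : chartVolume g.toRiemannianMetric c U ≠ 0 := by
  rw [chartVolume_apply g hU.measurableSet]
  have ho : IsOpen (c.target ∩ c.symm ⁻¹' U) := c.isOpen_inter_preimage_symm hU
  intro h0
  rw [lintegral_eq_zero_iff' ((aemeasurable_volDensity g hc).mono_measure
    (Measure.restrict_mono inter_subset_left le_rfl)), EventuallyEq,
    ae_restrict_iff' ho.measurableSet] at h0
  have h1 : ∀ᵐ y, y ∉ c.target ∩ c.symm ⁻¹' U := by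
    filter_upwards [h0] with y hy hmem
    have := hy hmem
    simp only [Pi.zero_apply, ENNReal.ofReal_eq_zero] at this
    exact absurd this (not_le.2 (volDensity_pos g hc hmem.1))
  have h2 : volume (c.target ∩ c.symm ⁻¹' U) = 0 := by
    simpa only [ae_iff, not_not, ofPred_mem_eq] using h1
  obtain ⟨x, hxU, hxc⟩ := hne
  refine (ho.measure_pos volume ⟨c x, c.map_source hxc, ?_⟩).ne' h2
  simpa only [mem_preimage, c.left_inv hxc] using hxU

instance isOpenPosMeasure_riemannianVolume :
    (riemannianVolume g.toRiemannianMetric (M := M)).IsOpenPosMeasure where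
  open_pos U hU hne := by
    obtain ⟨x, hx⟩ := hne
    have h := chartVolume_pos g (IsManifold.chart_mem_maximalAtlas x) hU
      ⟨x, hx, mem_chart_source _ x⟩
    intro h0
    apply h
    rw [← restrict_riemannianVolume g x]
    rw [Measure.restrict_apply hU.measurableSet]
    exact measure_mono_null inter_subset_left h0

instance isLocallyFiniteMeasure_riemannianVolume :
    IsLocallyFiniteMeasure (riemannianVolume g.toRiemannianMetric (M := M)) where
  finiteAtNhds x := by
    set c := chartAt (EuclideanSpace ℝ (Fin n)) x with hcdef
    have hc : c ∈ IsManifold.maximalAtlas (𝓡 n) ∞ M := IsManifold.chart_mem_maximalAtlas x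
    have hx : x ∈ c.source := mem_chart_source _ x
    obtain ⟨K, hK, hKx, hKt⟩ := exists_compact_subset c.open_target (c.map_source hx)
    set U := c.source ∩ c ⁻¹' interior K
    have hU : IsOpen U := c.isOpen_inter_preimage isOpen_interior
    refine ⟨U, hU.mem_nhds ⟨hx, hKx⟩, ?_⟩
    have h1 : riemannianVolume g.toRiemannianMetric U = chartVolume g.toRiemannianMetric c U := by
      rw [← restrict_riemannianVolume g x, Measure.restrict_apply hU.measurableSet,
        inter_eq_self_of_subset_left inter_subset_left]
    rw [h1, chartVolume_apply g hU.measurableSet]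
    have hsub : c.target ∩ c.symm ⁻¹' U ⊆ K := by
      rintro y ⟨hy, -, hyK⟩
      simp only [mem_preimage, c.right_inv hy] at hyK
      exact interior_subset hyK
    refine (lintegral_mono_set hsub).trans_lt ?_
    have := ((contDiffOn_volDensity g hc).continuousOn.mono hKt).integrableOn_compact
      (μ := volume) hK
    exact this.lintegral_lt_top

variable {φ : M → ℝ}

theorem isLocallyFiniteMeasure_weightedVolume (hφ : Continuous φ) :
    IsLocallyFiniteMeasure (weightedVolume g.toRiemannianMetric φ) :=
  IsLocallyFiniteMeasure.withDensity_ofReal (by fun_prop)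

/-- Needed to pass from almost everywhere to everywhere for continuous functions, both for chart
independence and at the end of the proof. -/
theorem isOpenPosMeasure_weightedVolume (hφ : Continuous φ) :
    (weightedVolume g.toRiemannianMetric φ).IsOpenPosMeasure := by
  refine Measure.AbsolutelyContinuous.isOpenPosMeasure
    (μ := riemannianVolume g.toRiemannianMetric (M := M)) ?_
  refine withDensity_absolutelyContinuous' ?_ ?_
  · exact (ENNReal.continuous_ofReal.comp (by fun_prop)).measurable.aemeasurable
  · exact ae_of_all _ fun x ↦ by simp [Real.exp_pos]

theorem integral_weightedVolume_eq (hφ : Continuous φ) (x₀ : M)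
    (hcx : c = chartAt (EuclideanSpace ℝ (Fin n)) x₀) {f : M → ℝ} (hf : ContinuousOn f c.source)
    (h0 : ∀ x, x ∉ c.source → f x = 0) :
    ∫ x, f x ∂(weightedVolume g.toRiemannianMetric φ) =
      ∫ y in c.target, (volDensity g.toRiemannianMetric c y * Real.exp (-φ (c.symm y))) *
        f (c.symm y) := by
  have hc : c ∈ IsManifold.maximalAtlas (𝓡 n) ∞ M := hcx ▸ IsManifold.chart_mem_maximalAtlas x₀
  have hS := c.open_source.measurableSet
  have hexp : Continuous fun x ↦ Real.exp (-φ x) := by fun_prop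
  rw [← setIntegral_eq_integral_of_forall_compl_eq_zero h0]
  unfold weightedVolume
  rw [restrict_withDensity hS, integral_withDensity_eq_integral_toReal_smul₀
    hexp.measurable.ennreal_ofReal.aemeasurable (ae_of_all _ fun _ ↦ ENNReal.ofReal_lt_top)]
  have hmeas : AEStronglyMeasurable
      (fun x ↦ (ENNReal.ofReal (Real.exp (-φ x))).toReal • f x)
      ((riemannianVolume g.toRiemannianMetric (M := M)).restrict c.source) := by
    simp only [smul_eq_mul]
    exact (hexp.measurable.ennreal_ofReal.ennreal_toReal).aestronglyMeasurable.mul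
      (hf.aestronglyMeasurable hS)
  have hrestr : (riemannianVolume g.toRiemannianMetric (M := M)).restrict c.source =
      chartVolume g.toRiemannianMetric c := by
    rw [hcx]; exact restrict_riemannianVolume g x₀
  rw [hrestr] at hmeas ⊢
  unfold chartVolume at hmeas ⊢
  rw [integral_map (aemeasurable_symm_withDensity c _) hmeas,
    integral_withDensity_eq_integral_toReal_smul₀ (aemeasurable_volDensity g hc)
      (ae_of_all _ fun _ ↦ ENNReal.ofReal_lt_top)]
  refine setIntegral_congr_fun c.open_target.measurableSet fun y hy ↦ ?_
  simp only [smul_eq_mul]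
  rw [ENNReal.toReal_ofReal (volDensity_pos g hc hy).le, ENNReal.toReal_ofReal (Real.exp_pos _).le,
    mul_assoc]

end Volume

/-! ### Calculus of the scalar product of gradients -/

section GradientCalculus

variable {n : ℕ} {M : Type*} [TopologicalSpace M]
  [ChartedSpace (EuclideanSpace ℝ (Fin n)) M] [IsManifold (𝓡 n) ∞ M]
  {F : Type*} [NormedAddCommGroup F] [InnerProductSpace ℝ F]
  (g : Bundle.ContMDiffRiemannianMetric (𝓡 n) ∞ (EuclideanSpace ℝ (Fin n))
        (fun x : M ↦ TangentSpace (𝓡 n) x))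
  {c c' : OpenPartialHomeomorph M (EuclideanSpace ℝ (Fin n))}
  {f h k : M → F}

theorem contDiffOn_comp_symm (hc : c ∈ IsManifold.maximalAtlas (𝓡 n) ∞ M)
    (hf : ContMDiff (𝓡 n) 𝓘(ℝ, F) ∞ f) : ContDiffOn ℝ ∞ (f ∘ c.symm) c.target :=
  (hf.comp_contMDiffOn (contMDiffOn_symm_of_mem_maximalAtlas hc)).contDiffOn

theorem contDiffAt_comp_symm (hc : c ∈ IsManifold.maximalAtlas (𝓡 n) ∞ M)
    (hf : ContMDiff (𝓡 n) 𝓘(ℝ, F) ∞ f) {y : EuclideanSpace ℝ (Fin n)} (hy : y ∈ c.target) :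
    ContDiffAt ℝ ∞ (f ∘ c.symm) y :=
  (contDiffOn_comp_symm hc hf).contDiffAt (c.open_target.mem_nhds hy)

theorem differentiableAt_comp_symm (hc : c ∈ IsManifold.maximalAtlas (𝓡 n) ∞ M)
    (hf : ContMDiff (𝓡 n) 𝓘(ℝ, F) ∞ f) {y : EuclideanSpace ℝ (Fin n)} (hy : y ∈ c.target) :
    DifferentiableAt ℝ (f ∘ c.symm) y :=
  (contDiffAt_comp_symm hc hf hy).differentiableAt (by simp)

theorem contDiffOn_partialIn (hc : c ∈ IsManifold.maximalAtlas (𝓡 n) ∞ M)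
    (hf : ContMDiff (𝓡 n) 𝓘(ℝ, F) ∞ f) (i : Fin n) :
    ContDiffOn ℝ ∞ (partialIn c f i) c.target :=
  ((contDiffOn_comp_symm hc hf).fderiv_of_isOpen c.open_target (m := ∞) (by simp)).clm_apply
    contDiffOn_const

theorem gradInner_eq_gradInnerIn (hc : c ∈ IsManifold.maximalAtlas (𝓡 n) ∞ M)
    (hf : ContMDiff (𝓡 n) 𝓘(ℝ, F) ∞ f) (hh : ContMDiff (𝓡 n) 𝓘(ℝ, F) ∞ h) {x : M}
    (hx : x ∈ c.source) :
    gradInner g.toRiemannianMetric f h x = gradInnerIn g.toRiemannianMetric c f h (c x) :=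
  gradInnerIn_transition g hc (IsManifold.chart_mem_maximalAtlas x) hx (mem_chart_source _ x)
    (differentiableAt_comp_symm hc hf (c.map_source hx))
    (differentiableAt_comp_symm hc hh (c.map_source hx))

theorem continuousOn_gradInnerIn (hc : c ∈ IsManifold.maximalAtlas (𝓡 n) ∞ M)
    (hf : ContMDiff (𝓡 n) 𝓘(ℝ, F) ∞ f) (hh : ContMDiff (𝓡 n) 𝓘(ℝ, F) ∞ h) :
    ContinuousOn (gradInnerIn g.toRiemannianMetric c f h) c.target := by
  unfold gradInnerIn
  refine continuousOn_finsetSum _ fun i _ ↦ continuousOn_finsetSum _ fun j _ ↦ ?_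
  exact (contDiffOn_gram_inv g hc i j).continuousOn.mul
    ((contDiffOn_partialIn hc hf i).continuousOn.inner (contDiffOn_partialIn hc hh j).continuousOn)

/-- The definition uses a chart that varies with the point, so continuity is not immediate; near x
it is read in the fixed chart at x. -/
theorem continuous_gradInner (hf : ContMDiff (𝓡 n) 𝓘(ℝ, F) ∞ f)
    (hh : ContMDiff (𝓡 n) 𝓘(ℝ, F) ∞ h) :
    Continuous (gradInner g.toRiemannianMetric f h) := by
  refine continuous_iff_continuousAt.2 fun x ↦ ?_
  set c := chartAt (EuclideanSpace ℝ (Fin n)) x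
  have hc : c ∈ IsManifold.maximalAtlas (𝓡 n) ∞ M := IsManifold.chart_mem_maximalAtlas x
  have h1 : ContinuousOn (fun x ↦ gradInnerIn g.toRiemannianMetric c f h (c x)) c.source :=
    (continuousOn_gradInnerIn g hc hf hh).comp c.continuousOn fun y hy ↦ c.map_source hy
  have h2 := h1.congr fun y hy ↦ gradInner_eq_gradInnerIn g hc hf hh hy
  exact h2.continuousAt (chart_source_mem_nhds _ x)

theorem posSemidef_gram_inv (x : M) :
    (gram g.toRiemannianMetric (chartAt (EuclideanSpace ℝ (Fin n)) x)
      (chartAt (EuclideanSpace ℝ (Fin n)) x x))⁻¹.PosSemidef :=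
  (gram_posDef g (IsManifold.chart_mem_maximalAtlas x)
    (mem_chart_target _ x)).posSemidef.inv

theorem gradSq_nonneg (f : M → F) (x : M) : 0 ≤ gradSq g.toRiemannianMetric f x :=
  sum_mul_inner_nonneg (posSemidef_gram_inv g x) _

theorem sum_mul_inner_comm {ι : Type*} [Fintype ι] {A : Matrix ι ι ℝ} (hA : A.IsHermitian)
    (d e : ι → F) : ∑ i, ∑ j, A i j * ⟪d i, e j⟫ = ∑ i, ∑ j, A i j * ⟪e i, d j⟫ := by
  rw [Finset.sum_comm]
  refine Finset.sum_congr rfl fun i _ ↦ Finset.sum_congr rfl fun j _ ↦ ?_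
  rw [real_inner_comm, ← hA.apply i j, star_trivial]

theorem gradInner_comm (f h : M → F) (x : M) :
    gradInner g.toRiemannianMetric f h x = gradInner g.toRiemannianMetric h f x :=
  sum_mul_inner_comm (posSemidef_gram_inv g x).isHermitian _ _

/-- Cauchy-Schwarz with a parameter: expand |±δ∇f + ∇h|² ≥ 0 and divide by δ. A small δ favours the
term in f, which the density argument exploits. -/
theorem abs_gradInner_le (f h : M → F) (x : M) {δ : ℝ} (hδ : 0 < δ) :
    |gradInner g.toRiemannianMetric f h x| ≤
      (δ * gradSq g.toRiemannianMetric f x + δ⁻¹ * gradSq g.toRiemannianMetric h x) / 2 := by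
  have hA := posSemidef_gram_inv g x
  have hcomm := gradInner_comm g f h x
  rw [← gradInner_self, ← gradInner_self]
  unfold gradInner gradInnerIn at hcomm ⊢
  set c := chartAt (EuclideanSpace ℝ (Fin n)) x
  set A := (gram g.toRiemannianMetric c (c x))⁻¹
  set d := fun i ↦ partialIn c f i (c x)
  set e := fun i ↦ partialIn c h i (c x)
  have key : ∀ t : ℝ, 0 ≤ t ^ 2 * (∑ i, ∑ j, A i j * ⟪d i, d j⟫) +
      2 * t * (∑ i, ∑ j, A i j * ⟪d i, e j⟫) + ∑ i, ∑ j, A i j * ⟪e i, e j⟫ := by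
    intro t
    have h1 := sum_mul_inner_nonneg hA (fun i ↦ t • d i + e i)
    have h2 : ∑ i, ∑ j, A i j * ⟪t • d i + e i, t • d j + e j⟫ =
        t ^ 2 * (∑ i, ∑ j, A i j * ⟪d i, d j⟫) + t * (∑ i, ∑ j, A i j * ⟪d i, e j⟫) +
          t * (∑ i, ∑ j, A i j * ⟪e i, d j⟫) + ∑ i, ∑ j, A i j * ⟪e i, e j⟫ := by
      simp only [inner_add_left, inner_add_right, real_inner_smul_left, real_inner_smul_right,
        Finset.mul_sum, ← Finset.sum_add_distrib]
      refine Finset.sum_congr rfl fun i _ ↦ Finset.sum_congr rfl fun j _ ↦ by ring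
    rw [h2, ← hcomm] at h1
    linarith
  have k1 := key δ
  have k2 := key (-δ)
  rw [abs_le]
  have hδ' : δ⁻¹ * δ = 1 := inv_mul_cancel₀ hδ.ne'
  have hi : 0 ≤ δ⁻¹ := (inv_pos.2 hδ).le
  constructor
  · have := mul_nonneg hi k1
    linear_combination (1 / 2 : ℝ) * this + (δ / 2 * (∑ i, ∑ j, A i j * ⟪d i, d j⟫) + ∑ i, ∑ j, A i j * ⟪d i, e j⟫) * hδ'
  · have := mul_nonneg hi k2
    linear_combination (1 / 2 : ℝ) * this + (δ / 2 * (∑ i, ∑ j, A i j * ⟪d i, d j⟫) - ∑ i, ∑ j, A i j * ⟪d i, e j⟫) * hδ'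

theorem partialIn_add {y : EuclideanSpace ℝ (Fin n)} (hf : DifferentiableAt ℝ (f ∘ c.symm) y)
    (hh : DifferentiableAt ℝ (h ∘ c.symm) y) (i : Fin n) :
    partialIn c (fun x ↦ f x + h x) i y = partialIn c f i y + partialIn c h i y := by
  unfold partialIn
  have : (fun x ↦ f x + h x) ∘ c.symm = f ∘ c.symm + h ∘ c.symm := rfl
  rw [this, fderiv_add hf hh]; rfl

theorem partialIn_sub {y : EuclideanSpace ℝ (Fin n)} (hf : DifferentiableAt ℝ (f ∘ c.symm) y)
    (hh : DifferentiableAt ℝ (h ∘ c.symm) y) (i : Fin n) :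
    partialIn c (fun x ↦ f x - h x) i y = partialIn c f i y - partialIn c h i y := by
  unfold partialIn
  have : (fun x ↦ f x - h x) ∘ c.symm = f ∘ c.symm - h ∘ c.symm := rfl
  rw [this, fderiv_sub hf hh]; rfl

theorem gradInner_add_right (hh : ContMDiff (𝓡 n) 𝓘(ℝ, F) ∞ h)
    (hk : ContMDiff (𝓡 n) 𝓘(ℝ, F) ∞ k) (x : M) :
    gradInner g.toRiemannianMetric f (fun x ↦ h x + k x) x =
      gradInner g.toRiemannianMetric f h x + gradInner g.toRiemannianMetric f k x := by
  unfold gradInner gradInnerIn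
  simp only [partialIn_add (differentiableAt_comp_symm (IsManifold.chart_mem_maximalAtlas x) hh
    (mem_chart_target _ x)) (differentiableAt_comp_symm (IsManifold.chart_mem_maximalAtlas x) hk
    (mem_chart_target _ x)), inner_add_right, mul_add, Finset.sum_add_distrib]

theorem gradInner_sub_right (hh : ContMDiff (𝓡 n) 𝓘(ℝ, F) ∞ h)
    (hk : ContMDiff (𝓡 n) 𝓘(ℝ, F) ∞ k) (x : M) :
    gradInner g.toRiemannianMetric f (fun x ↦ h x - k x) x =
      gradInner g.toRiemannianMetric f h x - gradInner g.toRiemannianMetric f k x := by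
  unfold gradInner gradInnerIn
  simp only [partialIn_sub (differentiableAt_comp_symm (IsManifold.chart_mem_maximalAtlas x) hh
    (mem_chart_target _ x)) (differentiableAt_comp_symm (IsManifold.chart_mem_maximalAtlas x) hk
    (mem_chart_target _ x)), inner_sub_right, mul_sub, Finset.sum_sub_distrib]

theorem partialIn_eq_zero {x : M} (hx : x ∈ c.source) (hf : x ∉ tsupport f) (i : Fin n) :
    partialIn c f i (c x) = 0 := by
  have h1 : f ∘ c.symm =ᶠ[𝓝 (c x)] fun _ ↦ 0 := by
    have h2 : c.symm ⁻¹' (tsupport f)ᶜ ∈ 𝓝 (c x) := by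
      refine (c.symm.continuousAt (c.map_source hx)).preimage_mem_nhds ?_
      rw [c.left_inv hx]
      exact (isClosed_tsupport f).isOpen_compl.mem_nhds hf
    filter_upwards [h2] with z hz
    exact image_eq_zero_of_notMem_tsupport (f := f) hz
  unfold partialIn
  rw [h1.fderiv_eq]; simp

theorem gradInner_eq_zero_of_notMem {x : M} (hh : x ∉ tsupport h) :
    gradInner g.toRiemannianMetric f h x = 0 := by
  unfold gradInner gradInnerIn
  simp only [partialIn_eq_zero (mem_chart_source _ x) hh, inner_zero_right, mul_zero,
    Finset.sum_const_zero]

theorem gradInner_zero_right (x : M) :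
    gradInner g.toRiemannianMetric f (fun _ ↦ 0) x = 0 :=
  gradInner_eq_zero_of_notMem g (by simp [tsupport])

theorem gradInner_sum_right {ι : Type*} (s : Finset ι) {v : ι → M → F}
    (hv : ∀ i ∈ s, ContMDiff (𝓡 n) 𝓘(ℝ, F) ∞ (v i)) (x : M) :
    gradInner g.toRiemannianMetric f (fun x ↦ ∑ i ∈ s, v i x) x =
      ∑ i ∈ s, gradInner g.toRiemannianMetric f (v i) x := by
  classical
  induction s using Finset.induction_on with
  | empty => simp [gradInner_zero_right]
  | insert i s hi ih =>
    simp only [Finset.sum_insert hi]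
    rw [gradInner_add_right g (hv i (Finset.mem_insert_self _ _))
      (contMDiff_finsetSum fun j hj ↦ hv j (Finset.mem_insert_of_mem hj)),
      ih fun j hj ↦ hv j (Finset.mem_insert_of_mem hj)]

end GradientCalculus

/-! ### The drift Laplacian in divergence form -/

section DriftInChart

variable {n : ℕ} {M : Type*} [TopologicalSpace M]
  [ChartedSpace (EuclideanSpace ℝ (Fin n)) M] [IsManifold (𝓡 n) ∞ M]
  {F : Type*} [NormedAddCommGroup F] [InnerProductSpace ℝ F]
  (g : Bundle.ContMDiffRiemannianMetric (𝓡 n) ∞ (EuclideanSpace ℝ (Fin n))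
        (fun x : M ↦ TangentSpace (𝓡 n) x))
  {c c' : OpenPartialHomeomorph M (EuclideanSpace ℝ (Fin n))}
  {f : M → F} {φ : M → ℝ}

/-- The drift Laplacian computed in the chart `c`. -/
def driftIn (g : Bundle.RiemannianMetric (fun x : M ↦ TangentSpace (𝓡 n) x))
    (c : OpenPartialHomeomorph M (EuclideanSpace ℝ (Fin n))) (φ : M → ℝ) (f : M → F)
    (y : EuclideanSpace ℝ (Fin n)) : F :=
  (volDensity g c y)⁻¹ •
    ∑ i, fderiv ℝ (fun z ↦ ∑ j, (volDensity g c z * (gram g c z)⁻¹ i j) • partialIn c f j z)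
      y (EuclideanSpace.single i (1 : ℝ)) -
  ∑ i, ∑ j, ((gram g c y)⁻¹ i j * partialIn c φ j y) • partialIn c f i y

/-- The coordinates of the vector field `e^(-φ) √(det g) ∇f`. -/
def weightedFlux (g : Bundle.RiemannianMetric (fun x : M ↦ TangentSpace (𝓡 n) x))
    (c : OpenPartialHomeomorph M (EuclideanSpace ℝ (Fin n))) (φ : M → ℝ) (f : M → F)
    (i : Fin n) (y : EuclideanSpace ℝ (Fin n)) : F :=
  Real.exp (-φ (c.symm y)) •
    ∑ j, (volDensity g c y * (gram g c y)⁻¹ i j) • partialIn c f j y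

theorem contDiffOn_flux (hc : c ∈ IsManifold.maximalAtlas (𝓡 n) ∞ M)
    (hf : ContMDiff (𝓡 n) 𝓘(ℝ, F) ∞ f) (i : Fin n) :
    ContDiffOn ℝ ∞ (fun y ↦ ∑ j, (volDensity g.toRiemannianMetric c y *
      (gram g.toRiemannianMetric c y)⁻¹ i j) • partialIn c f j y) c.target :=
  ContDiffOn.sum fun j _ ↦ ((contDiffOn_volDensity g hc).mul (contDiffOn_gram_inv g hc i j)).smul
    (contDiffOn_partialIn hc hf j)

theorem contDiffOn_weightedFlux (hc : c ∈ IsManifold.maximalAtlas (𝓡 n) ∞ M)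
    (hφ : ContMDiff (𝓡 n) 𝓘(ℝ, ℝ) ∞ φ) (hf : ContMDiff (𝓡 n) 𝓘(ℝ, F) ∞ f) (i : Fin n) :
    ContDiffOn ℝ ∞ (weightedFlux g.toRiemannianMetric c φ f i) c.target :=
  (contDiffOn_comp_symm hc hφ).neg.exp.smul (contDiffOn_flux g hc hf i)

/-- Differentiating the factor e^(-φ) of the flux produces exactly the drift term, so the weighted
operator is a divergence; the symmetry of g^ij matches the indices. -/
theorem smul_driftIn (hc : c ∈ IsManifold.maximalAtlas (𝓡 n) ∞ M)
    (hφ : ContMDiff (𝓡 n) 𝓘(ℝ, ℝ) ∞ φ) (hf : ContMDiff (𝓡 n) 𝓘(ℝ, F) ∞ f)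
    {y : EuclideanSpace ℝ (Fin n)} (hy : y ∈ c.target) :
    (volDensity g.toRiemannianMetric c y * Real.exp (-φ (c.symm y))) •
        driftIn g.toRiemannianMetric c φ f y =
      ∑ i, fderiv ℝ (weightedFlux g.toRiemannianMetric c φ f i) y
        (EuclideanSpace.single i (1 : ℝ)) := by
  have hnh := c.open_target.mem_nhds hy
  have h1 : ∀ i, fderiv ℝ (weightedFlux g.toRiemannianMetric c φ f i) y
        (EuclideanSpace.single i (1 : ℝ)) =
      Real.exp (-φ (c.symm y)) • fderiv ℝ (fun z ↦ ∑ j, (volDensity g.toRiemannianMetric c z *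
        (gram g.toRiemannianMetric c z)⁻¹ i j) • partialIn c f j z) y
          (EuclideanSpace.single i (1 : ℝ)) -
      (Real.exp (-φ (c.symm y)) * partialIn c φ i y) •
        ∑ j, (volDensity g.toRiemannianMetric c y * (gram g.toRiemannianMetric c y)⁻¹ i j) •
          partialIn c f j y := by
    intro i
    have hd := (((contDiffOn_flux g hc hf i).contDiffAt hnh).differentiableAt
      (by simp)).hasFDerivAt
    have hp := (differentiableAt_comp_symm hc hφ hy).hasFDerivAt
    have h2 := (hp.neg.exp.smul hd).fderiv
    have h3 : weightedFlux g.toRiemannianMetric c φ f i = (fun z ↦ Real.exp ((-(φ ∘ c.symm)) z)) •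
      (fun z ↦ ∑ j, (volDensity g.toRiemannianMetric c z *
        (gram g.toRiemannianMetric c z)⁻¹ i j) • partialIn c f j z) := rfl
    rw [h3, h2]
    simp only [add_apply, smul_apply, ContinuousLinearMap.smulRight_apply, neg_apply, smul_eq_mul,
      Pi.neg_apply, Function.comp_apply, mul_neg, neg_smul, sub_eq_add_neg]
    rfl
  simp only [h1]
  rw [Finset.sum_sub_distrib, ← Finset.smul_sum]
  unfold driftIn
  rw [smul_sub, smul_smul]
  have hv := (volDensity_pos g hc hy).ne'
  congr 1
  · congr 1
    field_simp
  · simp only [Finset.smul_sum, smul_smul]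
    rw [Finset.sum_comm]
    refine Finset.sum_congr rfl fun i _ ↦ Finset.sum_congr rfl fun j _ ↦ ?_
    congr 1
    have := (gram_posDef g hc hy).posSemidef.inv.isHermitian.apply j i
    rw [star_trivial] at this
    rw [this]
    ring

theorem continuousOn_driftIn (hc : c ∈ IsManifold.maximalAtlas (𝓡 n) ∞ M)
    (hφ : ContMDiff (𝓡 n) 𝓘(ℝ, ℝ) ∞ φ) (hf : ContMDiff (𝓡 n) 𝓘(ℝ, F) ∞ f) :
    ContinuousOn (driftIn g.toRiemannianMetric c φ f) c.target := by
  unfold driftIn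
  refine ContinuousOn.sub (ContinuousOn.smul ?_ ?_) ?_
  · exact (contDiffOn_volDensity g hc).continuousOn.inv₀ fun y hy ↦ (volDensity_pos g hc hy).ne'
  · refine continuousOn_finsetSum _ fun i _ ↦ ?_
    exact (((contDiffOn_flux g hc hf i).fderiv_of_isOpen c.open_target (m := ∞)
      (by simp)).clm_apply contDiffOn_const).continuousOn
  · refine continuousOn_finsetSum _ fun i _ ↦ continuousOn_finsetSum _ fun j _ ↦ ?_
    exact ((contDiffOn_gram_inv g hc i j).continuousOn.mul
      (contDiffOn_partialIn hc hφ j).continuousOn).smul (contDiffOn_partialIn hc hf i).continuousOn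

end DriftInChart

/-! ### Weak form and chart independence of the drift Laplacian -/

section WeakFormula

variable {n : ℕ} {M : Type*} [TopologicalSpace M] [T2Space M]
  [ChartedSpace (EuclideanSpace ℝ (Fin n)) M] [IsManifold (𝓡 n) ∞ M]
  [MeasurableSpace M] [BorelSpace M]
  {F : Type*} [NormedAddCommGroup F] [InnerProductSpace ℝ F]
  (g : Bundle.ContMDiffRiemannianMetric (𝓡 n) ∞ (EuclideanSpace ℝ (Fin n))
        (fun x : M ↦ TangentSpace (𝓡 n) x))
  {f v : M → F} {φ : M → ℝ}

/-- A function read in the chart `c`, extended by zero. -/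
def readIn (c : OpenPartialHomeomorph M (EuclideanSpace ℝ (Fin n))) (v : M → F) :
    EuclideanSpace ℝ (Fin n) → F :=
  indicator c.target (v ∘ c.symm)

variable {c : OpenPartialHomeomorph M (EuclideanSpace ℝ (Fin n))}

theorem isCompact_image_tsupport (hv : HasCompactSupport v) (hs : tsupport v ⊆ c.source) :
    IsCompact (c '' tsupport v) :=
  hv.isCompact.image_of_continuousOn (c.continuousOn.mono hs)

theorem image_tsupport_subset (hs : tsupport v ⊆ c.source) : c '' tsupport v ⊆ c.target := by
  rintro _ ⟨x, hx, rfl⟩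
  exact c.map_source (hs hx)

theorem readIn_eq_zero {y : EuclideanSpace ℝ (Fin n)} (hy : y ∉ c '' tsupport v) :
    readIn c v y = 0 := by
  unfold readIn
  by_cases hyt : y ∈ c.target
  · rw [indicator_of_mem hyt, Function.comp_apply]
    apply image_eq_zero_of_notMem_tsupport
    exact fun h ↦ hy ⟨_, h, c.right_inv hyt⟩
  · exact indicator_of_notMem hyt _

theorem tsupport_readIn_subset (hv : HasCompactSupport v) (hs : tsupport v ⊆ c.source) :
    tsupport (readIn c v) ⊆ c '' tsupport v :=
  closure_minimal (fun y hy ↦ by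
    by_contra h
    exact hy (readIn_eq_zero h)) (isCompact_image_tsupport hv hs).isClosed

theorem readIn_eventuallyEq {y : EuclideanSpace ℝ (Fin n)} (hy : y ∈ c.target) :
    readIn c v =ᶠ[𝓝 y] v ∘ c.symm := by
  filter_upwards [c.open_target.mem_nhds hy] with z hz
  exact indicator_of_mem hz _

theorem contDiff_readIn (hc : c ∈ IsManifold.maximalAtlas (𝓡 n) ∞ M)
    (hv : ContMDiff (𝓡 n) 𝓘(ℝ, F) ∞ v) (hcs : HasCompactSupport v)
    (hs : tsupport v ⊆ c.source) : ContDiff ℝ ∞ (readIn c v) := by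
  refine contDiff_iff_contDiffAt.2 fun y ↦ ?_
  by_cases hy : y ∈ c '' tsupport v
  · have hyt := image_tsupport_subset hs hy
    exact (contDiffAt_comp_symm hc hv hyt).congr_of_eventuallyEq (readIn_eventuallyEq hyt)
  · refine (contDiffAt_const (c := (0 : F))).congr_of_eventuallyEq ?_
    filter_upwards [(isCompact_image_tsupport hcs hs).isClosed.isOpen_compl.mem_nhds hy] with z hz
    exact readIn_eq_zero hz

/-- W is smooth only on the target, but `readIn c v` vanishes off a compact subset of it. All
integrands are therefore integrable, and integration by parts on the whole space applies in each
coordinate. -/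
theorem integral_sum_fderiv_inner (hc : c ∈ IsManifold.maximalAtlas (𝓡 n) ∞ M)
    (hv : ContMDiff (𝓡 n) 𝓘(ℝ, F) ∞ v) (hcs : HasCompactSupport v)
    (hs : tsupport v ⊆ c.source) {W : Fin n → EuclideanSpace ℝ (Fin n) → F}
    (hW : ∀ i, ContDiffOn ℝ ∞ (W i) c.target) :
    ∫ y, ∑ i, ⟪fderiv ℝ (W i) y (EuclideanSpace.single i (1 : ℝ)), readIn c v y⟫ =
      -∫ y, ∑ i, ⟪W i y, fderiv ℝ (readIn c v) y (EuclideanSpace.single i (1 : ℝ))⟫ := by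
  have hK := isCompact_image_tsupport hcs hs
  have hKt := image_tsupport_subset hs
  have hts := tsupport_readIn_subset hcs hs
  have hr := contDiff_readIn hc hv hcs hs
  have hint : ∀ q : EuclideanSpace ℝ (Fin n) → ℝ, ContinuousOn q c.target →
      (∀ y, y ∉ c '' tsupport v → q y = 0) → Integrable q := fun q hq h0 ↦
    (integrableOn_iff_integrable_of_support_subset (fun y hy ↦ by
      by_contra h; exact hy (h0 y h))).1 ((hq.mono hKt).integrableOn_compact hK)
  have hdr : ∀ i, Continuous fun y ↦
      fderiv ℝ (readIn c v) y (EuclideanSpace.single i (1 : ℝ)) := fun i ↦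
    (hr.continuous_fderiv (by simp)).clm_apply continuous_const
  have hdW : ∀ i, ContinuousOn (fun y ↦ fderiv ℝ (W i) y (EuclideanSpace.single i (1 : ℝ)))
      c.target := fun i ↦
    (((hW i).fderiv_of_isOpen c.open_target (m := ∞) (by simp)).clm_apply
      contDiffOn_const).continuousOn
  have h1 : ∀ i, Integrable fun y ↦
      ⟪fderiv ℝ (W i) y (EuclideanSpace.single i (1 : ℝ)), readIn c v y⟫ := fun i ↦
    hint _ ((hdW i).inner hr.continuous.continuousOn) fun y hy ↦ by
      rw [readIn_eq_zero hy, inner_zero_right]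
  have h2 : ∀ i, Integrable fun y ↦
      ⟪W i y, fderiv ℝ (readIn c v) y (EuclideanSpace.single i (1 : ℝ))⟫ := fun i ↦
    hint _ ((hW i).continuousOn.inner (hdr i).continuousOn) fun y hy ↦ by
      rw [fderiv_of_notMem_tsupport ℝ (fun h ↦ hy (hts h))]; simp
  have h3 : ∀ i, Integrable fun y ↦ ⟪W i y, readIn c v y⟫ := fun i ↦
    hint _ ((hW i).continuousOn.inner hr.continuous.continuousOn) fun y hy ↦ by
      rw [readIn_eq_zero hy, inner_zero_right]
  rw [integral_finsetSum _ fun i _ ↦ h1 i, integral_finsetSum _ fun i _ ↦ h2 i,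
    ← Finset.sum_neg_distrib]
  refine Finset.sum_congr rfl fun i _ ↦ ?_
  rw [eq_neg_iff_add_eq_zero, add_comm, ← eq_neg_iff_add_eq_zero]
  exact integral_bilinear_fderiv_right_eq_neg_left_of_integrable (B := innerSL ℝ) (h1 i) (h2 i)
    (h3 i) (fun y hy ↦ ((hW i).contDiffAt
      (c.open_target.mem_nhds (hKt (hts hy)))).differentiableAt (by simp))
    (fun y _ ↦ hr.contDiffAt.differentiableAt (by simp))

/-- The operator on the left is read in one chart, while the right side no longer mentions it; this
is what gives chart independence. -/
theorem integral_inner_driftIn (hφ : ContMDiff (𝓡 n) 𝓘(ℝ, ℝ) ∞ φ)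
    (hf : ContMDiff (𝓡 n) 𝓘(ℝ, F) ∞ f) (hv : ContMDiff (𝓡 n) 𝓘(ℝ, F) ∞ v)
    (hcs : HasCompactSupport v) (x₀ : M)
    (hs : tsupport v ⊆ (chartAt (EuclideanSpace ℝ (Fin n)) x₀).source) :
    ∫ x, ⟪driftIn g.toRiemannianMetric (chartAt (EuclideanSpace ℝ (Fin n)) x₀) φ f
        (chartAt (EuclideanSpace ℝ (Fin n)) x₀ x), v x⟫ ∂(weightedVolume g.toRiemannianMetric φ) =
      -∫ x, gradInner g.toRiemannianMetric f v x ∂(weightedVolume g.toRiemannianMetric φ) := by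
  obtain ⟨c, hcx⟩ : ∃ c, c = chartAt (EuclideanSpace ℝ (Fin n)) x₀ := ⟨_, rfl⟩
  rw [← hcx] at hs ⊢
  have hc : c ∈ IsManifold.maximalAtlas (𝓡 n) ∞ M :=
    hcx ▸ IsManifold.chart_mem_maximalAtlas x₀
  have hKt := image_tsupport_subset hs
  have hts := tsupport_readIn_subset hcs hs
  rw [integral_weightedVolume_eq g hφ.continuous x₀ hcx
      (f := fun x ↦ ⟪driftIn g.toRiemannianMetric c φ f (c x), v x⟫)
      (((continuousOn_driftIn g hc hφ hf).comp c.continuousOn fun x hx ↦ c.map_source hx).inner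
        hv.continuous.continuousOn)
      (fun x hx ↦ by
        rw [image_eq_zero_of_notMem_tsupport fun h ↦ hx (hs h), inner_zero_right]),
    integral_weightedVolume_eq g hφ.continuous x₀ hcx
      (continuous_gradInner g hf hv).continuousOn
      (fun x hx ↦ gradInner_eq_zero_of_notMem g fun h ↦ hx (hs h))]
  have key := integral_sum_fderiv_inner hc hv hcs hs
    (fun i ↦ contDiffOn_weightedFlux g hc hφ hf i)
  have e1 := setIntegral_eq_integral_of_forall_compl_eq_zero (μ := volume) (s := c.target)
    (f := fun y ↦ ∑ i, ⟪fderiv ℝ (weightedFlux g.toRiemannianMetric c φ f i) y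
      (EuclideanSpace.single i (1 : ℝ)), readIn c v y⟫) (fun y hy ↦
      Finset.sum_eq_zero fun i _ ↦ by
        rw [readIn_eq_zero fun h ↦ hy (hKt h), inner_zero_right])
  have e2 := setIntegral_eq_integral_of_forall_compl_eq_zero (μ := volume) (s := c.target)
    (f := fun y ↦ ∑ i, ⟪weightedFlux g.toRiemannianMetric c φ f i y,
      fderiv ℝ (readIn c v) y (EuclideanSpace.single i (1 : ℝ))⟫) (fun y hy ↦
      Finset.sum_eq_zero fun i _ ↦ by
        rw [fderiv_of_notMem_tsupport ℝ (fun h ↦ hy (hKt (hts h)))]; simp)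
  rw [← e1, ← e2] at key
  refine Eq.trans ?_ (key.trans ?_)
  · refine setIntegral_congr_fun c.open_target.measurableSet fun y hy ↦ ?_
    rw [c.right_inv hy, ← real_inner_smul_left, smul_driftIn g hc hφ hf hy, sum_inner,
      readIn, indicator_of_mem hy, Function.comp_apply]
  · congr 1
    refine setIntegral_congr_fun c.open_target.measurableSet fun y hy ↦ ?_
    rw [gradInner_eq_gradInnerIn g hc hf hv (c.map_target hy), c.right_inv hy]
    unfold gradInnerIn weightedFlux
    rw [Finset.sum_comm, Finset.mul_sum]
    refine Finset.sum_congr rfl fun i _ ↦ ?_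
    rw [(readIn_eventuallyEq hy).fderiv_eq, real_inner_smul_left, sum_inner, Finset.mul_sum,
      Finset.mul_sum]
    refine Finset.sum_congr rfl fun j _ ↦ ?_
    have := (gram_posDef g hc hy).posSemidef.inv.isHermitian.apply i j
    rw [star_trivial] at this
    rw [this, real_inner_smul_left]
    unfold partialIn
    ring

theorem continuousOn_driftIn_comp (hφ : ContMDiff (𝓡 n) 𝓘(ℝ, ℝ) ∞ φ)
    (hf : ContMDiff (𝓡 n) 𝓘(ℝ, F) ∞ f) (hc : c ∈ IsManifold.maximalAtlas (𝓡 n) ∞ M) :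
    ContinuousOn (fun x ↦ driftIn g.toRiemannianMetric c φ f (c x)) c.source :=
  (continuousOn_driftIn g hc hφ hf).comp c.continuousOn fun _ hx ↦ c.map_source hx

/-- The drift Laplacian does not depend on the chart: its weak form does not. -/
theorem driftIn_eq_of_mem_source [SecondCountableTopology M] (hφ : ContMDiff (𝓡 n) 𝓘(ℝ, ℝ) ∞ φ)
    (hf : ContMDiff (𝓡 n) 𝓘(ℝ, F) ∞ f) (x₀ x₁ : M) {x : M}
    (hx₀ : x ∈ (chartAt (EuclideanSpace ℝ (Fin n)) x₀).source)
    (hx₁ : x ∈ (chartAt (EuclideanSpace ℝ (Fin n)) x₁).source) :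
    driftIn g.toRiemannianMetric (chartAt (EuclideanSpace ℝ (Fin n)) x₀) φ f
        (chartAt (EuclideanSpace ℝ (Fin n)) x₀ x) =
      driftIn g.toRiemannianMetric (chartAt (EuclideanSpace ℝ (Fin n)) x₁) φ f
        (chartAt (EuclideanSpace ℝ (Fin n)) x₁ x) := by
  set c₀ := chartAt (EuclideanSpace ℝ (Fin n)) x₀
  set c₁ := chartAt (EuclideanSpace ℝ (Fin n)) x₁
  set ν := weightedVolume g.toRiemannianMetric φ
  have hlf : IsLocallyFiniteMeasure ν := isLocallyFiniteMeasure_weightedVolume g hφ.continuous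
  have hop : ν.IsOpenPosMeasure := isOpenPosMeasure_weightedVolume g hφ.continuous
  have hlc : LocallyCompactSpace M :=
    ChartedSpace.locallyCompactSpace (EuclideanSpace ℝ (Fin n)) M
  have hU : IsOpen (c₀.source ∩ c₁.source) := c₀.open_source.inter c₁.open_source
  set U := c₀.source ∩ c₁.source
  have hC₀ : ContinuousOn (fun x ↦ driftIn g.toRiemannianMetric c₀ φ f (c₀ x)) U :=
    (continuousOn_driftIn_comp g hφ hf (IsManifold.chart_mem_maximalAtlas x₀)).mono
      inter_subset_left
  have hC₁ : ContinuousOn (fun x ↦ driftIn g.toRiemannianMetric c₁ φ f (c₁ x)) U :=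
    (continuousOn_driftIn_comp g hφ hf (IsManifold.chart_mem_maximalAtlas x₁)).mono
      inter_subset_right
  -- Pairing with a fixed vector w reduces the claim to scalar functions, and ψ • w serves as test
  -- function.
  refine ext_inner_right ℝ fun w ↦ ?_
  set q₀ := fun x ↦ ⟪driftIn g.toRiemannianMetric c₀ φ f (c₀ x), w⟫
  set q₁ := fun x ↦ ⟪driftIn g.toRiemannianMetric c₁ φ f (c₁ x), w⟫
  have hq₀ : ContinuousOn q₀ U := hC₀.inner continuousOn_const
  have hq₁ : ContinuousOn q₁ U := hC₁.inner continuousOn_const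
  have hae : ∀ᵐ x ∂ν, x ∈ U → q₀ x - q₁ x = 0 := by
    refine hU.ae_eq_zero_of_integral_contMDiff_smul_eq_zero (𝓡 n)
      ((hq₀.sub hq₁).locallyIntegrableOn hU.measurableSet) fun ψ hψ hψc hψU ↦ ?_
    have hsup : tsupport (fun x ↦ ψ x • w) ⊆ tsupport ψ :=
      closure_mono fun x hx hx' ↦ hx (by simp only [hx', zero_smul])
    have hvs : ContMDiff (𝓡 n) 𝓘(ℝ, F) ∞ fun x ↦ ψ x • w := hψ.smul contMDiff_const
    have hvc : HasCompactSupport fun x ↦ ψ x • w :=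
      hψc.of_isClosed_subset (isClosed_tsupport _) hsup
    have k₀ := integral_inner_driftIn g hφ hf hvs hvc x₀
      (hsup.trans (hψU.trans inter_subset_left))
    have k₁ := integral_inner_driftIn g hφ hf hvs hvc x₁
      (hsup.trans (hψU.trans inter_subset_right))
    have hint : ∀ q : M → ℝ, ContinuousOn q U → Integrable (fun x ↦ ψ x * q x) ν := fun q hq ↦
      (integrableOn_iff_integrable_of_support_subset (s := tsupport ψ) (fun x hx ↦ by
        by_contra h
        exact hx (by simp only [image_eq_zero_of_notMem_tsupport h, zero_mul]))).1
        ((hψ.continuous.continuousOn.mul (hq.mono hψU)).integrableOn_compact hψc)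
    have i₀ : ∫ x, ψ x * q₀ x ∂ν = ∫ x, ψ x * q₁ x ∂ν := by
      refine Eq.trans ?_ ((k₀.trans k₁.symm).trans ?_)
      · simp only [real_inner_smul_right]; rfl
      · simp only [real_inner_smul_right]; rfl
    simp only [smul_eq_mul, mul_sub]
    rw [integral_sub (hint q₀ hq₀) (hint q₁ hq₁), i₀, sub_self]
  -- Continuous functions equal almost everywhere on an open set are equal there, because ν charges
  -- every nonempty open set.
  have heq : EqOn q₀ q₁ U := by
    refine Measure.eqOn_open_of_ae_eq (μ := ν) ?_ hU hq₀ hq₁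
    rw [EventuallyEq, ae_restrict_iff' hU.measurableSet]
    filter_upwards [hae] with z hz hzU
    exact sub_eq_zero.1 (hz hzU)
  exact heq ⟨hx₀, hx₁⟩

theorem driftLaplacian_eq_driftIn [SecondCountableTopology M] (hφ : ContMDiff (𝓡 n) 𝓘(ℝ, ℝ) ∞ φ)
    (hf : ContMDiff (𝓡 n) 𝓘(ℝ, F) ∞ f) (x₀ : M) {x : M}
    (hx₀ : x ∈ (chartAt (EuclideanSpace ℝ (Fin n)) x₀).source) :
    driftLaplacian g.toRiemannianMetric φ f x =
      driftIn g.toRiemannianMetric (chartAt (EuclideanSpace ℝ (Fin n)) x₀) φ f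
        (chartAt (EuclideanSpace ℝ (Fin n)) x₀ x) :=
  driftIn_eq_of_mem_source g hφ hf x x₀ (mem_chart_source _ x) hx₀

theorem continuous_driftLaplacian [SecondCountableTopology M]
    (hφ : ContMDiff (𝓡 n) 𝓘(ℝ, ℝ) ∞ φ) (hf : ContMDiff (𝓡 n) 𝓘(ℝ, F) ∞ f) :
    Continuous (driftLaplacian g.toRiemannianMetric φ f) :=
  continuous_iff_continuousAt.2 fun x ↦
    ((continuousOn_driftIn_comp g hφ hf (IsManifold.chart_mem_maximalAtlas x)).congr
      fun _ hy ↦ driftLaplacian_eq_driftIn g hφ hf x hy).continuousAt (chart_source_mem_nhds _ x)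

theorem integral_inner_driftLaplacian_of_tsupport_subset [SecondCountableTopology M]
    (hφ : ContMDiff (𝓡 n) 𝓘(ℝ, ℝ) ∞ φ)
    (hf : ContMDiff (𝓡 n) 𝓘(ℝ, F) ∞ f) (hv : ContMDiff (𝓡 n) 𝓘(ℝ, F) ∞ v)
    (hcs : HasCompactSupport v) (x₀ : M)
    (hs : tsupport v ⊆ (chartAt (EuclideanSpace ℝ (Fin n)) x₀).source) :
    ∫ x, ⟪driftLaplacian g.toRiemannianMetric φ f x, v x⟫
        ∂(weightedVolume g.toRiemannianMetric φ) =
      -∫ x, gradInner g.toRiemannianMetric f v x ∂(weightedVolume g.toRiemannianMetric φ) := by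
  rw [← integral_inner_driftIn g hφ hf hv hcs x₀ hs]
  refine integral_congr_ae (ae_of_all _ fun x ↦ ?_)
  simp only []
  by_cases hx : x ∈ tsupport v
  · rw [driftLaplacian_eq_driftIn g hφ hf x₀ (hs hx)]
  · rw [image_eq_zero_of_notMem_tsupport hx, inner_zero_right, inner_zero_right]

theorem integrable_of_continuous_of_compact_tsupport {X : Type*} [TopologicalSpace X]
    [MeasurableSpace X] [BorelSpace X] {ν : Measure X} [IsLocallyFiniteMeasure ν] {q : X → ℝ}
    {K : Set X} (hK : IsCompact K) (hKm : MeasurableSet K) (hq : Continuous q) (h0 : ∀ x, x ∉ K → q x = 0) :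
    Integrable q ν :=
  (integrableOn_iff_integrable_of_support_subset (s := K) (fun x hx ↦ by
    by_contra h
    exact hx (h0 x h))).1 (hq.continuousOn.integrableOn_compact' hK hKm)

/-- The weak form of the drift Laplacian. -/
theorem integral_inner_driftLaplacian [SecondCountableTopology M]
    (hφ : ContMDiff (𝓡 n) 𝓘(ℝ, ℝ) ∞ φ)
    (hf : ContMDiff (𝓡 n) 𝓘(ℝ, F) ∞ f) (hv : ContMDiff (𝓡 n) 𝓘(ℝ, F) ∞ v)
    (hcs : HasCompactSupport v) :
    ∫ x, ⟪driftLaplacian g.toRiemannianMetric φ f x, v x⟫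
        ∂(weightedVolume g.toRiemannianMetric φ) =
      -∫ x, gradInner g.toRiemannianMetric f v x ∂(weightedVolume g.toRiemannianMetric φ) := by
  have hlf : IsLocallyFiniteMeasure (weightedVolume g.toRiemannianMetric φ) :=
    isLocallyFiniteMeasure_weightedVolume g hφ.continuous
  have hlc : LocallyCompactSpace M :=
    ChartedSpace.locallyCompactSpace (EuclideanSpace ℝ (Fin n)) M
  -- A partition of unity subordinate to the chart domains cuts v into pieces supported in one
  -- chart; by compactness only finitely many are nonzero.
  obtain ⟨p, hp⟩ := SmoothPartitionOfUnity.exists_isSubordinate (𝓡 n) isClosed_univ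
    (fun x : M ↦ (chartAt (EuclideanSpace ℝ (Fin n)) x).source)
    (fun x ↦ (chartAt (EuclideanSpace ℝ (Fin n)) x).open_source)
    (fun x _ ↦ mem_iUnion.2 ⟨x, mem_chart_source _ x⟩)
  have hfin := p.locallyFinite.finite_nonempty_inter_compact hcs.isCompact
  set s := hfin.toFinset
  have hps : ∀ i, tsupport (fun x ↦ p i x • v x) ⊆ tsupport v := fun i ↦
    closure_mono fun x hx hx' ↦ hx (by simp only [hx', smul_zero])
  have hps' : ∀ i, tsupport (fun x ↦ p i x • v x) ⊆ tsupport (p i) := fun i ↦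
    closure_mono fun x hx hx' ↦ hx (by simp only [hx', zero_smul])
  have hsm : ∀ i, ContMDiff (𝓡 n) 𝓘(ℝ, F) ∞ fun x ↦ p i x • v x := fun i ↦
    (p i).contMDiff.smul hv
  have hcc : ∀ i, HasCompactSupport fun x ↦ p i x • v x := fun i ↦
    hcs.of_isClosed_subset (isClosed_tsupport _) (hps i)
  have hsum : ∀ x, v x = ∑ i ∈ s, p i x • v x := by
    intro x
    by_cases hx : x ∈ tsupport v
    · rw [← Finset.sum_smul]
      have h1 := p.sum_eq_one (mem_univ x)
      rw [finsum_eq_sum_of_support_subset (s := s)] at h1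
      · rw [h1, one_smul]
      · intro i hi
        simp only [s, Finite.coe_toFinset]
        exact ⟨x, hi, hx⟩
    · simp [image_eq_zero_of_notMem_tsupport hx]
  have hL := continuous_driftLaplacian g hφ hf
  calc ∫ x, ⟪driftLaplacian g.toRiemannianMetric φ f x, v x⟫
        ∂(weightedVolume g.toRiemannianMetric φ)
      = ∫ x, ∑ i ∈ s, ⟪driftLaplacian g.toRiemannianMetric φ f x, p i x • v x⟫
        ∂(weightedVolume g.toRiemannianMetric φ) := by
        refine integral_congr_ae (ae_of_all _ fun x ↦ ?_)
        simp only []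
        rw [← inner_sum, ← hsum]
    _ = ∑ i ∈ s, ∫ x, ⟪driftLaplacian g.toRiemannianMetric φ f x, p i x • v x⟫
        ∂(weightedVolume g.toRiemannianMetric φ) := by
        refine integral_finsetSum _ fun i _ ↦ ?_
        refine integrable_of_continuous_of_compact_tsupport (hcc i).isCompact
          (isClosed_tsupport _).measurableSet (hL.inner (hsm i).continuous) fun x hx ↦ ?_
        rw [image_eq_zero_of_notMem_tsupport (f := fun x ↦ p i x • v x) hx, inner_zero_right]
    _ = ∑ i ∈ s, -∫ x, gradInner g.toRiemannianMetric f (fun x ↦ p i x • v x) x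
        ∂(weightedVolume g.toRiemannianMetric φ) := Finset.sum_congr rfl fun i _ ↦
        integral_inner_driftLaplacian_of_tsupport_subset g hφ hf (hsm i) (hcc i) i
          ((hps' i).trans (hp i))
    _ = -∫ x, ∑ i ∈ s, gradInner g.toRiemannianMetric f (fun x ↦ p i x • v x) x
        ∂(weightedVolume g.toRiemannianMetric φ) := by
        rw [Finset.sum_neg_distrib, integral_finsetSum _ fun i _ ↦ ?_]
        exact integrable_of_continuous_of_compact_tsupport (hcc i).isCompact
          (isClosed_tsupport _).measurableSet (continuous_gradInner g hf (hsm i)) fun x hx ↦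
          gradInner_eq_zero_of_notMem g hx
    _ = _ := by
        congr 1
        refine integral_congr_ae (ae_of_all _ fun x ↦ ?_)
        simp only []
        rw [← gradInner_sum_right g s fun i _ ↦ hsm i]
        congr 1
        funext z
        exact (hsum z).symm

end WeakFormula

/-! ### Integration by parts in W^{1,2} and inequalities at one time -/

section FixedTime

variable {n : ℕ} {M : Type*} [TopologicalSpace M] [T2Space M] [SecondCountableTopology M]
  [ChartedSpace (EuclideanSpace ℝ (Fin n)) M] [IsManifold (𝓡 n) ∞ M]
  [MeasurableSpace M] [BorelSpace M]
  {F : Type*} [NormedAddCommGroup F] [InnerProductSpace ℝ F]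
  (g : Bundle.ContMDiffRiemannianMetric (𝓡 n) ∞ (EuclideanSpace ℝ (Fin n))
        (fun x : M ↦ TangentSpace (𝓡 n) x))
  {f v : M → F} {φ : M → ℝ}

theorem continuous_gradSq (hf : ContMDiff (𝓡 n) 𝓘(ℝ, F) ∞ f) :
    Continuous (gradSq g.toRiemannianMetric f) :=
  continuous_gradInner g hf hf

theorem integrable_sobolev (hf : ContMDiff (𝓡 n) 𝓘(ℝ, F) ∞ f)
    (h : sobolevSq g.toRiemannianMetric φ f < ⊤) :
    Integrable (fun x ↦ ‖f x‖ ^ 2 + gradSq g.toRiemannianMetric f x)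
      (weightedVolume g.toRiemannianMetric φ) := by
  have hc : Continuous fun x ↦ ‖f x‖ ^ 2 + gradSq g.toRiemannianMetric f x :=
    (hf.continuous.norm.pow 2).add (continuous_gradSq g hf)
  refine ⟨hc.aestronglyMeasurable, ?_⟩
  rw [hasFiniteIntegral_iff_ofReal (ae_of_all _ fun x ↦
    add_nonneg (sq_nonneg _) (gradSq_nonneg g f x))]
  exact h

theorem integrable_norm_sq (hf : ContMDiff (𝓡 n) 𝓘(ℝ, F) ∞ f)
    (h : sobolevSq g.toRiemannianMetric φ f < ⊤) :
    Integrable (fun x ↦ ‖f x‖ ^ 2) (weightedVolume g.toRiemannianMetric φ) :=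
  (integrable_sobolev g hf h).mono' (hf.continuous.norm.pow 2).aestronglyMeasurable
    (ae_of_all _ fun x ↦ by
      rw [Real.norm_of_nonneg (sq_nonneg _)]
      linarith [gradSq_nonneg g f x])

theorem integrable_gradSq (hf : ContMDiff (𝓡 n) 𝓘(ℝ, F) ∞ f)
    (h : sobolevSq g.toRiemannianMetric φ f < ⊤) :
    Integrable (fun x ↦ gradSq g.toRiemannianMetric f x)
      (weightedVolume g.toRiemannianMetric φ) :=
  (integrable_sobolev g hf h).mono' (continuous_gradSq g hf).aestronglyMeasurable
    (ae_of_all _ fun x ↦ by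
      rw [Real.norm_of_nonneg (gradSq_nonneg g f x)]
      linarith [sq_nonneg ‖f x‖])

theorem integrable_gradInner (hf : ContMDiff (𝓡 n) 𝓘(ℝ, F) ∞ f)
    (hv : ContMDiff (𝓡 n) 𝓘(ℝ, F) ∞ v)
    (hfi : Integrable (fun x ↦ gradSq g.toRiemannianMetric f x)
      (weightedVolume g.toRiemannianMetric φ))
    (hvi : Integrable (fun x ↦ gradSq g.toRiemannianMetric v x)
      (weightedVolume g.toRiemannianMetric φ)) :
    Integrable (fun x ↦ gradInner g.toRiemannianMetric f v x)
      (weightedVolume g.toRiemannianMetric φ) :=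
  ((hfi.add hvi).div_const 2).mono' (continuous_gradInner g hf hv).aestronglyMeasurable
    (ae_of_all _ fun x ↦ by
      have := abs_gradInner_le g f v x one_pos
      rw [one_mul, inv_one, one_mul] at this
      exact this)

theorem abs_inner_le_weighted (x y : F) {δ : ℝ} (hδ : 0 < δ) :
    |⟪x, y⟫| ≤ (δ * ‖x‖ ^ 2 + δ⁻¹ * ‖y‖ ^ 2) / 2 := by
  refine (abs_real_inner_le_norm x y).trans ?_
  have h : 0 ≤ δ⁻¹ * (δ * ‖x‖ - ‖y‖) ^ 2 := by positivity
  have h2 : δ⁻¹ * (δ * ‖x‖ - ‖y‖) ^ 2 = δ * ‖x‖ ^ 2 - 2 * ‖x‖ * ‖y‖ + δ⁻¹ * ‖y‖ ^ 2 := by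
    field_simp
    ring
  linarith

theorem integrable_inner_of_sq {X : Type*} [MeasurableSpace X] {ν : Measure X} {p q : X → F}
    (hp : MemLp p 2 ν) (hq : MemLp q 2 ν) : Integrable (fun x ↦ ⟪p x, q x⟫) ν :=
  (hp.integrable_norm_pow (by norm_num) |>.add (hq.integrable_norm_pow (by norm_num))).mono'
    (hp.1.inner hq.1) (ae_of_all _ fun x ↦ by
      have := abs_inner_le_weighted (p x) (q x) one_pos
      simp only [one_mul, inv_one] at this
      simp only [Pi.add_apply, Real.norm_eq_abs]
      have h1 := sq_nonneg ‖p x‖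
      have h2 := sq_nonneg ‖q x‖
      linarith)

theorem memLp_two_of_continuous {p : M → F} {ν : Measure M} (hp : Continuous p)
    (h : Integrable (fun x ↦ ‖p x‖ ^ 2) ν) : MemLp p 2 ν :=
  (memLp_two_iff_integrable_sq_norm hp.aestronglyMeasurable).2 h

/-- Integration by parts against the functions of `W^{1,2}_φ`. -/
theorem integral_inner_driftLaplacian_of_memW12 (hφ : ContMDiff (𝓡 n) 𝓘(ℝ, ℝ) ∞ φ)
    (hf : ContMDiff (𝓡 n) 𝓘(ℝ, F) ∞ f) (hv : ContMDiff (𝓡 n) 𝓘(ℝ, F) ∞ v)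
    (hfi : Integrable (fun x ↦ gradSq g.toRiemannianMetric f x)
      (weightedVolume g.toRiemannianMetric φ))
    (hL : Integrable (fun x ↦ ‖driftLaplacian g.toRiemannianMetric φ f x‖ ^ 2)
      (weightedVolume g.toRiemannianMetric φ))
    (hvW : MemW12 g.toRiemannianMetric φ v) :
    ∫ x, ⟪driftLaplacian g.toRiemannianMetric φ f x, v x⟫
        ∂(weightedVolume g.toRiemannianMetric φ) =
      -∫ x, gradInner g.toRiemannianMetric f v x ∂(weightedVolume g.toRiemannianMetric φ) := by
  set ν := weightedVolume g.toRiemannianMetric φ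
  set L := driftLaplacian g.toRiemannianMetric φ f
  have hLc : Continuous L := continuous_driftLaplacian g hφ hf
  have hLm : MemLp L 2 ν := memLp_two_of_continuous hLc hL
  have hlf : IsLocallyFiniteMeasure ν := isLocallyFiniteMeasure_weightedVolume g hφ.continuous
  obtain ⟨hvf, w, hw, hlim⟩ := hvW
  have hvi1 := integrable_inner_of_sq hLm
    (memLp_two_of_continuous hv.continuous (integrable_norm_sq g hv hvf))
  have hvi2 := integrable_gradInner g hf hv hfi (integrable_gradSq g hv hvf)
  have hvv : Integrable (fun x ↦ ⟪L x, v x⟫ + gradInner g.toRiemannianMetric f v x) ν :=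
    hvi1.add hvi2
  have hLf : Integrable (fun x ↦ ‖L x‖ ^ 2 + gradSq g.toRiemannianMetric f x) ν := hL.add hfi
  set X := ∫ x, (⟪L x, v x⟫ + gradInner g.toRiemannianMetric f v x) ∂ν with hX
  set A := ∫ x, (‖L x‖ ^ 2 + gradSq g.toRiemannianMetric f x) ∂ν
  have hA : 0 ≤ A := integral_nonneg fun x ↦ add_nonneg (sq_nonneg _) (gradSq_nonneg g f x)
  have hX0 : X = 0 := by
    -- X does not change when v is replaced by v - w k, since the defect vanishes on functions of
    -- compact support. The weighted Cauchy-Schwarz inequality bounds it by δ A / 2 plus a multiple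
    -- of ‖v - w k‖²; let k tend to infinity, then δ to 0.
    have hbound : ∀ δ, 0 < δ → |X| ≤ δ * A := by
      intro δ hδ
      have hev : ∀ᶠ k in atTop, |X| ≤ δ / 2 * A +
          δ⁻¹ / 2 * (sobolevSq g.toRiemannianMetric φ (fun x ↦ v x - w k x)).toReal := by
        filter_upwards [hlim.eventually (gt_mem_nhds ENNReal.zero_lt_top)] with k hk
        obtain ⟨hwk, hwc⟩ := hw k
        have hd : ContMDiff (𝓡 n) 𝓘(ℝ, F) ∞ fun x ↦ v x - w k x := hv.sub hwk
        have hI := integrable_sobolev g hd hk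
        have hval : (sobolevSq g.toRiemannianMetric φ (fun x ↦ v x - w k x)).toReal =
            ∫ x, (‖v x - w k x‖ ^ 2 +
              gradSq g.toRiemannianMetric (fun x ↦ v x - w k x) x) ∂ν := by
          rw [integral_eq_lintegral_of_nonneg_ae (ae_of_all _ fun x ↦
            add_nonneg (sq_nonneg _) (gradSq_nonneg g _ x)) hI.1]
          rfl
        have hw1 : Integrable (fun x ↦ ⟪L x, w k x⟫) ν :=
          integrable_of_continuous_of_compact_tsupport hwc.isCompact
            (isClosed_tsupport _).measurableSet (hLc.inner hwk.continuous) fun x hx ↦ by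
              rw [image_eq_zero_of_notMem_tsupport hx, inner_zero_right]
        have hw2 : Integrable (fun x ↦ gradInner g.toRiemannianMetric f (w k) x) ν :=
          integrable_of_continuous_of_compact_tsupport hwc.isCompact
            (isClosed_tsupport _).measurableSet (continuous_gradInner g hf hwk) fun x hx ↦
              gradInner_eq_zero_of_notMem g hx
        have hzero : ∫ x, (⟪L x, w k x⟫ + gradInner g.toRiemannianMetric f (w k) x) ∂ν = 0 := by
          rw [integral_add hw1 hw2, integral_inner_driftLaplacian g hφ hf hwk hwc]
          exact neg_add_cancel _
        have hww : Integrable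
            (fun x ↦ ⟪L x, w k x⟫ + gradInner g.toRiemannianMetric f (w k) x) ν := hw1.add hw2
        have hXd : X = ∫ x, (⟪L x, v x - w k x⟫ +
            gradInner g.toRiemannianMetric f (fun x ↦ v x - w k x) x) ∂ν := by
          rw [hX, ← sub_zero (∫ x, _ ∂ν), ← hzero, ← integral_sub hvv hww]
          refine integral_congr_ae (ae_of_all _ fun x ↦ ?_)
          simp only []
          rw [gradInner_sub_right g hv hwk, inner_sub_right]
          ring
        rw [hXd, hval, ← integral_const_mul, ← integral_const_mul,
          ← integral_add (hLf.const_mul _) (hI.const_mul _), ← Real.norm_eq_abs]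
        refine norm_integral_le_of_norm_le
          ((hLf.const_mul _).add (hI.const_mul _)) (ae_of_all _ fun x ↦ ?_)
        have h1 := abs_inner_le_weighted (L x) (v x - w k x) hδ
        have h2 := abs_gradInner_le g f (fun x ↦ v x - w k x) x hδ
        rw [Real.norm_eq_abs]
        refine (abs_add_le _ _).trans ((add_le_add h1 h2).trans (le_of_eq ?_))
        ring
      have hto : Tendsto (fun k ↦ δ / 2 * A +
          δ⁻¹ / 2 * (sobolevSq g.toRiemannianMetric φ (fun x ↦ v x - w k x)).toReal) atTop
          (𝓝 (δ / 2 * A + δ⁻¹ / 2 * 0)) := by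
        refine tendsto_const_nhds.add (Tendsto.const_mul _ ?_)
        have := (ENNReal.tendsto_toReal ENNReal.zero_ne_top).comp hlim
        rw [ENNReal.toReal_zero] at this
        exact this
      have := ge_of_tendsto hto hev
      nlinarith [mul_nonneg hδ.le hA]
    have h0 : |X| ≤ 0 := by
      refine le_of_forall_pos_le_add fun ε hε ↦ ?_
      refine (hbound (ε / (A + 1)) (by positivity)).trans ?_
      rw [zero_add, div_mul_eq_mul_div, div_le_iff₀ (by positivity)]
      nlinarith
    exact abs_nonpos_iff.1 h0
  rw [hX, integral_add hvi1 hvi2] at hX0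
  linarith

theorem inner_toLp {X : Type*} [MeasurableSpace X] {ν : Measure X} {p q : X → F}
    (hp : MemLp p 2 ν) (hq : MemLp q 2 ν) :
    ⟪hp.toLp p, hq.toLp q⟫ = ∫ x, ⟪p x, q x⟫ ∂ν := by
  rw [L2.inner_def]
  refine integral_congr_ae ?_
  filter_upwards [hp.coeFn_toLp, hq.coeFn_toLp] with x h1 h2
  rw [h1, h2]

theorem norm_toLp_sq {X : Type*} [MeasurableSpace X] {ν : Measure X} {p : X → F}
    (hp : MemLp p 2 ν) : ‖hp.toLp p‖ ^ 2 = ∫ x, ‖p x‖ ^ 2 ∂ν := by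
  rw [← real_inner_self_eq_norm_sq, inner_toLp]
  simp only [real_inner_self_eq_norm_sq]

/-- The differential inequalities for the energies at one time: `p` is `u`, `q` is `u_t`. -/
theorem energy_inequalities (hφ : ContMDiff (𝓡 n) 𝓘(ℝ, ℝ) ∞ φ) {p q : M → F}
    (hp : ContMDiff (𝓡 n) 𝓘(ℝ, F) ∞ p) (hq : ContMDiff (𝓡 n) 𝓘(ℝ, F) ∞ q)
    (hpW : MemW12 g.toRiemannianMetric φ p) (hqW : MemW12 g.toRiemannianMetric φ q)
    {C K : ℝ} (hCK : C ≤ K) (hineq : ∀ x, ‖q x - driftLaplacian g.toRiemannianMetric φ p x‖ ≤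
      C * (‖p x‖ + √(gradSq g.toRiemannianMetric p x))) :
    (∀ ε, 0 < ε →
      (∫ x, 2 * gradInner g.toRiemannianMetric p q x ∂(weightedVolume g.toRiemannianMetric φ)) *
          (∫ x, ‖p x‖ ^ 2 ∂(weightedVolume g.toRiemannianMetric φ) + ε) -
        (∫ x, gradSq g.toRiemannianMetric p x ∂(weightedVolume g.toRiemannianMetric φ)) *
          (∫ x, 2 * ⟪p x, q x⟫ ∂(weightedVolume g.toRiemannianMetric φ)) ≤
      C ^ 2 * (∫ x, ‖p x‖ ^ 2 ∂(weightedVolume g.toRiemannianMetric φ) +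
        ∫ x, gradSq g.toRiemannianMetric p x ∂(weightedVolume g.toRiemannianMetric φ)) *
          (∫ x, ‖p x‖ ^ 2 ∂(weightedVolume g.toRiemannianMetric φ) + ε)) ∧
    -(2 + 2 * K ^ 2) * (∫ x, ‖p x‖ ^ 2 ∂(weightedVolume g.toRiemannianMetric φ) +
        ∫ x, gradSq g.toRiemannianMetric p x ∂(weightedVolume g.toRiemannianMetric φ)) ≤
      ∫ x, 2 * ⟪p x, q x⟫ ∂(weightedVolume g.toRiemannianMetric φ) := by
  set ν := weightedVolume g.toRiemannianMetric φ
  set L := driftLaplacian g.toRiemannianMetric φ p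
  have hLc : Continuous L := continuous_driftLaplacian g hφ hp
  -- C is replaced by D before squaring, so an upper bound for C suffices even where C is negative.
  -- D = C feeds the frequency inequality, D = K the lower bound on I'.
  have hsq : ∀ D : ℝ, C ≤ D → ∀ x, ‖q x - L x‖ ^ 2 ≤
      2 * D ^ 2 * (‖p x‖ ^ 2 + gradSq g.toRiemannianMetric p x) := by
    intro D hD x
    have h0 := Real.sqrt_nonneg (gradSq g.toRiemannianMetric p x)
    have h1 := Real.sq_sqrt (gradSq_nonneg g p x)
    have h2 : ‖q x - L x‖ ≤ D * (‖p x‖ + √(gradSq g.toRiemannianMetric p x)) :=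
      (hineq x).trans (mul_le_mul_of_nonneg_right hD (by positivity))
    calc ‖q x - L x‖ ^ 2 ≤ (D * (‖p x‖ + √(gradSq g.toRiemannianMetric p x))) ^ 2 :=
          pow_le_pow_left₀ (norm_nonneg _) h2 2
      _ ≤ 2 * D ^ 2 * (‖p x‖ ^ 2 + gradSq g.toRiemannianMetric p x) := by
          nlinarith [mul_nonneg (sq_nonneg D)
            (sq_nonneg (‖p x‖ - √(gradSq g.toRiemannianMetric p x)))]
  have hpi := integrable_sobolev g hp hpW.1
  have hp2 := memLp_two_of_continuous hp.continuous (integrable_norm_sq g hp hpW.1)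
  have hq2 := memLp_two_of_continuous hq.continuous (integrable_norm_sq g hq hqW.1)
  have hpg := integrable_gradSq g hp hpW.1
  have hfi : Integrable (fun x ↦ ‖q x - L x‖ ^ 2) ν :=
    (hpi.const_mul (2 * C ^ 2)).mono' ((hq.continuous.sub hLc).norm.pow 2).aestronglyMeasurable
      (ae_of_all _ fun x ↦ by
        rw [Real.norm_of_nonneg (sq_nonneg _)]; exact hsq C le_rfl x)
  have hf2 : MemLp (fun x ↦ q x - L x) 2 ν :=
    memLp_two_of_continuous (hq.continuous.sub hLc) hfi
  -- L = q - (q - L) is a difference of square integrable functions; no second derivative of p is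
  -- assumed integrable.
  have hL2 : MemLp L 2 ν := by
    have := hq2.sub hf2
    refine this.ae_eq (ae_of_all _ fun x ↦ ?_)
    simp
  have hLi : Integrable (fun x ↦ ‖L x‖ ^ 2) ν :=
    (memLp_two_iff_integrable_sq_norm hLc.aestronglyMeasurable).1 hL2
  have w1 := integral_inner_driftLaplacian_of_memW12 g hφ hp hp hpg hLi hpW
  have w2 := integral_inner_driftLaplacian_of_memW12 g hφ hp hq hpg hLi hqW
  set E := ∫ x, gradSq g.toRiemannianMetric p x ∂ν
  have hfn : ∀ D : ℝ, C ≤ D → ‖hq2.toLp q - hL2.toLp L‖ ^ 2 ≤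
      2 * D ^ 2 * (‖hp2.toLp p‖ ^ 2 + E) := by
    intro D hD
    rw [← MemLp.toLp_sub, norm_toLp_sq, norm_toLp_sq,
      ← integral_add (integrable_norm_sq g hp hpW.1) hpg, ← integral_const_mul]
    exact integral_mono hfi (hpi.const_mul _) fun x ↦ hsq D hD x
  have hLP : ⟪hL2.toLp L, hp2.toLp p⟫ = -E := by rw [inner_toLp]; exact w1
  have hLQ : ⟪hL2.toLp L, hq2.toLp q⟫ = -∫ x, gradInner g.toRiemannianMetric p q x ∂ν := by
    rw [inner_toLp]; exact w2
  rw [integral_const_mul, integral_const_mul, ← norm_toLp_sq hp2, ← inner_toLp hp2 hq2]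
  constructor
  · intro ε hε
    have := frequency_inner_ineq hε.le (hfn C le_rfl) hLP
    rw [hLQ] at this
    linarith
  · exact frequency_inner_lower (hfn K hCK) hLP

end FixedTime

/-! ### Exchange of space and time derivatives -/

section MixedPartials

variable {E F : Type*} [NormedAddCommGroup E] [NormedSpace ℝ E] [NormedAddCommGroup F]
  [NormedSpace ℝ F] {w : E × ℝ → F} {y e : E} {t : ℝ}

theorem hasDerivAt_time (hw : DifferentiableAt ℝ w (y, t)) :
    HasDerivAt (fun τ ↦ w (y, τ)) (fderiv ℝ w (y, t) (0, 1)) t := by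
  have h1 : HasDerivAt (fun τ : ℝ ↦ (y, τ)) ((0 : E), (1 : ℝ)) t :=
    (hasDerivAt_const t y).prodMk (hasDerivAt_id t)
  exact hw.hasFDerivAt.comp_hasDerivAt t h1

theorem fderiv_space_apply (hw : DifferentiableAt ℝ w (y, t)) (e : E) :
    fderiv ℝ (fun z ↦ w (z, t)) y e = fderiv ℝ w (y, t) (e, 0) := by
  have h1 : HasFDerivAt (fun z : E ↦ (z, t)) (ContinuousLinearMap.inl ℝ E ℝ) y :=
    (hasFDerivAt_id y).prodMk (hasFDerivAt_const t y)
  have h2 := hw.hasFDerivAt.comp y h1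
  have h3 : fderiv ℝ (fun z ↦ w (z, t)) y =
      (fderiv ℝ w (y, t)).comp (ContinuousLinearMap.inl ℝ E ℝ) := h2.fderiv
  rw [h3]; rfl

/-- Both partial derivatives are values of the total derivative on the product, so this is the
symmetry of the second derivative. -/
theorem hasDerivAt_fderiv_space {O : Set (E × ℝ)} (hO : IsOpen O) (hw : ContDiffOn ℝ ∞ w O)
    (hyt : (y, t) ∈ O) (e : E) :
    HasDerivAt (fun τ ↦ fderiv ℝ w (y, τ) (e, 0))
      (fderiv ℝ (fun p ↦ fderiv ℝ w p (0, 1)) (y, t) (e, 0)) t := by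
  have hw2 : ContDiffOn ℝ ∞ (fderiv ℝ w) O := hw.fderiv_of_isOpen hO (by simp)
  have hd : DifferentiableAt ℝ (fderiv ℝ w) (y, t) :=
    (hw2.contDiffAt (hO.mem_nhds hyt)).differentiableAt (by simp)
  have h1 : ∀ v : E × ℝ, fderiv ℝ (fun p ↦ fderiv ℝ w p v) (y, t) =
      (fderiv ℝ (fderiv ℝ w) (y, t)).flip v := fun v ↦
    ((hd.hasFDerivAt.clm_apply (hasFDerivAt_const v (y, t))).fderiv).trans (by
      rw [ContinuousLinearMap.comp_zero, zero_add])
  have hsymm : IsSymmSndFDerivAt ℝ w (y, t) :=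
    (hw.contDiffAt (hO.mem_nhds hyt)).isSymmSndFDerivAt (by
      simp only [minSmoothness_of_isRCLikeNormedField]; exact WithTop.coe_le_coe.2 (le_top : (2 : ℕ∞) ≤ ⊤))
  have h2 := hasDerivAt_time (w := fun p ↦ fderiv ℝ w p (e, 0)) (y := y) (t := t)
    (hd.clm_apply (differentiableAt_const _))
  rw [h1] at h2 ⊢
  simp only [ContinuousLinearMap.flip_apply] at h2 ⊢
  rwa [hsymm (e, 0) (0, 1)]

end MixedPartials

/-! ### Regularity in space and time -/

section TimeDependent

variable {n : ℕ} {M : Type*} [TopologicalSpace M]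
  [ChartedSpace (EuclideanSpace ℝ (Fin n)) M] [IsManifold (𝓡 n) ∞ M]
  {F : Type*} [NormedAddCommGroup F] [InnerProductSpace ℝ F]
  (g : Bundle.ContMDiffRiemannianMetric (𝓡 n) ∞ (EuclideanSpace ℝ (Fin n))
        (fun x : M ↦ TangentSpace (𝓡 n) x))
  {c : OpenPartialHomeomorph M (EuclideanSpace ℝ (Fin n))}
  {a : ℝ} {u : M → ℝ → F}

/-- The half-line is open so that full derivatives in (y, t) are available; the initial time is
recovered later by continuity. -/
theorem contDiffOn_spaceTime (hc : c ∈ IsManifold.maximalAtlas (𝓡 n) ∞ M)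
    (hu : ContMDiffOn ((𝓡 n).prod 𝓘(ℝ, ℝ)) 𝓘(ℝ, F) ∞ (fun p : M × ℝ ↦ u p.1 p.2)
      (univ ×ˢ Ioi a)) :
    ContDiffOn ℝ ∞ (fun p : EuclideanSpace ℝ (Fin n) × ℝ ↦ u (c.symm p.1) p.2)
      (c.target ×ˢ Ioi a) := by
  have h1 : ContMDiffOn 𝓘(ℝ, EuclideanSpace ℝ (Fin n) × ℝ) (𝓡 n) ∞
      (fun p : EuclideanSpace ℝ (Fin n) × ℝ ↦ c.symm p.1) (c.target ×ˢ Ioi a) :=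
    (contMDiffOn_symm_of_mem_maximalAtlas hc).comp contDiff_fst.contMDiff.contMDiffOn
      fun p hp ↦ hp.1
  have h2 : ContMDiffOn 𝓘(ℝ, EuclideanSpace ℝ (Fin n) × ℝ) 𝓘(ℝ, ℝ) ∞
      (fun p : EuclideanSpace ℝ (Fin n) × ℝ ↦ p.2) (c.target ×ˢ Ioi a) :=
    contDiff_snd.contMDiff.contMDiffOn
  exact (hu.comp (h1.prodMk h2) fun p hp ↦ ⟨mem_univ _, hp.2⟩).contDiffOn

theorem contMDiff_slice
    (hu : ContMDiffOn ((𝓡 n).prod 𝓘(ℝ, ℝ)) 𝓘(ℝ, F) ∞ (fun p : M × ℝ ↦ u p.1 p.2)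
      (univ ×ˢ Ioi a)) {t : ℝ} (ht : a < t) :
    ContMDiff (𝓡 n) 𝓘(ℝ, F) ∞ fun x ↦ u x t := by
  have h1 : ContMDiff (𝓡 n) ((𝓡 n).prod 𝓘(ℝ, ℝ)) ∞ fun x : M ↦ (x, t) :=
    contMDiff_id.prodMk contMDiff_const
  exact contMDiffOn_univ.1 (hu.comp h1.contMDiffOn fun x _ ↦ ⟨mem_univ _, ht⟩)

theorem deriv_eq_fderiv_spaceTime (hc : c ∈ IsManifold.maximalAtlas (𝓡 n) ∞ M)
    (hu : ContMDiffOn ((𝓡 n).prod 𝓘(ℝ, ℝ)) 𝓘(ℝ, F) ∞ (fun p : M × ℝ ↦ u p.1 p.2)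
      (univ ×ˢ Ioi a)) {y : EuclideanSpace ℝ (Fin n)} (hy : y ∈ c.target) {t : ℝ} (ht : a < t) :
    HasDerivAt (u (c.symm y)) (fderiv ℝ (fun p : EuclideanSpace ℝ (Fin n) × ℝ ↦
      u (c.symm p.1) p.2) (y, t) (0, 1)) t :=
  hasDerivAt_time (w := fun p : EuclideanSpace ℝ (Fin n) × ℝ ↦ u (c.symm p.1) p.2)
    (((contDiffOn_spaceTime hc hu).contDiffAt ((c.open_target.prod isOpen_Ioi).mem_nhds (x := (y, t))
      ⟨hy, ht⟩)).differentiableAt (by simp))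

theorem contDiffOn_fderiv_time (hc : c ∈ IsManifold.maximalAtlas (𝓡 n) ∞ M)
    (hu : ContMDiffOn ((𝓡 n).prod 𝓘(ℝ, ℝ)) 𝓘(ℝ, F) ∞ (fun p : M × ℝ ↦ u p.1 p.2)
      (univ ×ˢ Ioi a)) (v : EuclideanSpace ℝ (Fin n) × ℝ) :
    ContDiffOn ℝ ∞ (fun q ↦ fderiv ℝ (fun p : EuclideanSpace ℝ (Fin n) × ℝ ↦
      u (c.symm p.1) p.2) q v) (c.target ×ˢ Ioi a) :=
  ((contDiffOn_spaceTime hc hu).fderiv_of_isOpen (c.open_target.prod isOpen_Ioi) (m := ∞)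
    (by simp)).clm_apply contDiffOn_const

/-- The time derivative is smooth in space and time. -/
theorem contMDiffOn_deriv
    (hu : ContMDiffOn ((𝓡 n).prod 𝓘(ℝ, ℝ)) 𝓘(ℝ, F) ∞ (fun p : M × ℝ ↦ u p.1 p.2)
      (univ ×ˢ Ioi a)) :
    ContMDiffOn ((𝓡 n).prod 𝓘(ℝ, ℝ)) 𝓘(ℝ, F) ∞ (fun p : M × ℝ ↦ deriv (u p.1) p.2)
      (univ ×ˢ Ioi a) := by
  rintro ⟨x, t⟩ ⟨-, ht⟩
  set c := chartAt (EuclideanSpace ℝ (Fin n)) x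
  have hc : c ∈ IsManifold.maximalAtlas (𝓡 n) ∞ M := IsManifold.chart_mem_maximalAtlas x
  have hx : x ∈ c.source := mem_chart_source _ x
  have hopen : IsOpen (c.source ×ˢ Ioi a) := c.open_source.prod isOpen_Ioi
  have h1 : ContMDiffOn ((𝓡 n).prod 𝓘(ℝ, ℝ)) 𝓘(ℝ, EuclideanSpace ℝ (Fin n)) ∞
      (fun p : M × ℝ ↦ c p.1) (c.source ×ˢ Ioi a) :=
    (contMDiffOn_of_mem_maximalAtlas hc).comp contMDiff_fst.contMDiffOn fun p hp ↦ hp.1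
  have h2 : ContMDiffOn ((𝓡 n).prod 𝓘(ℝ, ℝ)) 𝓘(ℝ, EuclideanSpace ℝ (Fin n) × ℝ) ∞
      (fun p : M × ℝ ↦ (c p.1, p.2)) (c.source ×ˢ Ioi a) :=
    h1.prodMk_space contMDiff_snd.contMDiffOn
  have h3 := (contDiffOn_fderiv_time hc hu (0, 1)).contMDiffOn.comp h2
    (fun p hp ↦ ⟨c.map_source hp.1, hp.2⟩)
  have h4 := h3.congr (f₁ := fun p : M × ℝ ↦ deriv (u p.1) p.2) fun p hp ↦ by
    have := deriv_eq_fderiv_spaceTime hc hu (c.map_source hp.1) hp.2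
    rw [c.left_inv hp.1] at this
    exact this.deriv
  exact (h4.contMDiffAt (hopen.mem_nhds ⟨hx, ht⟩)).contMDiffWithinAt

theorem partialIn_slice (hc : c ∈ IsManifold.maximalAtlas (𝓡 n) ∞ M)
    (hu : ContMDiffOn ((𝓡 n).prod 𝓘(ℝ, ℝ)) 𝓘(ℝ, F) ∞ (fun p : M × ℝ ↦ u p.1 p.2)
      (univ ×ˢ Ioi a)) {y : EuclideanSpace ℝ (Fin n)} (hy : y ∈ c.target) {t : ℝ} (ht : a < t)
    (i : Fin n) :
    partialIn c (fun x ↦ u x t) i y = fderiv ℝ (fun p : EuclideanSpace ℝ (Fin n) × ℝ ↦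
      u (c.symm p.1) p.2) (y, t) (EuclideanSpace.single i 1, 0) :=
  fderiv_space_apply (w := fun p : EuclideanSpace ℝ (Fin n) × ℝ ↦ u (c.symm p.1) p.2)
    (((contDiffOn_spaceTime hc hu).contDiffAt ((c.open_target.prod isOpen_Ioi).mem_nhds (x := (y, t))
      ⟨hy, ht⟩)).differentiableAt (by simp)) _

theorem hasDerivAt_partialIn (hc : c ∈ IsManifold.maximalAtlas (𝓡 n) ∞ M)
    (hu : ContMDiffOn ((𝓡 n).prod 𝓘(ℝ, ℝ)) 𝓘(ℝ, F) ∞ (fun p : M × ℝ ↦ u p.1 p.2)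
      (univ ×ˢ Ioi a)) {y : EuclideanSpace ℝ (Fin n)} (hy : y ∈ c.target) {t : ℝ} (ht : a < t)
    (i : Fin n) :
    HasDerivAt (fun τ ↦ partialIn c (fun x ↦ u x τ) i y)
      (partialIn c (fun x ↦ deriv (u x) t) i y) t := by
  have hO : IsOpen (c.target ×ˢ Ioi a) := c.open_target.prod isOpen_Ioi
  have h1 := hasDerivAt_fderiv_space hO (contDiffOn_spaceTime hc hu) (y := y) (t := t) ⟨hy, ht⟩
    (EuclideanSpace.single i 1)
  have h2 : partialIn c (fun x ↦ deriv (u x) t) i y =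
      fderiv ℝ (fun p ↦ fderiv ℝ (fun p : EuclideanSpace ℝ (Fin n) × ℝ ↦
        u (c.symm p.1) p.2) p (0, 1)) (y, t) (EuclideanSpace.single i 1, 0) := by
    rw [partialIn_slice hc (contMDiffOn_deriv hu) hy ht]
    congr 1
    refine Filter.EventuallyEq.fderiv_eq ?_
    filter_upwards [hO.mem_nhds (show (y, t) ∈ c.target ×ˢ Ioi a from ⟨hy, ht⟩)] with p hp
    exact (deriv_eq_fderiv_spaceTime hc hu hp.1 hp.2).deriv
  rw [h2]
  refine h1.congr_of_eventuallyEq ?_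
  filter_upwards [Ioi_mem_nhds ht] with τ hτ
  exact partialIn_slice hc hu hy hτ i

/-- The inverse Gram matrix does not depend on time, and ∂_t commutes with each ∂_i; the symmetry of
the scalar product gives the factor 2. -/
theorem hasDerivAt_gradSq
    (hu : ContMDiffOn ((𝓡 n).prod 𝓘(ℝ, ℝ)) 𝓘(ℝ, F) ∞ (fun p : M × ℝ ↦ u p.1 p.2)
      (univ ×ˢ Ioi a)) (x : M) {t : ℝ} (ht : a < t) :
    HasDerivAt (fun τ ↦ gradSq g.toRiemannianMetric (fun z ↦ u z τ) x)
      (2 * gradInner g.toRiemannianMetric (fun z ↦ u z t) (fun z ↦ deriv (u z) t) x) t := by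
  have hcomm := gradInner_comm g (fun z ↦ u z t) (fun z ↦ deriv (u z) t) x
  unfold gradSq
  unfold gradInner gradInnerIn at hcomm ⊢
  set c := chartAt (EuclideanSpace ℝ (Fin n)) x
  have hc : c ∈ IsManifold.maximalAtlas (𝓡 n) ∞ M := IsManifold.chart_mem_maximalAtlas x
  have hd := fun i ↦ hasDerivAt_partialIn hc hu (mem_chart_target _ x) ht i
  have h := HasDerivAt.fun_sum (u := Finset.univ) fun i (_ : i ∈ Finset.univ) ↦
    HasDerivAt.fun_sum (u := Finset.univ) fun j (_ : j ∈ Finset.univ) ↦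
    (((hd i).inner ℝ (hd j)).const_mul ((gram g.toRiemannianMetric c (c x))⁻¹ i j))
  refine h.congr_deriv ?_
  simp only [mul_add, Finset.sum_add_distrib]
  rw [two_mul]
  congr 1
  exact hcomm.symm

theorem hasDerivAt_slice
    (hu : ContMDiffOn ((𝓡 n).prod 𝓘(ℝ, ℝ)) 𝓘(ℝ, F) ∞ (fun p : M × ℝ ↦ u p.1 p.2)
      (univ ×ˢ Ioi a)) (x : M) {t : ℝ} (ht : a < t) :
    HasDerivAt (u x) (deriv (u x) t) t := by
  have := deriv_eq_fderiv_spaceTime (IsManifold.chart_mem_maximalAtlas x) hu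
    (mem_chart_target _ x) ht
  rw [(chartAt (EuclideanSpace ℝ (Fin n)) x).left_inv (mem_chart_source _ x)] at this
  exact this.differentiableAt.hasDerivAt

theorem continuousOn_inner_deriv
    (hu : ContMDiffOn ((𝓡 n).prod 𝓘(ℝ, ℝ)) 𝓘(ℝ, F) ∞ (fun p : M × ℝ ↦ u p.1 p.2)
      (univ ×ˢ Ioi a)) :
    ContinuousOn (fun p : M × ℝ ↦ ⟪u p.1 p.2, deriv (u p.1) p.2⟫) (univ ×ˢ Ioi a) :=
  hu.continuousOn.inner (contMDiffOn_deriv hu).continuousOn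

theorem continuousOn_partialIn_spaceTime (hc : c ∈ IsManifold.maximalAtlas (𝓡 n) ∞ M)
    (hu : ContMDiffOn ((𝓡 n).prod 𝓘(ℝ, ℝ)) 𝓘(ℝ, F) ∞ (fun p : M × ℝ ↦ u p.1 p.2)
      (univ ×ˢ Ioi a)) (i : Fin n) :
    ContinuousOn (fun p : EuclideanSpace ℝ (Fin n) × ℝ ↦ partialIn c (fun x ↦ u x p.2) i p.1)
      (c.target ×ˢ Ioi a) :=
  (contDiffOn_fderiv_time hc hu (EuclideanSpace.single i 1, 0)).continuousOn.congr fun _ hp ↦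
    partialIn_slice hc hu hp.1 hp.2 i

/-- Joint continuity supplies the joint measurability that Fubini requires. -/
theorem continuousOn_gradInner_spaceTime {v : M → ℝ → F}
    (hu : ContMDiffOn ((𝓡 n).prod 𝓘(ℝ, ℝ)) 𝓘(ℝ, F) ∞ (fun p : M × ℝ ↦ u p.1 p.2)
      (univ ×ˢ Ioi a))
    (hv : ContMDiffOn ((𝓡 n).prod 𝓘(ℝ, ℝ)) 𝓘(ℝ, F) ∞ (fun p : M × ℝ ↦ v p.1 p.2)
      (univ ×ˢ Ioi a)) :
    ContinuousOn (fun p : M × ℝ ↦ gradInner g.toRiemannianMetric (fun z ↦ u z p.2)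
      (fun z ↦ v z p.2) p.1) (univ ×ˢ Ioi a) := by
  rintro ⟨x, t⟩ ⟨-, ht⟩
  set c := chartAt (EuclideanSpace ℝ (Fin n)) x
  have hc : c ∈ IsManifold.maximalAtlas (𝓡 n) ∞ M := IsManifold.chart_mem_maximalAtlas x
  have hx : x ∈ c.source := mem_chart_source _ x
  have hopen : IsOpen (c.source ×ˢ Ioi a) := c.open_source.prod isOpen_Ioi
  have h1 : ContinuousOn (fun p : EuclideanSpace ℝ (Fin n) × ℝ ↦
      gradInnerIn g.toRiemannianMetric c (fun z ↦ u z p.2) (fun z ↦ v z p.2) p.1)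
      (c.target ×ˢ Ioi a) := by
    unfold gradInnerIn
    refine continuousOn_finsetSum _ fun i _ ↦ continuousOn_finsetSum _ fun j _ ↦ ?_
    exact ((contDiffOn_gram_inv g hc i j).continuousOn.comp continuousOn_fst fun p hp ↦ hp.1).mul
      ((continuousOn_partialIn_spaceTime hc hu i).inner (continuousOn_partialIn_spaceTime hc hv j))
  have h2 : ContinuousOn (fun p : M × ℝ ↦ (c p.1, p.2)) (c.source ×ˢ Ioi a) :=
    (c.continuousOn.comp continuousOn_fst fun p hp ↦ hp.1).prodMk continuousOn_snd
  have h3 := (h1.comp h2 fun p hp ↦ ⟨c.map_source hp.1, hp.2⟩).congr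
    (g := fun p : M × ℝ ↦ gradInner g.toRiemannianMetric (fun z ↦ u z p.2)
      (fun z ↦ v z p.2) p.1) fun p hp ↦
    gradInner_eq_gradInnerIn g hc (contMDiff_slice hu hp.2) (contMDiff_slice hv hp.2) hp.1
  exact (h3.continuousAt (hopen.mem_nhds ⟨hx, ht⟩)).continuousWithinAt

end TimeDependent

/-! ### Unique continuation on a manifold -/

section UniqueContinuation

variable {n : ℕ} {M : Type*} [TopologicalSpace M] [T2Space M] [SecondCountableTopology M]
  [ChartedSpace (EuclideanSpace ℝ (Fin n)) M] [IsManifold (𝓡 n) ∞ M]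
  [MeasurableSpace M] [BorelSpace M]
  {F : Type*} [NormedAddCommGroup F] [InnerProductSpace ℝ F]
  (g : Bundle.ContMDiffRiemannianMetric (𝓡 n) ∞ (EuclideanSpace ℝ (Fin n))
        (fun x : M ↦ TangentSpace (𝓡 n) x))
  {φ : M → ℝ} {a : ℝ} {u : M → ℝ → F}

/-- Tonelli is applied to f alone and the bound B enters by monotonicity afterwards, so B need not
be measurable. -/
theorem integrable_spaceTime {X : Type*} [TopologicalSpace X] [SecondCountableTopology X]
    [MeasurableSpace X] [BorelSpace X] {ν : Measure X} [SFinite ν] {f : X → ℝ → ℝ}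
    {B : X → ℝ → ℝ≥0∞} (hf : ContinuousOn (Function.uncurry f) (univ ×ˢ Ioi a)) {s t : ℝ}
    (hs : a < s) (hB : ∀ x τ, a < τ → ‖f x τ‖ₑ ≤ B x τ)
    (hfin : ∫⁻ τ in Ioc s t, ∫⁻ x, B x τ ∂ν < ⊤) :
    Integrable (Function.uncurry f) (ν.prod (volume.restrict (Ioc s t))) := by
  have hm : AEStronglyMeasurable (Function.uncurry f) (ν.prod (volume.restrict (Ioc s t))) := by
    have h1 : ν.prod (volume.restrict (Ioc s t)) =
        (ν.prod volume).restrict (univ ×ˢ Ioc s t) := by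
      rw [← Measure.prod_restrict, Measure.restrict_univ]
    rw [h1]
    exact (hf.mono (prod_mono_right fun τ hτ ↦ hs.trans hτ.1)).aestronglyMeasurable
      (MeasurableSet.univ.prod measurableSet_Ioc)
  refine ⟨hm, ?_⟩
  rw [HasFiniteIntegral, lintegral_prod_symm _ hm.enorm]
  exact (setLIntegral_mono' measurableSet_Ioc fun τ hτ ↦
    lintegral_mono fun x ↦ hB x τ (hs.trans hτ.1)).trans_lt hfin

/-- Unique continuation at infinity for the drift heat operator. -/
theorem eq_zero_of_vanishesToInfiniteOrder (hφ : ContMDiff (𝓡 n) 𝓘(ℝ, ℝ) ∞ φ)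
    (hu : ContMDiffOn ((𝓡 n).prod 𝓘(ℝ, ℝ)) 𝓘(ℝ, F) ∞ (fun p : M × ℝ ↦ u p.1 p.2)
      (univ ×ˢ Ioi a))
    (hW : ∀ t, a < t → MemW12 g.toRiemannianMetric φ (fun x ↦ u x t) ∧
      MemW12 g.toRiemannianMetric φ (fun x ↦ deriv (u x) t))
    (hint : ∀ s t, a < s → ∫⁻ τ in Ioc s t, (sobolevSq g.toRiemannianMetric φ (fun x ↦ u x τ) +
      sobolevSq g.toRiemannianMetric φ (fun x ↦ deriv (u x) τ)) < ⊤)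
    {C : ℝ → ℝ} {K : ℝ} (hK : ∀ t, a < t → C t ≤ K)
    (hC : IntegrableOn (fun t ↦ C t ^ 2) (Ioi a))
    (hineq : ∀ x t, a < t →
      ‖deriv (u x) t - driftLaplacian g.toRiemannianMetric φ (fun z ↦ u z t) x‖ ≤
        C t * (‖u x t‖ + √(gradSq g.toRiemannianMetric (fun z ↦ u z t) x)))
    (hvan : VanishesToInfiniteOrder g.toRiemannianMetric φ u) (x : M) {t : ℝ} (ht : a < t) :
    u x t = 0 := by
  -- With second countability, local finiteness makes ν σ-finite, as Fubini requires.
  have := isLocallyFiniteMeasure_weightedVolume g hφ.continuous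
  have := isOpenPosMeasure_weightedVolume g hφ.continuous
  set ν := weightedVolume g.toRiemannianMetric φ
  have hv := contMDiffOn_deriv hu
  have hsu := fun t (ht : a < t) ↦ contMDiff_slice hu ht
  have hsv := fun t (ht : a < t) ↦ contMDiff_slice (u := fun x t ↦ deriv (u x) t) hv ht
  have hfin : ∀ s t, a < s → ∫⁻ τ in Ioc s t, ∫⁻ x,
      (ENNReal.ofReal (‖u x τ‖ ^ 2 + gradSq g.toRiemannianMetric (fun z ↦ u z τ) x) +
      ENNReal.ofReal (‖deriv (u x) τ‖ ^ 2 +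
        gradSq g.toRiemannianMetric (fun z ↦ deriv (u z) τ) x)) ∂ν < ⊤ := by
    intro s t hs
    refine lt_of_le_of_lt (setLIntegral_mono' measurableSet_Ioc fun τ hτ ↦ ?_) (hint s t hs)
    have hτ' : a < τ := hs.trans hτ.1
    rw [lintegral_add_left]
    · rfl
    · exact (((hsu τ hτ').continuous.norm.pow 2).add
        (continuous_gradSq g (hsu τ hτ'))).measurable.ennreal_ofReal
  have hI : ∀ s t, a < s → s ≤ t → IntervalIntegrable
      (fun τ ↦ ∫ x, 2 * ⟪u x τ, deriv (u x) τ⟫ ∂ν) volume s t ∧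
      (∫ x, ‖u x t‖ ^ 2 ∂ν) - (∫ x, ‖u x s‖ ^ 2 ∂ν) =
        ∫ τ in s..t, ∫ x, 2 * ⟪u x τ, deriv (u x) τ⟫ ∂ν := by
    intro s t hs hst
    have hpos : ∀ {τ}, τ ∈ Icc s t → a < τ := fun h ↦ hs.trans_le h.1
    refine integral_sub_eq_intervalIntegral (q := fun x τ ↦ ‖u x τ‖ ^ 2)
      (r := fun x τ ↦ 2 * ⟪u x τ, deriv (u x) τ⟫) hst
      (fun x τ hτ ↦ (hasDerivAt_slice hu x (hpos hτ)).norm_sq)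
      (fun x ↦ ((continuousOn_const.mul (continuousOn_inner_deriv hu)).comp
        (f := fun τ ↦ (x, τ)) (by fun_prop) fun τ hτ ↦ ⟨mem_univ _, hpos hτ⟩))
      (integrable_spaceTime (continuousOn_const.mul (continuousOn_inner_deriv hu)) hs
        (fun x τ hτ ↦ ?_) (hfin s t hs))
      (integrable_norm_sq g (hsu s hs) (hW s hs).1.1)
      (integrable_norm_sq g (hsu t (hs.trans_le hst)) (hW t (hs.trans_le hst)).1.1)
    -- 2 |⟪u, u_t⟫| ≤ ‖u‖² + ‖u_t‖², which is at most the sum of the two Sobolev densities.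
    rw [← ENNReal.ofReal_add (add_nonneg (sq_nonneg _) (gradSq_nonneg g _ _))
      (add_nonneg (sq_nonneg _) (gradSq_nonneg g _ _)), ← ofReal_norm]
    refine ENNReal.ofReal_le_ofReal ?_
    have h1 := abs_inner_le_weighted (u x τ) (deriv (u x) τ) one_pos
    rw [Real.norm_eq_abs, abs_mul, abs_two]
    simp only [one_mul, inv_one] at h1
    linarith [gradSq_nonneg g (fun z ↦ u z τ) x, gradSq_nonneg g (fun z ↦ deriv (u z) τ) x]
  have hE : ∀ s t, a < s → s ≤ t → IntervalIntegrable
      (fun τ ↦ ∫ x, 2 * gradInner g.toRiemannianMetric (fun z ↦ u z τ)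
        (fun z ↦ deriv (u z) τ) x ∂ν) volume s t ∧
      (∫ x, gradSq g.toRiemannianMetric (fun z ↦ u z t) x ∂ν) -
        (∫ x, gradSq g.toRiemannianMetric (fun z ↦ u z s) x ∂ν) =
        ∫ τ in s..t, ∫ x, 2 * gradInner g.toRiemannianMetric (fun z ↦ u z τ)
          (fun z ↦ deriv (u z) τ) x ∂ν := by
    intro s t hs hst
    have hpos : ∀ {τ}, τ ∈ Icc s t → a < τ := fun h ↦ hs.trans_le h.1
    have hcont := continuousOn_const (c := (2 : ℝ)).mul (continuousOn_gradInner_spaceTime g hu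
      (v := fun x t ↦ deriv (u x) t) hv)
    refine integral_sub_eq_intervalIntegral
      (q := fun x τ ↦ gradSq g.toRiemannianMetric (fun z ↦ u z τ) x)
      (r := fun x τ ↦ 2 * gradInner g.toRiemannianMetric (fun z ↦ u z τ)
          (fun z ↦ deriv (u z) τ) x) hst
      (fun x τ hτ ↦ hasDerivAt_gradSq g hu x (hpos hτ))
      (fun x ↦ hcont.comp
        (f := fun τ ↦ (x, τ)) (by fun_prop) fun τ hτ ↦ ⟨mem_univ _, hpos hτ⟩)
      (integrable_spaceTime hcont hs (fun x τ hτ ↦ ?_) (hfin s t hs))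
      (integrable_gradSq g (hsu s hs) (hW s hs).1.1)
      (integrable_gradSq g (hsu t (hs.trans_le hst)) (hW t (hs.trans_le hst)).1.1)
    rw [← ENNReal.ofReal_add (add_nonneg (sq_nonneg _) (gradSq_nonneg g _ _))
      (add_nonneg (sq_nonneg _) (gradSq_nonneg g _ _)), ← ofReal_norm]
    refine ENNReal.ofReal_le_ofReal ?_
    have h1 := abs_gradInner_le g (fun z ↦ u z τ) (fun z ↦ deriv (u z) τ) x one_pos
    rw [Real.norm_eq_abs, abs_mul, abs_two]
    simp only [one_mul, inv_one] at h1
    linarith [sq_nonneg ‖u x τ‖, sq_nonneg ‖deriv (u x) τ‖]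
  have hest := fun t (ht : a < t) ↦ energy_inequalities g hφ (hsu t ht) (hsv t ht) (hW t ht).1
    (hW t ht).2 (hK t ht) fun x ↦ hineq x t ht
  have hzero := eq_zero_of_frequency (by positivity : 0 ≤ 2 + 2 * K ^ 2) hI hE
    (fun t _ ↦ integral_nonneg fun x ↦ sq_nonneg _)
    (fun t _ ↦ integral_nonneg fun x ↦ gradSq_nonneg g _ x) hC (fun t _ ↦ sq_nonneg _)
    (fun t ht ↦ (hest t ht).1) (fun t ht ↦ (hest t ht).2) hvan t ht
  -- I(t) = 0 gives u = 0 almost everywhere, hence everywhere by continuity.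
  have hae := (integral_eq_zero_iff_of_nonneg (fun x ↦ sq_nonneg ‖u x t‖)
    (integrable_norm_sq g (hsu t ht) (hW t ht).1.1)).1 hzero
  have := congrFun ((Continuous.ae_eq_iff_eq ν ((hsu t ht).continuous.norm.pow 2)
    continuous_const).1 hae) x
  exact norm_eq_zero.1 (pow_eq_zero_iff two_ne_zero |>.1 this)

theorem timeDeriv_eq_deriv {u : M → ℝ → F} (x : M) {t : ℝ} (ht : a < t) :
    timeDeriv a u x t = deriv (u x) t :=
  derivWithin_of_mem_nhds (Ici_mem_nhds ht)

theorem eq_zero_of_sobolevGrowth (hφ : ContMDiff (𝓡 n) 𝓘(ℝ, ℝ) ∞ φ) {C : ℝ → ℝ}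
    (hCb : BddAbove (C '' Ici a)) (hC : IntegrableOn (fun t ↦ C t ^ 2) (Ici a))
    (hu : ContMDiffOn ((𝓡 n).prod 𝓘(ℝ, ℝ)) 𝓘(ℝ, F) ∞ (fun p : M × ℝ ↦ u p.1 p.2)
      (univ ×ˢ Ici a))
    (hW : SobolevGrowth g.toRiemannianMetric φ a u)
    (hineq : ∀ x t, a ≤ t →
      ‖timeDeriv a u x t - driftLaplacian g.toRiemannianMetric φ (fun z ↦ u z t) x‖ ≤
        C t * (‖u x t‖ + √(gradSq g.toRiemannianMetric (fun z ↦ u z t) x)))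
    (hvan : VanishesToInfiniteOrder g.toRiemannianMetric φ u) (x : M) {t : ℝ} (ht : a ≤ t) :
    u x t = 0 := by
  obtain ⟨K, hK⟩ := hCb
  have hkey : ∀ t, a < t → u x t = 0 := by
    intro t ht
    refine eq_zero_of_vanishesToInfiniteOrder g hφ
      (hu.mono (prod_mono_right Ioi_subset_Ici_self)) (fun t ht ↦ ?_) (fun s t hs ↦ ?_)
      (fun t ht ↦ hK ⟨t, ht.le, rfl⟩) (hC.mono_set Ioi_subset_Ici_self) (fun x t ht ↦ ?_) hvan x ht
    · simpa only [timeDeriv_eq_deriv _ ht] using hW.1 t ht.le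
    · refine lt_of_le_of_lt ?_ (hW.2 t)
      calc _ = ∫⁻ τ in Ioc s t, (sobolevSq g.toRiemannianMetric φ (fun x ↦ u x τ) +
            sobolevSq g.toRiemannianMetric φ (fun x ↦ timeDeriv a u x τ)) :=
            setLIntegral_congr_fun measurableSet_Ioc fun τ hτ ↦ by
              simp only [timeDeriv_eq_deriv _ (hs.trans hτ.1)]
        _ ≤ _ := lintegral_mono_set (Ioc_subset_Icc_self.trans (Icc_subset_Icc_left hs.le))
    · simpa only [timeDeriv_eq_deriv _ ht] using hineq x t ht.le
  -- At t = a the value is the limit from the right.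
  rcases ht.lt_or_eq with h | rfl
  · exact hkey t h
  · have hcont : ContinuousOn (fun τ ↦ u x τ) (Ici a) :=
      hu.continuousOn.comp (f := fun τ ↦ (x, τ)) (by fun_prop) fun τ hτ ↦ ⟨mem_univ _, hτ⟩
    have h1 : Tendsto (fun τ ↦ u x τ) (𝓝[>] a) (𝓝 (u x a)) :=
      (hcont a self_mem_Ici).mono_left (nhdsWithin_mono _ Ioi_subset_Ici_self)
    refine tendsto_nhds_unique h1 (tendsto_const_nhds.congr' ?_)
    filter_upwards [self_mem_nhdsWithin] with τ hτ
    exact (hkey τ hτ).symm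

end UniqueContinuation

/-! ### Euclidean space with the Gaussian weight -/

section EuclideanMetric

variable {n : ℕ}

/-- The flat metric of Euclidean space. -/
def euclideanMetric (n : ℕ) :
    Bundle.ContMDiffRiemannianMetric (𝓡 n) ∞ (EuclideanSpace ℝ (Fin n))
      (fun x : EuclideanSpace ℝ (Fin n) ↦ TangentSpace (𝓡 n) x) where
  __ := (riemannianMetricVectorSpace (EuclideanSpace ℝ (Fin n))).toRiemannianMetric
  contMDiff := (riemannianMetricVectorSpace (EuclideanSpace ℝ (Fin n))).contMDiff.of_le le_top

theorem gram_euclideanMetric (y : EuclideanSpace ℝ (Fin n)) :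
    gram (euclideanMetric n).toRiemannianMetric (OpenPartialHomeomorph.refl _) y = 1 := by
  ext i j
  have h : mfderiv (𝓡 n) (𝓡 n) (OpenPartialHomeomorph.refl (EuclideanSpace ℝ (Fin n))).symm y =
      ContinuousLinearMap.id ℝ (TangentSpace (𝓡 n) y) := mfderiv_id
  rw [gram, Matrix.of_apply, h, Matrix.one_apply]
  change ⟪(EuclideanSpace.single i (1 : ℝ) : EuclideanSpace ℝ (Fin n)),
    EuclideanSpace.single j (1 : ℝ)⟫ = _
  rw [EuclideanSpace.inner_single_left]
  simp

theorem volDensity_euclideanMetric (y : EuclideanSpace ℝ (Fin n)) :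
    volDensity (euclideanMetric n).toRiemannianMetric (OpenPartialHomeomorph.refl _) y = 1 := by
  rw [volDensity, gram_euclideanMetric, Matrix.det_one, Real.sqrt_one]

theorem partialIn_refl {F : Type*} [NormedAddCommGroup F] [InnerProductSpace ℝ F]
    (f : EuclideanSpace ℝ (Fin n) → F) (i : Fin n) (y : EuclideanSpace ℝ (Fin n)) :
    partialIn (OpenPartialHomeomorph.refl _) f i y =
      fderiv ℝ f y (EuclideanSpace.single i (1 : ℝ)) := rfl

/-- Every preferred chart is the identity, so the supremum runs over a constant family. -/
theorem riemannianVolume_euclideanMetric :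
    riemannianVolume (euclideanMetric n).toRiemannianMetric =
      (volume : Measure (EuclideanSpace ℝ (Fin n))) := by
  simp only [riemannianVolume, chartAt_self_eq, ciSup_const, chartVolume,
    volDensity_euclideanMetric, ENNReal.ofReal_one, OpenPartialHomeomorph.refl_target,
    Measure.restrict_univ]
  rw [show (volume : Measure (EuclideanSpace ℝ (Fin n))).withDensity (fun _ ↦ 1) = volume from
    withDensity_one]
  exact Measure.map_id

theorem gradSq_euclideanMetric (f : EuclideanSpace ℝ (Fin n) → ℝ)
    (x : EuclideanSpace ℝ (Fin n)) :
    gradSq (euclideanMetric n).toRiemannianMetric f x = ‖gradient f x‖ ^ 2 := by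
  simp only [gradSq, chartAt_self_eq, gram_euclideanMetric, inv_one, Matrix.one_apply, ite_mul,
    one_mul, zero_mul, Finset.sum_ite_eq, Finset.mem_univ, if_true, partialIn_refl,
    EuclideanSpace.norm_sq_eq]
  refine Finset.sum_congr rfl fun i _ ↦ ?_
  have h : gradient f x i = fderiv ℝ f x (EuclideanSpace.single i (1 : ℝ)) := by
    rw [← InnerProductSpace.toDual_symm_apply (𝕜 := ℝ), EuclideanSpace.inner_single_right]
    simp [gradient]
  rw [real_inner_self_eq_norm_sq, h]
  rfl

theorem norm_gradient (f : EuclideanSpace ℝ (Fin n) → ℝ) (x : EuclideanSpace ℝ (Fin n)) :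
    ‖gradient f x‖ = ‖fderiv ℝ f x‖ :=
  LinearIsometryEquiv.norm_map _ _

theorem laplacian_eq_sum_fderiv {f : EuclideanSpace ℝ (Fin n) → ℝ}
    {x : EuclideanSpace ℝ (Fin n)} :
    Laplacian.laplacian f x = ∑ i, fderiv ℝ (fderiv ℝ f) x (EuclideanSpace.single i (1 : ℝ))
      (EuclideanSpace.single i (1 : ℝ)) := by
  rw [InnerProductSpace.laplacian_eq_iteratedFDeriv_orthonormalBasis f
    (EuclideanSpace.basisFun (Fin n) ℝ)]
  simp [iteratedFDeriv_two_apply]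

theorem laplaceBeltrami_euclideanMetric {f : EuclideanSpace ℝ (Fin n) → ℝ}
    (hf : ContDiff ℝ ∞ f) (x : EuclideanSpace ℝ (Fin n)) :
    laplaceBeltrami (euclideanMetric n).toRiemannianMetric f x = Laplacian.laplacian f x := by
  have hd : DifferentiableAt ℝ (fderiv ℝ f) x :=
    (hf.fderiv_right (m := ∞) (by simp)).differentiable (by simp) x
  simp only [laplaceBeltrami, chartAt_self_eq, gram_euclideanMetric, volDensity_euclideanMetric,
    inv_one, Matrix.one_apply, mul_ite, mul_one, mul_zero, ite_smul, one_smul, zero_smul,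
    Finset.sum_ite_eq, Finset.mem_univ, if_true, partialIn_refl, laplacian_eq_sum_fderiv]
  refine Finset.sum_congr rfl fun i _ ↦ ?_
  change fderiv ℝ (fun z ↦ fderiv ℝ f z (EuclideanSpace.single i 1)) x _ = _
  rw [fderiv_clm_apply hd (differentiableAt_const _)]
  simp

/-- The Gaussian weight `|x|² / 4`. -/
def gaussPotential (x : EuclideanSpace ℝ (Fin n)) : ℝ := ‖x‖ ^ 2 / 4

theorem contDiff_gaussPotential : ContDiff ℝ ∞ (gaussPotential (n := n)) :=
  (contDiff_norm_sq ℝ).div_const 4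

theorem fderiv_gaussPotential (x v : EuclideanSpace ℝ (Fin n)) :
    fderiv ℝ gaussPotential x v = ⟪x, v⟫ / 2 := by
  have h := ((hasStrictFDerivAt_norm_sq x).hasFDerivAt.mul_const (4⁻¹ : ℝ)).fderiv
  have h2 : (gaussPotential : EuclideanSpace ℝ (Fin n) → ℝ) = fun x ↦ ‖x‖ ^ 2 * 4⁻¹ := by
    ext; rw [gaussPotential, div_eq_mul_inv]
  rw [h2, h]
  simp
  ring

theorem gradPairing_euclideanMetric (f : EuclideanSpace ℝ (Fin n) → ℝ)
    (x : EuclideanSpace ℝ (Fin n)) :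
    gradPairing (euclideanMetric n).toRiemannianMetric f gaussPotential x =
      fderiv ℝ f x x / 2 := by
  simp only [gradPairing, chartAt_self_eq, gram_euclideanMetric, inv_one, Matrix.one_apply,
    ite_mul, one_mul, zero_mul, ite_smul, zero_smul, Finset.sum_ite_eq, Finset.mem_univ, if_true,
    partialIn_refl, OpenPartialHomeomorph.refl_apply, fderiv_gaussPotential]
  have h : fderiv ℝ f x x = ∑ i, fderiv ℝ f x (x i • EuclideanSpace.single i (1 : ℝ)) := by
    rw [← map_sum, sum_smul_single]
  rw [h, Finset.sum_div]
  refine Finset.sum_congr rfl fun i _ ↦ ?_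
  rw [EuclideanSpace.inner_single_right, map_smul]
  simp
  ring

theorem driftLaplacian_euclideanMetric {f : EuclideanSpace ℝ (Fin n) → ℝ}
    (hf : ContDiff ℝ ∞ f) (x : EuclideanSpace ℝ (Fin n)) :
    driftLaplacian (euclideanMetric n).toRiemannianMetric gaussPotential f x =
      Laplacian.laplacian f x - fderiv ℝ f x x / 2 := by
  rw [driftLaplacian, laplaceBeltrami_euclideanMetric hf, gradPairing_euclideanMetric]

theorem sobolevSq_euclideanMetric (f : EuclideanSpace ℝ (Fin n) → ℝ) :
    sobolevSq (euclideanMetric n).toRiemannianMetric gaussPotential f = gaussSobolevSq f := by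
  rw [sobolevSq, weightedVolume, riemannianVolume_euclideanMetric,
    lintegral_withDensity_eq_lintegral_mul_non_measurable _ _
      (ae_of_all _ fun x ↦ ENNReal.ofReal_lt_top)]
  · refine lintegral_congr fun x ↦ ?_
    rw [Pi.mul_apply, ← ENNReal.ofReal_mul (Real.exp_pos _).le, mul_comm,
      gradSq_euclideanMetric, Real.norm_eq_abs, sq_abs]
    rfl
  · exact (Real.continuous_exp.comp
      contDiff_gaussPotential.continuous.neg).measurable.ennreal_ofReal

theorem energy_euclideanMetric (w : EuclideanSpace ℝ (Fin n) → ℝ → ℝ) (s : ℝ) :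
    energy (euclideanMetric n).toRiemannianMetric gaussPotential w s =
      ∫ x, w x s ^ 2 * Real.exp (-(‖x‖ ^ 2 / 4)) := by
  rw [energy, weightedVolume, riemannianVolume_euclideanMetric,
    integral_withDensity_eq_integral_toReal_smul]
  · refine integral_congr_ae (ae_of_all _ fun x ↦ ?_)
    simp only
    rw [ENNReal.toReal_ofReal (Real.exp_pos _).le, smul_eq_mul, mul_comm, Real.norm_eq_abs,
      sq_abs]
    rfl
  · exact (Real.continuous_exp.comp
      contDiff_gaussPotential.continuous.neg).measurable.ennreal_ofReal
  · exact ae_of_all _ fun x ↦ ENNReal.ofReal_lt_top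

/-- The smooth functions of finite Gaussian Sobolev norm are limits of functions of compact
support. -/
theorem memW12_euclideanMetric {f : EuclideanSpace ℝ (Fin n) → ℝ} (hf : ContDiff ℝ ∞ f)
    (hfin : gaussSobolevSq f < ⊤) :
    MemW12 (euclideanMetric n).toRiemannianMetric gaussPotential f := by
  have h0 : sobolevSq (euclideanMetric n).toRiemannianMetric gaussPotential f < ⊤ := by
    rwa [sobolevSq_euclideanMetric]
  refine ⟨h0, ?_⟩
  let χ : ContDiffBump (0 : EuclideanSpace ℝ (Fin n)) := ⟨1, 2, one_pos, one_lt_two⟩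
  have hχ : ContDiff ℝ ∞ χ := χ.contDiff
  obtain ⟨B, hB⟩ : ∃ B, ∀ x, ‖fderiv ℝ χ x‖ ≤ B :=
    (hχ.continuous_fderiv (by simp)).bounded_above_of_compact_support
      (χ.hasCompactSupport.fderiv ℝ)
  have hB0 : 0 ≤ B := (norm_nonneg _).trans (hB 0)
  -- The cutoffs χ(x / (k + 1)) increase their radius with k; as r k ≤ 1, their gradients keep the
  -- bound B of χ.
  let r : ℕ → ℝ := fun k ↦ ((k : ℝ) + 1)⁻¹
  have hr0 : ∀ k, 0 < r k := fun k ↦ by positivity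
  have hr1 : ∀ k, r k ≤ 1 := fun k ↦ inv_le_one_of_one_le₀ (by simp)
  let ψ : ℕ → EuclideanSpace ℝ (Fin n) → ℝ := fun k x ↦ χ (r k • x)
  have hψ : ∀ k, ContDiff ℝ ∞ (ψ k) := fun k ↦ hχ.comp (contDiff_const_smul _)
  have hψd : ∀ k x, ‖fderiv ℝ (ψ k) x‖ ≤ B := by
    intro k x
    have h1 : fderiv ℝ (ψ k) x = r k • fderiv ℝ χ (r k • x) := fderiv_comp_smul (r k)
    rw [h1, norm_smul, Real.norm_of_nonneg (hr0 k).le]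
    exact (mul_le_of_le_one_left (norm_nonneg _) (hr1 k)).trans (hB _)
  have hcut : ∀ k, ContDiff ℝ ∞ fun x ↦ f x - ψ k x * f x := fun k ↦ hf.sub ((hψ k).mul hf)
  refine ⟨fun k x ↦ ψ k x * f x, fun k ↦ ⟨((hψ k).mul hf).contMDiff, ?_⟩, ?_⟩
  · refine HasCompactSupport.mul_right ?_
    exact χ.hasCompactSupport.comp_homeomorph (Homeomorph.smulOfNeZero (r k) (hr0 k).ne')
  set ν := weightedVolume (euclideanMetric n).toRiemannianMetric
    (gaussPotential : EuclideanSpace ℝ (Fin n) → ℝ)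
  -- The majorant for dominated convergence: (|∇f| + B|f|)² ≤ 2|∇f|² + 2B²|f|², and |(1 - ψ)f| ≤
  -- |f|.
  have hbound : ∀ k x, ‖f x - ψ k x * f x‖ ^ 2 +
      gradSq (euclideanMetric n).toRiemannianMetric (fun x ↦ f x - ψ k x * f x) x ≤
      (2 + 2 * B ^ 2) * (‖f x‖ ^ 2 + gradSq (euclideanMetric n).toRiemannianMetric f x) := by
    intro k x
    have hχ0 : 0 ≤ ψ k x := χ.nonneg
    have hχ1 : ψ k x ≤ 1 := χ.le_one
    rw [gradSq_euclideanMetric, gradSq_euclideanMetric, norm_gradient, norm_gradient]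
    have hdf := hf.differentiable (by simp) x
    have hdψ := (hψ k).differentiable (by simp) x
    have h1 : fderiv ℝ (fun x ↦ f x - ψ k x * f x) x =
        (1 - ψ k x) • fderiv ℝ f x - f x • fderiv ℝ (ψ k) x := by
      have hm := (hdf.hasFDerivAt.sub (hdψ.hasFDerivAt.mul hdf.hasFDerivAt)).fderiv
      refine hm.trans ?_
      module
    have h2 : ‖fderiv ℝ (fun x ↦ f x - ψ k x * f x) x‖ ≤ ‖fderiv ℝ f x‖ + ‖f x‖ * B := by
      rw [h1]
      refine (norm_sub_le _ _).trans (add_le_add ?_ ?_)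
      · rw [norm_smul, Real.norm_of_nonneg (by linarith)]
        exact mul_le_of_le_one_left (norm_nonneg _) (by linarith)
      · rw [norm_smul]
        exact mul_le_mul_of_nonneg_left (hψd k x) (norm_nonneg _)
    have h3 : ‖f x - ψ k x * f x‖ ≤ ‖f x‖ := by
      rw [show f x - ψ k x * f x = (1 - ψ k x) * f x by ring, norm_mul,
        Real.norm_of_nonneg (by linarith)]
      exact mul_le_of_le_one_left (norm_nonneg _) (by linarith)
    have h4 := pow_le_pow_left₀ (norm_nonneg _) h2 2
    have h5 := pow_le_pow_left₀ (norm_nonneg _) h3 2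
    nlinarith [sq_nonneg (‖fderiv ℝ f x‖ - ‖f x‖ * B), sq_nonneg ‖f x‖,
      mul_nonneg (sq_nonneg B) (sq_nonneg ‖fderiv ℝ f x‖)]
  have hlim := tendsto_lintegral_of_dominated_convergence (μ := ν)
    (F := fun k x ↦ ENNReal.ofReal (‖f x - ψ k x * f x‖ ^ 2 +
      gradSq (euclideanMetric n).toRiemannianMetric (fun x ↦ f x - ψ k x * f x) x))
    (f := fun _ ↦ 0)
    (fun x ↦ ENNReal.ofReal ((2 + 2 * B ^ 2) *
      (‖f x‖ ^ 2 + gradSq (euclideanMetric n).toRiemannianMetric f x)))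
    (fun k ↦ (((hcut k).continuous.norm.pow 2).add
      (continuous_gradSq _ (hcut k).contMDiff)).measurable.ennreal_ofReal)
    (fun k ↦ ae_of_all _ fun x ↦ ENNReal.ofReal_le_ofReal (hbound k x)) ?_ ?_
  · rw [lintegral_zero] at hlim
    exact hlim
  · simp_rw [ENNReal.ofReal_mul (by positivity : 0 ≤ 2 + 2 * B ^ 2)]
    have hm : Measurable fun x ↦ ENNReal.ofReal
        (‖f x‖ ^ 2 + gradSq (euclideanMetric n).toRiemannianMetric f x) := ((hf.continuous.norm.pow 2).add
      (continuous_gradSq _ hf.contMDiff)).measurable.ennreal_ofReal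
    rw [lintegral_const_mul _ hm]
    exact (ENNReal.mul_lt_top ENNReal.ofReal_lt_top h0).ne
  · refine ae_of_all _ fun x ↦ tendsto_const_nhds.congr' ?_
    have hrlim : Tendsto r atTop (𝓝 0) := by
      simpa [r] using tendsto_one_div_add_atTop_nhds_zero_nat (𝕜 := ℝ)
    have hx : ∀ᶠ k in atTop, r k • x ∈ Metric.ball (0 : EuclideanSpace ℝ (Fin n)) 1 := by
      have : Tendsto (fun k ↦ r k • x) atTop (𝓝 0) := by simpa using hrlim.smul_const x
      exact this (Metric.ball_mem_nhds _ one_pos)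
    filter_upwards [hx] with k hk
    -- The difference vanishes on a whole neighbourhood of x, so its gradient at x vanishes too.
    have hev : (fun x ↦ f x - ψ k x * f x) =ᶠ[𝓝 x] fun _ ↦ 0 := by
      have hopen : IsOpen ((fun y : EuclideanSpace ℝ (Fin n) ↦ r k • y) ⁻¹' Metric.ball 0 1) :=
        Metric.isOpen_ball.preimage (continuous_const_smul _)
      filter_upwards [hopen.mem_nhds hk] with y hy
      have : ψ k y = 1 := χ.one_of_mem_closedBall (Metric.ball_subset_closedBall hy)
      rw [this]; ring
    rw [gradSq_euclideanMetric, norm_gradient, hev.fderiv_eq, hev.eq_of_nhds]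
    simp

end EuclideanMetric

/-! ### Self-similar variables and the heat operator -/

section SelfSimilar

variable {n : ℕ} {T : ℝ} {u : EuclideanSpace ℝ (Fin n) → ℝ → ℝ}

theorem neg_exp_neg_mem (hT : 0 < T) {s : ℝ} (hs : -Real.log T < s) :
    -Real.exp (-s) ∈ Ioo (-T) 0 := by
  refine ⟨neg_lt_neg ?_, neg_lt_zero.2 (Real.exp_pos _)⟩
  rw [← Real.lt_log_iff_exp_lt hT]
  linarith

theorem contDiffOn_selfSimilar (hT : 0 < T)
    (hu : ContDiffOn ℝ ∞ (fun p : EuclideanSpace ℝ (Fin n) × ℝ ↦ u p.1 p.2)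
      (univ ×ˢ Ioo (-T) 0)) :
    ContDiffOn ℝ ∞ (fun p : EuclideanSpace ℝ (Fin n) × ℝ ↦ selfSimilar u p.1 p.2)
      (univ ×ˢ Ioi (-Real.log T)) := by
  have h : ContDiff ℝ ∞ fun p : EuclideanSpace ℝ (Fin n) × ℝ ↦
      (Real.exp (-p.2 / 2) • p.1, -Real.exp (-p.2)) := by fun_prop
  exact hu.comp h.contDiffOn fun p hp ↦ ⟨mem_univ _, neg_exp_neg_mem hT hp.2⟩

theorem contMDiffOn_prod_of_contDiffOn {f : EuclideanSpace ℝ (Fin n) × ℝ → ℝ}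
    {S : Set (EuclideanSpace ℝ (Fin n) × ℝ)} (hf : ContDiffOn ℝ ∞ f S) :
    ContMDiffOn ((𝓡 n).prod 𝓘(ℝ, ℝ)) 𝓘(ℝ, ℝ) ∞ f S := by
  have h : ContMDiff ((𝓡 n).prod 𝓘(ℝ, ℝ)) 𝓘(ℝ, EuclideanSpace ℝ (Fin n) × ℝ) ∞
      fun p : EuclideanSpace ℝ (Fin n) × ℝ ↦ (p.1, p.2) :=
    contMDiff_fst.prodMk_space contMDiff_snd
  exact hf.contMDiffOn.comp h.contMDiffOn fun p hp ↦ hp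

theorem fderiv_selfSimilar (s : ℝ) (x : EuclideanSpace ℝ (Fin n)) :
    fderiv ℝ (fun x ↦ selfSimilar u x s) x = Real.exp (-s / 2) •
      fderiv ℝ (fun z ↦ u z (-Real.exp (-s))) (Real.exp (-s / 2) • x) :=
  fderiv_comp_smul (f := fun z ↦ u z (-Real.exp (-s))) (Real.exp (-s / 2))

theorem laplacian_selfSimilar (s : ℝ) (x : EuclideanSpace ℝ (Fin n)) :
    Laplacian.laplacian (fun x ↦ selfSimilar u x s) x = Real.exp (-s) *
      Laplacian.laplacian (fun z ↦ u z (-Real.exp (-s))) (Real.exp (-s / 2) • x) := by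
  have h1 : fderiv ℝ (fun x ↦ selfSimilar u x s) = fun x ↦ Real.exp (-s / 2) •
      fderiv ℝ (fun z ↦ u z (-Real.exp (-s))) (Real.exp (-s / 2) • x) :=
    funext fun x ↦ fderiv_selfSimilar s x
  have h2 : fderiv ℝ (fderiv ℝ (fun x ↦ selfSimilar u x s)) x = Real.exp (-s) •
      fderiv ℝ (fderiv ℝ (fun z ↦ u z (-Real.exp (-s)))) (Real.exp (-s / 2) • x) := by
    let := invertibleOfNonzero (Real.exp_pos (-s / 2)).ne'
    have h3 := fderiv_comp_smul (f := fderiv ℝ (fun z ↦ u z (-Real.exp (-s))))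
      (Real.exp (-s / 2)) (x := x)
    rw [h1]
    refine (fderiv_const_smul_of_invertible (f := fun x : EuclideanSpace ℝ (Fin n) ↦
      fderiv ℝ (fun z ↦ u z (-Real.exp (-s))) (Real.exp (-s / 2) • x))
      (Real.exp (-s / 2))).trans ?_
    rw [h3, smul_smul, ← Real.exp_add]
    congr 2
    ring
  simp only [laplacian_eq_sum_fderiv, h2, Finset.mul_sum]
  rfl

/-- The s-derivative of the rescaled point e^(-s/2) x produces the term -⟨x, ∇w⟩/2, which is the
drift of the Gaussian weight. -/
theorem deriv_selfSimilar (hT : 0 < T)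
    (hu : ContDiffOn ℝ ∞ (fun p : EuclideanSpace ℝ (Fin n) × ℝ ↦ u p.1 p.2)
      (univ ×ˢ Ioo (-T) 0)) {s : ℝ} (hs : -Real.log T < s) (x : EuclideanSpace ℝ (Fin n)) :
    deriv (selfSimilar u x) s = Real.exp (-s) *
        deriv (u (Real.exp (-s / 2) • x)) (-Real.exp (-s)) -
      fderiv ℝ (fun x ↦ selfSimilar u x s) x x / 2 := by
  have hmem : (Real.exp (-s / 2) • x, -Real.exp (-s)) ∈
      (univ : Set (EuclideanSpace ℝ (Fin n))) ×ˢ Ioo (-T) 0 :=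
    ⟨mem_univ _, neg_exp_neg_mem hT hs⟩
  have hd := (hu.contDiffAt ((isOpen_univ.prod isOpen_Ioo).mem_nhds hmem)).differentiableAt
    (by simp)
  have h1 : HasDerivAt (fun s ↦ (Real.exp (-s / 2) • x, -Real.exp (-s)))
      ((Real.exp (-s / 2) * (-1 / 2)) • x, -(Real.exp (-s) * -1)) s :=
    (((hasDerivAt_neg s).div_const 2).exp.smul_const x).prodMk (hasDerivAt_neg s).exp.neg
  have h2 := (hd.hasFDerivAt.comp_hasDerivAt s h1).deriv
  have h3 := (hasDerivAt_time (w := fun p : EuclideanSpace ℝ (Fin n) × ℝ ↦ u p.1 p.2) hd).deriv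
  have h4 := fderiv_space_apply (w := fun p : EuclideanSpace ℝ (Fin n) × ℝ ↦ u p.1 p.2) hd x
  have h5 : (((Real.exp (-s / 2) * (-1 / 2)) • x, -(Real.exp (-s) * -1)) :
      EuclideanSpace ℝ (Fin n) × ℝ) =
      (Real.exp (-s / 2) * (-1 / 2)) • (x, (0 : ℝ)) + Real.exp (-s) • (0, (1 : ℝ)) := by
    ext <;> simp
  rw [h5, map_add, map_smul, map_smul, ← h3, ← h4] at h2
  rw [fderiv_selfSimilar]
  refine h2.trans ?_
  simp only [smul_eq_mul, smul_apply]
  change _ + _ * deriv (u (Real.exp (-s / 2) • x)) (-Real.exp (-s)) = _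
  ring

/-- Substitute y = e^(-s/2) x at t = -e^(-s): the kernel becomes e^(-|x|²/4), and the Jacobian is
absorbed by the factor (-t)^(-n/2). -/
theorem poonEnergy_neg_exp (s : ℝ) :
    poonEnergy u (-Real.exp (-s)) = (4 * Real.pi) ^ (-(n : ℝ) / 2) *
      ∫ x, selfSimilar u x s ^ 2 * Real.exp (-(‖x‖ ^ 2 / 4)) := by
  have h := Measure.integral_comp_smul (volume : Measure (EuclideanSpace ℝ (Fin n)))
    (fun y ↦ u y (-Real.exp (-s)) ^ 2 * Real.exp (-(‖y‖ ^ 2 / (4 * Real.exp (-s)))))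
    (Real.exp (-s / 2))
  have hsq : Real.exp (-s / 2) ^ 2 = Real.exp (-s) := by
    rw [← Real.exp_nat_mul]; congr 1; push_cast; ring
  have h2 : ∀ x : EuclideanSpace ℝ (Fin n),
      ‖Real.exp (-s / 2) • x‖ ^ 2 / (4 * Real.exp (-s)) = ‖x‖ ^ 2 / 4 := by
    intro x
    rw [norm_smul, mul_pow, Real.norm_of_nonneg (Real.exp_pos _).le, hsq]
    have := Real.exp_pos (-s)
    field_simp
  simp only [h2, finrank_euclideanSpace, Fintype.card_fin] at h
  have h3 : ∫ x, selfSimilar u x s ^ 2 * Real.exp (-(‖x‖ ^ 2 / 4)) =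
      |(Real.exp (-s / 2) ^ n)⁻¹| *
        ∫ y, u y (-Real.exp (-s)) ^ 2 * Real.exp (-(‖y‖ ^ 2 / (4 * Real.exp (-s)))) := h
  rw [h3, poonEnergy, neg_neg, Real.mul_rpow (by positivity) (Real.exp_pos _).le,
    abs_of_nonneg (by positivity), mul_assoc]
  congr 2
  rw [← Real.exp_mul, ← Real.exp_nat_mul, ← Real.exp_neg]
  congr 1
  ring

/-- At t = -e^(-s) one has (-t)^(-c) = e^(cs), so polynomial order in t is exponential order in s.
-/
theorem vanishesToInfiniteOrder_selfSimilar
    (h : ∀ k : ℝ, Tendsto (fun t : ℝ ↦ (-t) ^ (-k) * poonEnergy u t) (𝓝[<] 0) (𝓝 0)) :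
    VanishesToInfiniteOrder (euclideanMetric n).toRiemannianMetric gaussPotential
      (selfSimilar u) := by
  intro c
  have hexp : Tendsto (fun s ↦ -Real.exp (-s)) atTop (𝓝[<] 0) := by
    refine tendsto_nhdsWithin_iff.2 ⟨?_, Eventually.of_forall fun s ↦
      neg_lt_zero.2 (Real.exp_pos _)⟩
    simpa using (Real.tendsto_exp_atBot.comp tendsto_neg_atTop_atBot).neg
  have h1 := ((h c).comp hexp).const_mul ((4 * Real.pi) ^ ((n : ℝ) / 2))
  rw [mul_zero] at h1
  refine h1.congr fun s ↦ ?_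
  rw [Function.comp_apply, poonEnergy_neg_exp, neg_neg, energy_euclideanMetric, ← Real.exp_mul,
    show -s * -c = c * s by ring]
  have h2 : (4 * Real.pi) ^ ((n : ℝ) / 2) * (4 * Real.pi) ^ (-(n : ℝ) / 2) = 1 := by
    rw [← Real.rpow_add (by positivity), show (n : ℝ) / 2 + -(n : ℝ) / 2 = 0 by ring,
      Real.rpow_zero]
  linear_combination (Real.exp (c * s) *
    ∫ x, selfSimilar u x s ^ 2 * Real.exp (-(‖x‖ ^ 2 / 4))) * h2

/-- Unique continuation for the heat operator at the space-time origin. -/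
theorem eq_zero_of_poonEnergy {C : ℝ} (hT : 0 < T)
    (hu : ContDiffOn ℝ ∞ (fun p : EuclideanSpace ℝ (Fin n) × ℝ ↦ u p.1 p.2)
      (univ ×ˢ Ico (-T) 0))
    (hgrowth : GaussGrowth (-Real.log T) (selfSimilar u))
    (hineq : ∀ x, ∀ t ∈ Ico (-T) 0,
      |derivWithin (fun τ ↦ u x τ) (Ico (-T) 0) t - Laplacian.laplacian (fun z ↦ u z t) x| ≤
        C * (|u x t| + ‖gradient (fun z ↦ u z t) x‖))
    (hvan : ∀ k : ℝ, Tendsto (fun t : ℝ ↦ (-t) ^ (-k) * poonEnergy u t) (𝓝[<] 0) (𝓝 0))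
    (x : EuclideanSpace ℝ (Fin n)) {t : ℝ} (ht : t ∈ Ico (-T) 0) : u x t = 0 := by
  set a := -Real.log T
  have hu' := hu.mono (prod_mono_right (Ioo_subset_Ico_self (a := -T) (b := (0 : ℝ))))
  have hw := contMDiffOn_prod_of_contDiffOn (contDiffOn_selfSimilar hT hu')
  have hsw : ∀ s, a < s → ContDiff ℝ ∞ fun x ↦ selfSimilar u x s := fun s hs ↦
    (contMDiff_slice hw hs).contDiff
  have hswt : ∀ s, a < s → ContDiff ℝ ∞ fun x ↦ deriv (selfSimilar u x) s := fun s hs ↦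
    (contMDiff_slice (u := fun x s ↦ deriv (selfSimilar u x) s) (contMDiffOn_deriv hw) hs).contDiff
  have hderiv : ∀ x s, a < s → derivWithin (fun σ ↦ selfSimilar u x σ) (Ici a) s =
      deriv (selfSimilar u x) s := fun x s hs ↦ derivWithin_of_mem_nhds (Ici_mem_nhds hs)
  -- Only times s > a are used, where one-sided and ordinary derivatives agree; the initial time
  -- follows by continuity of u.
  have hzero : ∀ s, a < s → ∀ x, selfSimilar u x s = 0 := by
    intro s hs x
    -- The operator scales by e^(-s) and ∇w = e^(-s/2) ∇u, so the coefficient is e^(-s) for |w| and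
    -- e^(-s/2) for |∇w|; their sum serves for both. It decreases in s, hence the bound K at s = a.
    refine eq_zero_of_vanishesToInfiniteOrder (euclideanMetric n) (φ := gaussPotential)
      (C := fun s ↦ |C| * (Real.exp (-s) + Real.exp (-s / 2)))
      (K := |C| * (Real.exp (-a) + Real.exp (-a / 2)))
      contDiff_gaussPotential.contMDiff hw (fun s hs ↦ ⟨?_, ?_⟩) (fun s t hs ↦ ?_)
      (fun s hs ↦ ?_) ?_ (fun x s hs ↦ ?_) (vanishesToInfiniteOrder_selfSimilar hvan) x hs
    · exact memW12_euclideanMetric (hsw s hs) (hgrowth.1 s hs.le).1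
    · refine memW12_euclideanMetric (hswt s hs) ?_
      simpa only [hderiv _ s hs] using (hgrowth.1 s hs.le).2
    · simp only [sobolevSq_euclideanMetric]
      refine lt_of_le_of_lt ?_ (hgrowth.2 t)
      calc _ = ∫⁻ τ in Ioc s t, (gaussSobolevSq (fun x ↦ selfSimilar u x τ) +
            gaussSobolevSq (fun x ↦ derivWithin (fun σ ↦ selfSimilar u x σ) (Ici a) τ)) :=
            setLIntegral_congr_fun measurableSet_Ioc fun τ hτ ↦ by
              simp only [hderiv _ τ (hs.trans hτ.1)]
        _ ≤ _ := lintegral_mono_set (Ioc_subset_Icc_self.trans (Icc_subset_Icc_left hs.le))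
    · gcongr
    -- The square of the coefficient is C² (e^(-2s) + 2 e^(-3s/2) + e^(-s)).
    · have h1 : ∀ b : ℝ, 0 < b → IntegrableOn (fun s ↦ Real.exp (-b * s)) (Ioi a) := fun b hb ↦
        exp_neg_integrableOn_Ioi a hb
      refine (((h1 2 two_pos).add (((h1 (3 / 2) (by norm_num)).const_mul 2).add
        (h1 1 one_pos))).const_mul (C ^ 2)).congr (ae_of_all _ fun s ↦ ?_)
      simp only [Pi.add_apply]
      rw [mul_pow, sq_abs, add_sq, ← Real.exp_nat_mul, ← Real.exp_nat_mul, mul_assoc 2,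
        ← Real.exp_add]
      push_cast
      ring_nf
    · have hmem := neg_exp_neg_mem hT hs
      set y := Real.exp (-s / 2) • x
      set τ := -Real.exp (-s) with hτ
      have h1 := hineq y τ (Ioo_subset_Ico_self hmem)
      rw [derivWithin_of_mem_nhds (Ico_mem_nhds hmem.1 hmem.2), norm_gradient] at h1
      rw [driftLaplacian_euclideanMetric (hsw s hs), deriv_selfSimilar hT hu' hs,
        laplacian_selfSimilar, gradSq_euclideanMetric, Real.sqrt_sq (norm_nonneg _),
        norm_gradient, fderiv_selfSimilar, norm_smul, Real.norm_of_nonneg (Real.exp_pos _).le]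
      -- The two drift terms cancel, leaving e^(-s) (u_t - Δu).
      have h2 : Real.exp (-s) * deriv (u y) τ - (Real.exp (-s / 2) • fderiv ℝ (fun z ↦ u z τ) y) x
          / 2 - (Real.exp (-s) * Laplacian.laplacian (fun z ↦ u z τ) y -
            (Real.exp (-s / 2) • fderiv ℝ (fun z ↦ u z τ) y) x / 2) =
          Real.exp (-s) * (deriv (u y) τ - Laplacian.laplacian (fun z ↦ u z τ) y) := by ring
      rw [h2, norm_mul, Real.norm_of_nonneg (Real.exp_pos _).le]
      have h3 : Real.exp (-s) = Real.exp (-s / 2) * Real.exp (-s / 2) := by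
        rw [← Real.exp_add]; congr 1; ring
      have hC := le_abs_self C
      have hC0 := abs_nonneg C
      have he := Real.exp_pos (-s / 2)
      have hA := abs_nonneg (u y τ)
      have hG := norm_nonneg (fderiv ℝ (fun z ↦ u z τ) y)
      calc Real.exp (-s) * ‖deriv (u y) τ - Laplacian.laplacian (fun z ↦ u z τ) y‖
          ≤ Real.exp (-s) * (|C| * (|u y τ| + ‖fderiv ℝ (fun z ↦ u z τ) y‖)) := by
            refine mul_le_mul_of_nonneg_left (h1.trans ?_) (Real.exp_pos _).le
            gcongr
        _ ≤ |C| * (Real.exp (-s) + Real.exp (-s / 2)) *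
            (|u y τ| + Real.exp (-s / 2) * ‖fderiv ℝ (fun z ↦ u z τ) y‖) := by
            rw [h3]
            -- This quantity is exactly the difference of the two sides.
            have : 0 ≤ |C| * (Real.exp (-s / 2) * |u y τ| +
              Real.exp (-s / 2) * Real.exp (-s / 2) *
                (Real.exp (-s / 2) * ‖fderiv ℝ (fun z ↦ u z τ) y‖)) := by positivity
            linarith
  have hopen : ∀ t ∈ Ioo (-T) 0, u x t = 0 := by
    intro t ht
    have h0 : 0 < -t := by linarith [ht.2]
    have hs : a < -Real.log (-t) := neg_lt_neg (Real.log_lt_log h0 (by linarith [ht.1]))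
    -- Inverting the change of variables: s = -log(-t), at the point e^(s/2) x.
    have h1 := hzero _ hs ((Real.exp (-(-Real.log (-t)) / 2))⁻¹ • x)
    rwa [selfSimilar, smul_inv_smul₀ (Real.exp_pos _).ne', neg_neg, Real.exp_log h0, neg_neg] at h1
  rcases ht.1.lt_or_eq with h | rfl
  · exact hopen t ⟨h, ht.2⟩
  · have hcont : ContinuousOn (fun τ ↦ u x τ) (Ico (-T) 0) :=
      hu.continuousOn.comp (f := fun τ ↦ (x, τ)) (by fun_prop) fun τ hτ ↦ ⟨mem_univ _, hτ⟩
    have h1 : Tendsto (fun τ ↦ u x τ) (𝓝[Ioo (-T) 0] (-T)) (𝓝 (u x (-T))) :=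
      (hcont (-T) ht).mono_left (nhdsWithin_mono _ Ioo_subset_Ico_self)
    rw [nhdsWithin_Ioo_eq_nhdsGT (by linarith)] at h1
    refine tendsto_nhds_unique h1 (tendsto_const_nhds.congr' ?_)
    filter_upwards [Ioo_mem_nhdsGT (by linarith : -T < 0)] with τ hτ
    exact (hopen τ hτ).symm

end SelfSimilar

end DriftHeat

end

theorem corollary3p3 :
    -- Unique continuation at infinity for the drift heat operator on a Riemannian manifold.
    (∀ (n N : ℕ) (M : Type*) [TopologicalSpace M] [T2Space M] [SecondCountableTopology M]
      [ChartedSpace (EuclideanSpace ℝ (Fin n)) M] [IsManifold (𝓡 n) ∞ M]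
      [MeasurableSpace M] [BorelSpace M]
      (g : Bundle.ContMDiffRiemannianMetric (𝓡 n) ∞ (EuclideanSpace ℝ (Fin n))
        (fun x : M ↦ TangentSpace (𝓡 n) x))
      (φ : M → ℝ) (_ : ContMDiff (𝓡 n) 𝓘(ℝ, ℝ) ∞ φ)
      (a : ℝ) (C : ℝ → ℝ) (u : M → ℝ → EuclideanSpace ℝ (Fin N)),
      BddAbove (C '' Ici a) →
      IntegrableOn (fun t ↦ C t ^ 2) (Ici a) →
      ContMDiffOn ((𝓡 n).prod 𝓘(ℝ, ℝ)) 𝓘(ℝ, EuclideanSpace ℝ (Fin N)) ∞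
        (fun p : M × ℝ ↦ u p.1 p.2) (univ ×ˢ Ici a) →
      DriftHeat.SobolevGrowth g.toRiemannianMetric φ a u →
      (∀ x t, a ≤ t →
        ‖DriftHeat.timeDeriv a u x t -
            DriftHeat.driftLaplacian g.toRiemannianMetric φ (fun z ↦ u z t) x‖ ≤
          C t * (‖u x t‖ + √(DriftHeat.gradSq g.toRiemannianMetric (fun z ↦ u z t) x))) →
      DriftHeat.VanishesToInfiniteOrder g.toRiemannianMetric φ u →
      ∀ x t, a ≤ t → u x t = 0) ∧
    -- Unique continuation for the heat operator on Euclidean space, at the space-time origin.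
    (∀ (n : ℕ) (T C : ℝ) (u : EuclideanSpace ℝ (Fin n) → ℝ → ℝ),
      0 < T →
      ContDiffOn ℝ ∞ (fun p : EuclideanSpace ℝ (Fin n) × ℝ ↦ u p.1 p.2) (univ ×ˢ Ico (-T) 0) →
      DriftHeat.GaussGrowth (-Real.log T) (DriftHeat.selfSimilar u) →
      (∀ x, ∀ t ∈ Ico (-T) 0,
        |derivWithin (fun τ ↦ u x τ) (Ico (-T) 0) t - Laplacian.laplacian (fun z ↦ u z t) x| ≤
          C * (|u x t| + ‖gradient (fun z ↦ u z t) x‖)) →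
      (∀ k : ℝ, Tendsto (fun t : ℝ ↦ (-t) ^ (-k) * DriftHeat.poonEnergy u t) (𝓝[<] 0) (𝓝 0)) →
      ∀ x, ∀ t ∈ Ico (-T) 0, u x t = 0) := by
  refine ⟨?_, ?_⟩
  · intro n N M _ _ _ _ _ _ _ g φ hφ a C u hCb hC hu hW hineq hvan x t ht
    exact DriftHeat.eq_zero_of_sobolevGrowth g hφ hCb hC hu hW hineq hvan x ht
  · intro n T C u hT hu hgrowth hineq hvan x t ht
    exact DriftHeat.eq_zero_of_poonEnergy hT hu hgrowth hineq hvan x ht
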